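/- A set system consists of a finite universe $\mathcal E$ and a finite family $\mathcal S$ of subsets of $\mathcal E$ with union $\mathcal E$; sets and elements carry natural-number identifiers. A set cover is a subfamily of $\mathcal S$ with union $\mathcal E$. Let $\mathrm{OPT}(\mathcal S,\mathcal E)$ be the optimal fractional set cover value, i.e. the infimum of $\sum_{S\in\mathcal S}x_S$ over all $x\in\mathbb R_{\ge 0}^{\mathcal S}$ with $\sum_{S\ni e}x_S\ge 1$ for every $e\in\mathcal E$. A neighbor query asks "what is the $i$-th element of the set $S$?" or "what is the $i$-th set containing the element $e$?", where the elements of each set and the sets containing each element are listed in an arbitrary order, and the reply says so if there is no $i$-th one. A local computation algorithm (LCA) for set cover is an algorithm that is given $s$, $t$ and the identifier of a set $S\in\mathcal S$, can adaptively make neighbor queries to the input and read bits of an infinite tape of independent fair random bits, and answers yes or no; no state other than the tape is shared between different calls. Theorem. There are a constant $C>0$ and an LCA such that the following holds for all integers $s,t\ge 2$ and every set system $(\mathcal S,\mathcal E)$ in which every set has at most $s$ elements and every element lies in at most $t$ sets. There is a set cover $\mathcal C=\mathcal C(\omega)$, depending only on $(\mathcal S,\mathcal E)$ (with its identifiers),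 $s$, $t$ and the random tape $\omega$, such that for every tape $\omega$ and every $S\in\mathcal S$ the LCA, asked about $S$, makes at most $$s^{\,C\log_2 s}\cdot t^{\,C\log_2 s\cdot(\log_2\log_2 s+\log_2\log_2 t)}$$ neighbor queries and correctly answers whether $S\in\mathcal C(\omega)$, whatever the order of the neighbor lists; and $$\mathbb E_\omega\big[|\mathcal C(\omega)|\big]\le C\log_2 s\cdot \mathrm{OPT}(\mathcal S,\mathcal E).$$ -/

import Mathlib

/-- A finite set system. Sets and elements carry natural-number identifiers, `elts S` is the set of
elements of the set with identifier `S` (only meaningful for `S ∈ sets`), and the union of all sets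
is the universe `univ`. -/
structure SetSystem where
  sets : Finset ℕ
  univ : Finset ℕ
  elts : ℕ → Finset ℕ
  elts_subset : ∀ S ∈ sets, elts S ⊆ univ
  exists_mem : ∀ e ∈ univ, ∃ S ∈ sets, e ∈ elts S

namespace SetSystem

/-- The sets containing the element `e`. -/
def setsOf (I : SetSystem) (e : ℕ) : Finset ℕ := {S ∈ I.sets | e ∈ I.elts S}

/-- Every set has at most `s` elements and every element lies in at most `t` sets. -/
def Bounded (I : SetSystem) (s t : ℕ) : Prop :=
  (∀ S ∈ I.sets, (I.elts S).card ≤ s) ∧ ∀ e ∈ I.univ, (I.setsOf e).card ≤ t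

/-- `D` is a set cover: a subfamily whose union is the universe. -/
def IsCover (I : SetSystem) (D : Finset ℕ) : Prop :=
  D ⊆ I.sets ∧ ∀ e ∈ I.univ, ∃ S ∈ D, e ∈ I.elts S

/-- `x` is a fractional set cover: a nonnegative weighting of the sets which gives total weight at
least one to the sets containing any given element. -/
def IsFractionalCover (I : SetSystem) (x : ℕ → ℝ) : Prop :=
  (∀ S ∈ I.sets, 0 ≤ x S) ∧ ∀ e ∈ I.univ, 1 ≤ ∑ S ∈ I.setsOf e, x S

/-- The optimal fractional set cover value. -/
noncomputable def opt (I : SetSystem) : ℝ :=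
  sInf {v : ℝ | ∃ x : ℕ → ℝ, I.IsFractionalCover x ∧ v = ∑ S ∈ I.sets, x S}

/-- A bipartite adjacency-list representation of a set system, with the neighbors of each set and
of each element listed in an arbitrary order. Identifiers that are not in use have an empty list. -/
structure Representation (I : SetSystem) where
  setList : ℕ → List ℕ
  elemList : ℕ → List ℕ
  setList_nodup : ∀ S, (setList S).Nodup
  elemList_nodup : ∀ e, (elemList e).Nodup
  mem_setList : ∀ S e, e ∈ setList S ↔ S ∈ I.sets ∧ e ∈ I.elts S
  mem_elemList : ∀ e S, S ∈ elemList e ↔ S ∈ I.sets ∧ e ∈ I.elts S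

end SetSystem

/-- What a local algorithm can do next. -/
inductive LCAAction where
  /-- the neighbor query: what is the `i`-th element of the set `S`? (counting from `0`) -/
  | querySet (S i : ℕ)
  /-- the neighbor query: what is the `i`-th set containing the element `e`? (counting from `0`) -/
  | queryElem (e i : ℕ)
  /-- read the `j`-th bit of the random tape -/
  | readBit (j : ℕ)
  /-- stop and answer `b` -/
  | answer (b : Bool)

namespace LCAAction

/-- Actions as a sum of standard types, used only to transport their standard coding. -/
def equivSum : LCAAction ≃ (ℕ × ℕ) ⊕ (ℕ × ℕ) ⊕ ℕ ⊕ Bool where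
  toFun
    | querySet S i => .inl (S, i)
    | queryElem e i => .inr (.inl (e, i))
    | readBit j => .inr (.inr (.inl j))
    | answer b => .inr (.inr (.inr b))
  invFun
    | .inl (S, i) => querySet S i
    | .inr (.inl (e, i)) => queryElem e i
    | .inr (.inr (.inl j)) => readBit j
    | .inr (.inr (.inr b)) => answer b
  left_inv a := by cases a <;> rfl
  right_inv a := by rcases a with _ | _ | _ | _ <;> rfl

instance primcodable : Primcodable LCAAction := Primcodable.ofEquiv _ equivSum

end LCAAction

/-- A local computation algorithm. It is given the parameters `s` and `t` and the identifier `S` of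
the set it is asked about; its next action is a computable function of these and of the list of
the responses it has received so far (its working memory). It knows nothing else about the input,
and nothing is carried over from one call to another. -/
structure LocalAlgorithm where
  next : (s t S : ℕ) → List (Option ℕ) → LCAAction
  computable :
    Computable fun p : ℕ × ℕ × ℕ × List (Option ℕ) => next p.1 p.2.1 p.2.2.1 p.2.2.2

namespace LocalAlgorithm

/-- `A.Run s t S R ω h q b`: on input representation `R` and random tape `ω`, the algorithm `A`,
called with parameters `s`, `t` on the set `S` and having received the responses `h`, will stop
after making exactly `q` further neighbor queries and answer `b`. The response to a query for the
`i`-th neighbor is `none` if there are at most `i` neighbors. -/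
inductive Run (A : LocalAlgorithm) (s t S : ℕ) {I : SetSystem} (R : I.Representation)
    (ω : ℕ → Bool) : List (Option ℕ) → ℕ → Bool → Prop
  | answer {h : List (Option ℕ)} {b : Bool} (ha : A.next s t S h = .answer b) :
      Run A s t S R ω h 0 b
  | querySet {h : List (Option ℕ)} {S' i q : ℕ} {b : Bool} (ha : A.next s t S h = .querySet S' i)
      (hr : Run A s t S R ω (h ++ [(R.setList S')[i]?]) q b) : Run A s t S R ω h (q + 1) b
  | queryElem {h : List (Option ℕ)} {e i q : ℕ} {b : Bool} (ha : A.next s t S h = .queryElem e i)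
      (hr : Run A s t S R ω (h ++ [(R.elemList e)[i]?]) q b) : Run A s t S R ω h (q + 1) b
  | readBit {h : List (Option ℕ)} {j q : ℕ} {b : Bool} (ha : A.next s t S h = .readBit j)
      (hr : Run A s t S R ω (h ++ [some (ω j).toNat]) q b) : Run A s t S R ω h q b

/-- On the representation `R` and the tape `ω`, and called with parameters `s`, `t` on the set `S`,
the algorithm `A` stops after making at most `Q` neighbor queries, and answers `b`. -/
def Answers (A : LocalAlgorithm) (s t S : ℕ) {I : SetSystem} (R : I.Representation)
    (ω : ℕ → Bool) (Q : ℝ) (b : Bool) : Prop :=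
  ∃ q : ℕ, A.Run s t S R ω [] q b ∧ (q : ℝ) ≤ Q

end LocalAlgorithm

/-- The law of the random tape: independent fair bits. -/
noncomputable def tapeMeasure : MeasureTheory.Measure (ℕ → Bool) :=
  MeasureTheory.Measure.infinitePi fun _ => (PMF.uniformOfFintype Bool).toMeasure

/-- The query bound `s ^ (C log s) * t ^ (C log s (log log s + log log t))`, with binary
logarithms. -/
noncomputable def queryBound (C : ℝ) (s t : ℕ) : ℝ :=
  (s : ℝ) ^ (C * Real.logb 2 s) *
    (t : ℝ) ^ (C * (Real.logb 2 s * (Real.logb 2 (Real.logb 2 s) + Real.logb 2 (Real.logb 2 t))))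

/-! The cover comes from a parallel greedy algorithm. Its levels run from about `log s` down to `0`,
one stage per level, and a stage has `T + 1` rounds with `t ≤ 2 ^ T`. Each stage starts with all
sets in the race. In each round a set stays in only if it holds at least `thr` counted uncovered
elements, elements being counted so that `2 ^ level` uncovered ones yield `thr` on average. The
survivors of round `j` of the stage join with probability `2 ^ -(T - j)`, which doubles up to one.

Size. The unit cost of a joining set is spread over its counted uncovered elements. Suppose `d`
surviving sets contain an uncovered `e` and each joins with probability `p`. Then `d p (1 - p) ^ d ≤
1 - (1 - p) ^ d` compares the charge to `e` in the next round with the probability that `e` is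
covered now (`joinProb_mul_mean_le_succ`), and the sum telescopes (`mean_joined_stage_le`). A stage
thus costs at most `3 * 2 ^ -level` per element uncovered at its start. A set with many uncovered
elements passes every test with high probability and joins in the last round
(`pr_liveElts_stage_le`), so an average set receives `O(1)` charge per stage. The charges divided by
`O(log s)` are feasible for the dual program, and weak duality (`sum_le_mul_opt`) gives the bound.

Simulation. Whether `e` is uncovered is decided by recursion on rounds. Two lists are kept short.
Only sets whose join coin for the current round shows `true` are followed through the earlier rounds
of the stage, and around an uncovered element they are few (`pr_hitList_le`). A test asks about the
current round only for counted elements that were uncovered at the stage start (`pr_preSample_le`).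
The simulation gives up when a list is too long, so the query bound holds on every tape. The
recursion costs a factor `2 ^ O(ℓ)` per round and a further factor `s + t + 2` per stage
(`costBound`), where `2 ^ ℓ` is polynomial in `log s + log t`.

Giving up. A set on which the simulation gives up is put into the cover, so the answers are exact
(`evLe_top`). An elementary overflow has probability about `2 ^ -2 ^ ℓ`, which beats the union bound
over the whole recursion (`pr_failSet_le`, `Schedule.failBound_le`), so these sets add only a
constant charge per set. -/

open Finset

namespace LocalSetCover

/-! ### Iterated averages over independent biased coins -/

section Average

variable {κ : Type*} [DecidableEq κ] (p : κ → ℝ)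

/-- The average of `f` over the coin `k`, which shows `true` with probability `p k`. -/
def avg (k : κ) (f : (κ → Bool) → ℝ) : (κ → Bool) → ℝ := fun x =>
  p k * f (Function.update x k true) + (1 - p k) * f (Function.update x k false)

/-- The average of `f` over the coins in the list `l`. -/
def expect (l : List κ) (f : (κ → Bool) → ℝ) : (κ → Bool) → ℝ := l.foldr (avg p) f

variable {p}

@[simp] lemma expect_nil (f : (κ → Bool) → ℝ) : expect p [] f = f := rfl

lemma expect_cons (k : κ) (l : List κ) (f : (κ → Bool) → ℝ) :
    expect p (k :: l) f = avg p k (expect p l f) := rfl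

lemma expect_add (l : List κ) (f g : (κ → Bool) → ℝ) (x : κ → Bool) :
    expect p l (fun y => f y + g y) x = expect p l f x + expect p l g x := by
  induction l generalizing x with
  | nil => rfl
  | cons k l ih => simp only [expect_cons, avg, ih]; ring

lemma expect_const_mul (l : List κ) (c : ℝ) (f : (κ → Bool) → ℝ) (x : κ → Bool) :
    expect p l (fun y => c * f y) x = c * expect p l f x := by
  induction l generalizing x with
  | nil => rfl
  | cons k l ih => simp only [expect_cons, avg, ih]; ring

lemma expect_const (l : List κ) (c : ℝ) (x : κ → Bool) : expect p l (fun _ => c) x = c := by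
  induction l generalizing x with
  | nil => rfl
  | cons k l ih => simp only [expect_cons, avg, ih]; ring

lemma expect_sub (l : List κ) (f g : (κ → Bool) → ℝ) (x : κ → Bool) :
    expect p l (fun y => f y - g y) x = expect p l f x - expect p l g x := by
  have := expect_add (p := p) l f (fun y => (-1) * g y) x
  rw [expect_const_mul] at this
  rw [show (fun y => f y - g y) = fun y => f y + (-1) * g y by funext y; ring, this]; ring

lemma expect_sum {ι : Type*} (l : List κ) (s : Finset ι) (f : ι → (κ → Bool) → ℝ) (x : κ → Bool) :
    expect p l (fun y => ∑ i ∈ s, f i y) x = ∑ i ∈ s, expect p l (f i) x := by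
  classical
  induction s using Finset.induction_on with
  | empty => simp [expect_const]
  | insert a s ha ih => simp only [Finset.sum_insert ha, expect_add, ih]

/-- Two functions that agree at all points that agree with `x` off `l` have the same average over
`l` at `x`. -/
lemma expect_congr (l : List κ) {f g : (κ → Bool) → ℝ} {x : κ → Bool}
    (h : ∀ y, (∀ k, k ∉ l → y k = x k) → f y = g y) : expect p l f x = expect p l g x := by
  induction l generalizing x with
  | nil => exact h x fun _ _ => rfl
  | cons k l ih =>
    simp only [expect_cons, avg]
    have key : ∀ b, expect p l f (Function.update x k b) = expect p l g (Function.update x k b) := by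
      refine fun b => ih fun y hy => h y fun k' hk' => ?_
      simp only [List.mem_cons, not_or] at hk'
      rw [hy k' hk'.2, Function.update_of_ne hk'.1]
    rw [key, key]

lemma expect_eq_of_forall (l : List κ) {f : (κ → Bool) → ℝ} {x : κ → Bool} {c : ℝ}
    (h : ∀ y, (∀ k, k ∉ l → y k = x k) → f y = c) : expect p l f x = c := by
  rw [expect_congr l (g := fun _ => c) h, expect_const]

lemma expect_mono (hp : ∀ k, 0 ≤ p k ∧ p k ≤ 1) (l : List κ) {f g : (κ → Bool) → ℝ} {x : κ → Bool}
    (h : ∀ y, (∀ k, k ∉ l → y k = x k) → f y ≤ g y) : expect p l f x ≤ expect p l g x := by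
  induction l generalizing x with
  | nil => exact h x fun _ _ => rfl
  | cons k l ih =>
    simp only [expect_cons, avg]
    have key : ∀ b, expect p l f (Function.update x k b) ≤ expect p l g (Function.update x k b) := by
      refine fun b => ih fun y hy => h y fun k' hk' => ?_
      simp only [List.mem_cons, not_or] at hk'
      rw [hy k' hk'.2, Function.update_of_ne hk'.1]
    exact add_le_add (mul_le_mul_of_nonneg_left (key _) (hp k).1)
      (mul_le_mul_of_nonneg_left (key _) (sub_nonneg.2 (hp k).2))

lemma expect_nonneg (hp : ∀ k, 0 ≤ p k ∧ p k ≤ 1) (l : List κ) {f : (κ → Bool) → ℝ}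
    (h : ∀ y, 0 ≤ f y) (x : κ → Bool) : 0 ≤ expect p l f x := by
  rw [← expect_const (p := p) l 0 x]; exact expect_mono hp l fun y _ => h y

lemma avg_comm (k k' : κ) (f : (κ → Bool) → ℝ) :
    avg p k (avg p k' f) = avg p k' (avg p k f) := by
  rcases eq_or_ne k k' with rfl | h
  · rfl
  · funext x
    simp only [avg, Function.update_comm h]; ring

lemma avg_idem (k : κ) (f : (κ → Bool) → ℝ) : avg p k (avg p k f) = avg p k f := by
  funext x
  simp only [avg, Function.update_idem]; ring

lemma expect_avg (l : List κ) (k : κ) (f : (κ → Bool) → ℝ) :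
    expect p l (avg p k f) = avg p k (expect p l f) := by
  induction l with
  | nil => rfl
  | cons k' l ih => rw [expect_cons, ih, avg_comm, expect_cons]

/-- Averages over different coins commute and a repeated average is absorbed. Hence a chosen group
of coins can be integrated out first, which is how independence is used later. -/
lemma expect_avg_of_mem {l : List κ} {k : κ} (hk : k ∈ l) (f : (κ → Bool) → ℝ) :
    expect p l (avg p k f) = expect p l f := by
  induction l with
  | nil => simp at hk
  | cons k' l ih =>
    rw [expect_cons, expect_cons]
    rcases List.mem_cons.1 hk with rfl | h
    · rw [expect_avg, avg_idem]
    · rw [ih h]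

/-- Averaging first over some of the coins does not change the full average. -/
lemma expect_expect {l l' : List κ} (h : l' ⊆ l) (f : (κ → Bool) → ℝ) :
    expect p l (expect p l' f) = expect p l f := by
  induction l' with
  | nil => rfl
  | cons k l' ih =>
    rw [expect_cons, expect_avg_of_mem (h List.mem_cons_self), ih fun a ha => h (List.mem_cons_of_mem _ ha)]

/-- The average of a product of functions of different coins. -/
lemma expect_prod {ι : Type*} [DecidableEq ι] (s : Finset ι) (key : ι → κ)
    (hkey : Function.Injective key) (g : ι → Bool → ℝ) (x : κ → Bool) :
    expect p (s.toList.map key) (fun y => ∏ i ∈ s, g i (y (key i))) x =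
      ∏ i ∈ s, (p (key i) * g i true + (1 - p (key i)) * g i false) := by
  suffices H : ∀ l : List ι, l.Nodup → ∀ x,
      expect p (l.map key) (fun y => (l.map fun i => g i (y (key i))).prod) x =
        (l.map fun i => (p (key i) * g i true + (1 - p (key i)) * g i false)).prod by
    simpa [Finset.prod_map_toList] using H s.toList s.nodup_toList x
  intro l
  induction l with
  | nil => intro _ x; simp
  | cons i l ih =>
    intro hl x
    obtain ⟨hi, hl⟩ := List.nodup_cons.1 hl
    simp only [List.map_cons, expect_cons, avg, List.prod_cons]
    have key : ∀ b, expect p (l.map key) (fun y => g i (y (key i)) *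
        (l.map fun i => g i (y (key i))).prod) (Function.update x (key i) b) =
        g i b * (l.map fun i => (p (key i) * g i true + (1 - p (key i)) * g i false)).prod := by
      intro b
      rw [expect_congr (g := fun y => g i b * (l.map fun i => g i (y (key i))).prod),
        expect_const_mul, ih hl]
      intro y hy
      rw [hy (key i), Function.update_self]
      simpa [hkey.eq_iff] using hi
    rw [key, key]; ring

end Average

end LocalSetCover

open Finset

namespace LocalSetCover

/-! ### Biased coins on the random tape -/

section Tape

open MeasureTheory

/-- `G` depends only on the tape positions in `J`. -/
def TapeLocal {α : Type*} (J : Finset ℕ) (G : (ℕ → Bool) → α) : Prop :=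
  ∀ ω ω' : ℕ → Bool, (∀ n ∈ J, ω n = ω' n) → G ω = G ω'

instance : IsProbabilityMeasure tapeMeasure := by
  unfold tapeMeasure; infer_instance

/-- `G` factors through the finite space of bit patterns on `J`, where everything is integrable. -/
lemma TapeLocal.integrable {J : Finset ℕ} {G : (ℕ → Bool) → ℝ} (h : TapeLocal J G) :
    Integrable G tapeMeasure := by
  classical
  have hG : G = (fun z : J → Bool => G fun n => if hn : n ∈ J then z ⟨n, hn⟩ else false) ∘
      (fun ω : ℕ → Bool => fun n : J => ω n) := by
    funext ω
    exact h _ _ fun n hn => by simp [hn]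
  have hm : Measurable (fun ω : ℕ → Bool => fun n : J => ω n) := by fun_prop
  rw [hG]
  have : IsFiniteMeasure (tapeMeasure.map (fun ω : ℕ → Bool => fun n : J => ω n)) :=
    Measure.isFiniteMeasure_map _ _
  exact (Integrable.of_finite (μ := tapeMeasure.map (fun ω : ℕ → Bool => fun n : J => ω n))).comp_measurable hm

/-- Resampling one bit preserves the law: a product measure is determined by its values on finite
boxes, and there only the condition at `n` changes. This turns integrals into iterated averages, one
bit at a time. -/
lemma tapeMeasure_eq_average (n : ℕ) :
    (2⁻¹ : ENNReal) • tapeMeasure.map (fun ω => Function.update ω n true) +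
      (2⁻¹ : ENNReal) • tapeMeasure.map (fun ω => Function.update ω n false) = tapeMeasure := by
  classical
  have hm : ∀ b, Measurable (fun ω : ℕ → Bool => Function.update ω n b) := fun b =>
    measurable_update_left
  unfold tapeMeasure
  refine Measure.eq_infinitePi _ fun s t ht => ?_
  have hbit : ∀ u : Set Bool, (PMF.uniformOfFintype Bool).toMeasure u =
      2⁻¹ * u.indicator 1 true + 2⁻¹ * u.indicator 1 false := by
    intro u
    rw [PMF.toMeasure_apply_fintype]
    simp [Set.indicator_apply]
  have hpi : MeasurableSet ((s : Set ℕ).pi t) :=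
    MeasurableSet.pi (Finset.countable_toSet s) fun i _ => ht i
  have hset : ∀ b, (fun ω : ℕ → Bool => Function.update ω n b) ⁻¹' (s : Set ℕ).pi t =
      if n ∈ s → b ∈ t n then ((s.erase n : Finset ℕ) : Set ℕ).pi t else ∅ := by
    intro b
    ext ω
    simp only [Set.mem_preimage, Set.mem_pi, Finset.mem_coe]
    split_ifs with h
    · simp only [Set.mem_pi, Finset.mem_coe, Finset.mem_erase]
      constructor
      · intro H i hi
        have := H i hi.2
        rwa [Function.update_of_ne hi.1] at this
      · intro H i hi
        rcases eq_or_ne i n with rfl | hin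
        · rw [Function.update_self]; exact h hi
        · rw [Function.update_of_ne hin]; exact H i ⟨hin, hi⟩
    · simp only [Set.mem_empty_iff_false, iff_false]
      push Not at h
      intro H
      have := H n h.1
      rw [Function.update_self] at this
      exact h.2 this
  simp only [Measure.add_apply, Measure.smul_apply, smul_eq_mul]
  rw [Measure.map_apply (hm _) hpi, Measure.map_apply (hm _) hpi, hset, hset]
  by_cases hn : n ∈ s
  · rw [← Finset.mul_prod_erase s _ hn, hbit]
    simp only [hn, true_imp_iff]
    have := Measure.infinitePi_pi (fun _ : ℕ => (PMF.uniformOfFintype Bool).toMeasure)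
      (s := s.erase n) (t := t) fun i _ => ht i
    by_cases h1 : true ∈ t n <;> by_cases h2 : false ∈ t n <;>
      simp only [h1, h2, this, if_true, if_false, measure_empty, Set.indicator_of_mem,
        Set.indicator_of_notMem, not_false_eq_true, Pi.one_apply, mul_one, mul_zero, add_zero,
        zero_add, zero_mul, add_mul]
  · simp only [hn, false_imp_iff, if_true, Finset.erase_eq_of_notMem hn]
    rw [Measure.infinitePi_pi _ fun i _ => ht i, ← add_mul, ENNReal.inv_two_add_inv_two, one_mul]

lemma TapeLocal.comp_update {α : Type*} {J : Finset ℕ} {G : (ℕ → Bool) → α} (h : TapeLocal J G)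
    (n : ℕ) (b : Bool) : TapeLocal J fun ω => G (Function.update ω n b) := by
  intro ω ω' hω
  refine h _ _ fun m hm => ?_
  rcases eq_or_ne m n with rfl | hne
  · simp
  · simp [hne, hω m hm]

lemma TapeLocal.avg {J : Finset ℕ} {G : (ℕ → Bool) → ℝ} (h : TapeLocal J G) (q : ℕ → ℝ) (n : ℕ) :
    TapeLocal J (avg q n G) := by
  intro ω ω' hω
  have key : ∀ b, G (Function.update ω n b) = G (Function.update ω' n b) := fun b =>
    h.comp_update n b ω ω' hω
  simp only [LocalSetCover.avg, key]

lemma TapeLocal.integral_avg {J : Finset ℕ} {G : (ℕ → Bool) → ℝ} (h : TapeLocal J G) (n : ℕ) :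
    ∫ ω, G ω ∂tapeMeasure = ∫ ω, LocalSetCover.avg (fun _ => 1 / 2) n G ω ∂tapeMeasure := by
  have hm : ∀ b, Measurable (fun ω : ℕ → Bool => Function.update ω n b) := fun b =>
    measurable_update_left
  have hG_int : ∀ b, Integrable G (tapeMeasure.map fun ω => Function.update ω n b) := by
    intro b
    have h1 : Integrable G tapeMeasure := h.integrable
    rw [← tapeMeasure_eq_average n] at h1
    have := (integrable_add_measure.1 h1)
    cases b
    · exact (integrable_smul_measure (by simp) (by simp)).1 this.2
    · exact (integrable_smul_measure (by simp) (by simp)).1 this.1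
  conv_lhs => rw [← tapeMeasure_eq_average n]
  rw [integral_add_measure ((hG_int _).smul_measure (by simp)) ((hG_int _).smul_measure (by simp)),
    integral_smul_measure, integral_smul_measure,
    integral_map (hm _).aemeasurable (hG_int _).aestronglyMeasurable,
    integral_map (hm _).aemeasurable (hG_int _).aestronglyMeasurable]
  simp only [LocalSetCover.avg]
  rw [integral_add ((h.comp_update n true).integrable.const_mul _)
    ((h.comp_update n false).integrable.const_mul _), integral_const_mul, integral_const_mul]
  norm_num

lemma TapeLocal.expect {J : Finset ℕ} {G : (ℕ → Bool) → ℝ} (h : TapeLocal J G) (q : ℕ → ℝ)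
    (l : List ℕ) : TapeLocal J (expect q l G) := by
  induction l with
  | nil => exact h
  | cons n l ih => exact ih.avg q n

lemma TapeLocal.integral_expect {J : Finset ℕ} {G : (ℕ → Bool) → ℝ} (h : TapeLocal J G)
    (l : List ℕ) :
    ∫ ω, G ω ∂tapeMeasure = ∫ ω, LocalSetCover.expect (fun _ => 1 / 2) l G ω ∂tapeMeasure := by
  induction l with
  | nil => rfl
  | cons n l ih => rw [ih, expect_cons]; exact (h.expect _ l).integral_avg n

/-- The average over fair bits of a function of their conjunction. -/
lemma expect_half_forall (l : List ℕ) (hl : l.Nodup) (A B : ℝ) (ω : ℕ → Bool) :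
    expect (fun _ => 1 / 2) l (fun ω => if ∀ n ∈ l, ω n = true then A else B) ω =
      (1 / 2) ^ l.length * A + (1 - (1 / 2) ^ l.length) * B := by
  induction l generalizing ω with
  | nil => simp
  | cons n l ih =>
    obtain ⟨hn, hl⟩ := List.nodup_cons.1 hl
    rw [expect_cons]
    simp only [avg]
    rw [expect_congr l (x := Function.update ω n true)
        (g := fun ω => if ∀ n ∈ l, ω n = true then A else B), ih hl,
      expect_eq_of_forall l (x := Function.update ω n false) (c := B), List.length_cons]
    · ring
    · intro y hy
      rw [if_neg]
      intro H
      have := H n List.mem_cons_self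
      rw [hy n hn] at this
      simp at this
    · intro y hy
      have : y n = true := by rw [hy n hn]; simp
      simp [this]

variable {κ : Type*} [DecidableEq κ] (expo : κ → ℕ) (pos : κ → ℕ → ℕ)

/-- The coins read off the tape: the coin `k` is the conjunction of `expo k` tape bits. -/
def coins (ω : ℕ → Bool) (k : κ) : Bool := decide (∀ r < expo k, ω (pos k r) = true)

variable {pos}

/-- The law of the coins. -/
lemma integral_coins (hpos : ∀ k r k' r', pos k r = pos k' r' → k = k' ∧ r = r') (l : List κ)
    (F : (κ → Bool) → ℝ) (hF : ∀ x y, (∀ k ∈ l, x k = y k) → F x = F y) (x₀ : κ → Bool) :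
    Integrable (fun ω => F (coins expo pos ω)) tapeMeasure ∧
      ∫ ω, F (coins expo pos ω) ∂tapeMeasure = expect (fun k => (1 / 2) ^ expo k) l F x₀ := by
  classical
  set J : Finset ℕ := l.toFinset.biUnion fun k => (range (expo k)).image (pos k) with hJ
  have hloc : ∀ F : (κ → Bool) → ℝ, (∀ x y, (∀ k ∈ l, x k = y k) → F x = F y) →
      TapeLocal J (fun ω => F (coins expo pos ω)) := by
    intro F hF ω ω' h
    refine hF _ _ fun k hk => ?_
    have : ∀ r < expo k, ω (pos k r) = ω' (pos k r) := fun r hr => h _ <| by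
      simp only [hJ, mem_biUnion, List.mem_toFinset, mem_image, Finset.mem_range]
      exact ⟨k, hk, r, hr, rfl⟩
    simp only [coins]
    congr 1
    refine propext (forall₂_congr fun r hr => by rw [this r hr])
  -- Averaging over the bits of the coin `k` amounts to averaging over that coin, since the tape
  -- positions of different coins are disjoint and the other coins stay fixed.
  have hstep : ∀ (F : (κ → Bool) → ℝ) (_ : ∀ x y, (∀ k ∈ l, x k = y k) → F x = F y) (k : κ),
      ∫ ω, F (coins expo pos ω) ∂tapeMeasure =
        ∫ ω, avg (fun k => (1 / 2) ^ expo k) k F (coins expo pos ω) ∂tapeMeasure := by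
    intro F hF k
    set b : List ℕ := (List.range (expo k)).map (pos k) with hb
    have hbn : b.Nodup := List.Nodup.map (fun r r' h => (hpos _ _ _ _ h).2) List.nodup_range
    rw [(hloc F hF).integral_expect b]
    congr 1
    funext ω
    rw [expect_congr b (g := fun y => if ∀ n ∈ b, y n = true then
        F (Function.update (coins expo pos ω) k true) else
        F (Function.update (coins expo pos ω) k false)), expect_half_forall b hbn]
    · simp [avg, hb]
    · intro y hy
      have hother : ∀ k', k' ≠ k → coins expo pos y k' = coins expo pos ω k' := by
        intro k' hk'
        simp only [coins]
        congr 1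
        refine propext (forall₂_congr fun r _ => ?_)
        rw [hy]
        simp only [hb, List.mem_map, not_exists, not_and]
        intro r' _ h
        exact hk' (hpos _ _ _ _ h).1.symm
      have hself : coins expo pos y k = decide (∀ n ∈ b, y n = true) := by
        simp [coins, hb]
      have : coins expo pos y =
          Function.update (coins expo pos ω) k (decide (∀ n ∈ b, y n = true)) := by
        funext k'
        rcases eq_or_ne k' k with rfl | hk'
        · rw [Function.update_self, hself]
        · rw [Function.update_of_ne hk', hother k' hk']
      rw [this]
      by_cases h : ∀ n ∈ b, y n = true
      · simp only [if_pos h, decide_eq_true h]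
      · simp only [if_neg h, decide_eq_false h]
  have hloc' : ∀ (l' : List κ) x y, (∀ k ∈ l, x k = y k) →
      expect (fun k => (1 / 2) ^ expo k) l' F x = expect (fun k => (1 / 2) ^ expo k) l' F y := by
    intro l'
    induction l' with
    | nil => exact hF
    | cons k l' ih =>
      intro x y h
      simp only [expect_cons, avg]
      have : ∀ b, expect (fun k => (1 / 2) ^ expo k) l' F (Function.update x k b) =
          expect (fun k => (1 / 2) ^ expo k) l' F (Function.update y k b) := by
        refine fun b => ih _ _ fun k' hk' => ?_
        rcases eq_or_ne k' k with rfl | hne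
        · simp
        · simp [hne, h k' hk']
      rw [this, this]
  refine ⟨(hloc F hF).integrable, ?_⟩
  have hall : ∀ l' : List κ, ∫ ω, F (coins expo pos ω) ∂tapeMeasure =
      ∫ ω, expect (fun k => (1 / 2) ^ expo k) l' F (coins expo pos ω) ∂tapeMeasure := by
    intro l'
    induction l' with
    | nil => rfl
    | cons k l' ih => rw [ih, expect_cons]; exact hstep _ (hloc' l') k
  rw [hall l]
  -- All coins that `F` depends on have been averaged out, so the base point is irrelevant.
  have hconst : ∀ x, expect (fun k => (1 / 2) ^ expo k) l F x =
      expect (fun k => (1 / 2) ^ expo k) l F x₀ := by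
    have gen : ∀ l' : List κ, ∀ x y, (∀ k ∈ l, k ∉ l' → x k = y k) →
        expect (fun k => (1 / 2) ^ expo k) l' F x = expect (fun k => (1 / 2) ^ expo k) l' F y := by
      intro l'
      induction l' with
      | nil => exact fun x y h => hF x y fun k hk => h k hk List.not_mem_nil
      | cons k l' ih =>
        intro x y h
        simp only [expect_cons, avg]
        have : ∀ b, expect (fun k => (1 / 2) ^ expo k) l' F (Function.update x k b) =
            expect (fun k => (1 / 2) ^ expo k) l' F (Function.update y k b) := by
          refine fun b => ih _ _ fun k' hk' hkl => ?_
          rcases eq_or_ne k' k with rfl | hne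
          · simp
          · simp [hne, h k' hk' (by simp [hne, hkl])]
        rw [this, this]
    exact fun x => gen l x x₀ fun k hk hk' => absurd hk hk'
  simp only [hconst, integral_const, probReal_univ, one_smul]

end Tape

end LocalSetCover

open Finset

namespace LocalSetCover

/-! ### The parallel algorithm -/

/-- The parameters of the parallel algorithm. There are `L + 1` stages of `T + 1` rounds each. -/
structure Schedule where
  L : ℕ
  T : ℕ
  ℓ : ℕ

/-- The coin `(true, S, τ)` decides whether the set `S` may join the cover in round `τ`, the coin
`(false, e, τ)` whether the element `e` is counted in round `τ`. -/
abbrev Key := Bool × ℕ × ℕ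

namespace Schedule

variable (P : Schedule)

/-- The number of the round within its stage. -/
def round (τ : ℕ) : ℕ := τ % (P.T + 1)

/-- The first round of the stage. -/
def start (τ : ℕ) : ℕ := τ - τ % (P.T + 1)

/-- The level of a stage: it treats sets with about `2 ^ level` uncovered elements. -/
def level (τ : ℕ) : ℕ := P.L - τ / (P.T + 1)

/-- A coin shows `true` with probability `2 ^ (- expo)`. -/
def expo (k : Key) : ℕ := if k.1 then P.T - P.round k.2.2 else P.level k.2.2 - P.ℓ

/-- The number of counted uncovered elements that a set needs to stay in the race. -/
def thr (τ : ℕ) : ℕ := 2 ^ min (P.level τ) P.ℓ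

/-- The allowed number of sets that may join `d` rounds later and contain a given uncovered element.
The typical number is of order `2 ^ d`; the extra factor `2 ^ (ℓ + 1)` makes an overflow doubly
exponentially unlikely in `ℓ`. -/
def cap (d : ℕ) : ℕ := 2 ^ (P.ℓ + 1 + d)

/-- A typical set enters a stage with at most `2 ^ (level + 3)` uncovered elements, so at most `8 *
2 ^ ℓ` are counted on average. The exponential moment with base `2` is then at most `2 ^ (16 * 2 ^
ℓ)`, and `17` in place of `16` leaves a tail of `2 ^ -2 ^ ℓ`. -/
def maxSample : ℕ := 17 * 2 ^ P.ℓ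

def numRounds : ℕ := (P.L + 1) * (P.T + 1)

noncomputable def prob (k : Key) : ℝ := (1 / 2) ^ P.expo k

/-- The outcome of a coin; coins of probability one show `true`. -/
def coin (x : Key → Bool) (k : Key) : Bool := decide (P.expo k = 0) || x k

lemma prob_nonneg (k : Key) : 0 ≤ P.prob k := by unfold prob; positivity

lemma prob_le_one (k : Key) : P.prob k ≤ 1 := pow_le_one₀ (by norm_num) (by norm_num)

lemma prob_bounds (k : Key) : 0 ≤ P.prob k ∧ P.prob k ≤ 1 := ⟨P.prob_nonneg k, P.prob_le_one k⟩

lemma prob_of_expo_eq_zero {k : Key} (h : P.expo k = 0) : P.prob k = 1 := by simp [prob, h]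

lemma coin_congr {x y : Key → Bool} {k : Key} (h : x k = y k) : P.coin x k = P.coin y k := by
  simp [coin, h]

lemma start_add_round (τ : ℕ) : P.start τ + P.round τ = τ :=
  Nat.sub_add_cancel (Nat.mod_le _ _)

lemma start_le (τ : ℕ) : P.start τ ≤ τ := Nat.sub_le _ _

lemma round_le (τ : ℕ) : P.round τ ≤ P.T := Nat.lt_succ_iff.1 (Nat.mod_lt _ (Nat.succ_pos _))

lemma start_eq (τ : ℕ) : P.start τ = (P.T + 1) * (τ / (P.T + 1)) := by
  have := Nat.div_add_mod τ (P.T + 1)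
  unfold start; omega

lemma div_start_add {τ k : ℕ} (hk : k ≤ P.T) :
    (P.start τ + k) / (P.T + 1) = τ / (P.T + 1) := by
  rw [start_eq, Nat.mul_add_div (Nat.succ_pos _), Nat.div_eq_of_lt (Nat.lt_succ_of_le hk), add_zero]

lemma level_start_add {τ k : ℕ} (hk : k ≤ P.T) : P.level (P.start τ + k) = P.level τ := by
  simp only [level, P.div_start_add hk]

lemma round_start_add {τ k : ℕ} (hk : k ≤ P.T) : P.round (P.start τ + k) = k := by
  rw [round, start_eq, Nat.mul_add_mod, Nat.mod_eq_of_lt (Nat.lt_succ_of_le hk)]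

lemma start_start_add {τ k : ℕ} (hk : k ≤ P.T) : P.start (P.start τ + k) = P.start τ := by
  rw [start_eq, P.div_start_add hk, ← start_eq]

end Schedule

section Rounds

variable (P : Schedule) (I : SetSystem) (x : Key → Bool)

/-- The elements of `S` counted in round `τ`. -/
def sample (al : Finset ℕ) (τ S : ℕ) : Finset ℕ := {e ∈ I.elts S | e ∈ al ∧ P.coin x (false, e, τ)}

/-- The uncovered elements and the sets still in the race before round `τ`. -/
def rounds : ℕ → Finset ℕ × Finset ℕ
  | 0 => (I.univ, I.sets)
  | τ + 1 =>
    let ac := {S ∈ (rounds τ).2 | P.thr τ ≤ #(sample P I x (rounds τ).1 τ S)}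
    ((rounds τ).1 \ {S ∈ ac | P.coin x (true, S, τ)}.biUnion I.elts,
      if P.round (τ + 1) = 0 then I.sets else ac)

/-- The elements not covered before round `τ`. -/
def alive (τ : ℕ) : Finset ℕ := (rounds P I x τ).1

/-- The sets in the race before round `τ`. -/
def cand (τ : ℕ) : Finset ℕ := (rounds P I x τ).2

/-- `S` has enough counted uncovered elements in round `τ`. -/
def Passes (τ S : ℕ) : Prop := P.thr τ ≤ #(sample P I x (alive P I x τ) τ S)

instance (τ S : ℕ) : Decidable (Passes P I x τ S) := inferInstanceAs (Decidable (_ ≤ _))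

/-- The sets that may join the cover in round `τ`. -/
def active (τ : ℕ) : Finset ℕ := {S ∈ cand P I x τ | Passes P I x τ S}

/-- The sets that join the cover in round `τ`. -/
def joined (τ : ℕ) : Finset ℕ := {S ∈ active P I x τ | P.coin x (true, S, τ)}

lemma alive_zero : alive P I x 0 = I.univ := rfl

lemma alive_succ (τ : ℕ) :
    alive P I x (τ + 1) = alive P I x τ \ (joined P I x τ).biUnion I.elts := rfl

lemma cand_succ (τ : ℕ) :
    cand P I x (τ + 1) = if P.round (τ + 1) = 0 then I.sets else active P I x τ := rfl

lemma cand_of_round_eq_zero {τ : ℕ} (h : P.round τ = 0) : cand P I x τ = I.sets := by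
  cases τ with
  | zero => rfl
  | succ τ => rw [cand_succ, if_pos h]

lemma active_subset_cand (τ : ℕ) : active P I x τ ⊆ cand P I x τ := filter_subset _ _

lemma cand_subset (τ : ℕ) : cand P I x τ ⊆ I.sets := by
  induction τ with
  | zero => exact subset_rfl
  | succ τ ih =>
    rw [cand_succ]
    split_ifs
    · exact subset_rfl
    · exact (active_subset_cand P I x τ).trans ih

lemma active_subset (τ : ℕ) : active P I x τ ⊆ I.sets :=
  (active_subset_cand P I x τ).trans (cand_subset P I x τ)

lemma joined_subset (τ : ℕ) : joined P I x τ ⊆ I.sets :=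
  (filter_subset _ _).trans (active_subset P I x τ)

lemma alive_antitone {τ τ' : ℕ} (h : τ ≤ τ') : alive P I x τ' ⊆ alive P I x τ := by
  induction h with
  | refl => exact subset_rfl
  | step _ ih => exact (sdiff_subset).trans ih

lemma alive_subset (τ : ℕ) : alive P I x τ ⊆ I.univ := alive_antitone P I x (Nat.zero_le τ)

lemma mem_alive_succ {τ e : ℕ} : e ∈ alive P I x (τ + 1) ↔
    e ∈ alive P I x τ ∧ ∀ S ∈ active P I x τ, P.coin x (true, S, τ) = true → e ∉ I.elts S := by
  simp [alive_succ, joined]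

lemma cand_start_succ {τ k : ℕ} (hk : k + 1 ≤ P.T) :
    cand P I x (P.start τ + (k + 1)) = active P I x (P.start τ + k) := by
  rw [← add_assoc, cand_succ, if_neg]
  rw [add_assoc, P.round_start_add hk]; omega

lemma cand_start (τ : ℕ) : cand P I x (P.start τ) = I.sets := by
  have := P.round_start_add (τ := τ) (Nat.zero_le P.T)
  exact cand_of_round_eq_zero P I x this

variable {P I x}

/-- The source of all independence: the state before a round is a function of the coins of earlier
rounds, so the fresh coins can be averaged out with the state held fixed. -/
lemma rounds_congr {y : Key → Bool} {τ : ℕ}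
    (h : ∀ k : Key, k.2.2 < τ → x k = y k) : rounds P I x τ = rounds P I y τ := by
  induction τ with
  | zero => rfl
  | succ τ ih =>
    have ih := ih fun k hk => h k (hk.trans (Nat.lt_succ_self _))
    have hb : ∀ b i, P.coin x (b, i, τ) = P.coin y (b, i, τ) := fun b i =>
      P.coin_congr (h _ (Nat.lt_succ_self _))
    simp only [rounds, ih, sample, hb]
    congr!

lemma alive_congr {y : Key → Bool} {τ : ℕ} (h : ∀ k : Key, k.2.2 < τ → x k = y k) :
    alive P I x τ = alive P I y τ := by rw [alive, rounds_congr h, alive]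

lemma cand_congr {y : Key → Bool} {τ : ℕ} (h : ∀ k : Key, k.2.2 < τ → x k = y k) :
    cand P I x τ = cand P I y τ := by rw [cand, rounds_congr h, cand]

/-- The join coins of round `τ` are left free: the active sets are decided before these coins are
looked at. -/
lemma active_congr {y : Key → Bool} {τ : ℕ} (h : ∀ k : Key, k.2.2 < τ → x k = y k)
    (h' : ∀ e, x (false, e, τ) = y (false, e, τ)) : active P I x τ = active P I y τ := by
  have : ∀ e, P.coin x (false, e, τ) = P.coin y (false, e, τ) := fun e => P.coin_congr (h' e)
  simp only [active, Passes, sample, cand_congr h, alive_congr h, this]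
  congr!

/-- An element of a set that has not joined the cover by the end of the stage of level `0` is
covered. -/
lemma alive_numRounds : alive P I x P.numRounds = ∅ := by
  rw [Finset.eq_empty_iff_forall_notMem]
  intro e he
  obtain ⟨S, hS, heS⟩ := I.exists_mem e (alive_subset P I x _ he)
  set τ₀ := P.L * (P.T + 1) with hτ₀
  have hN : P.numRounds = τ₀ + P.T + 1 := by rw [Schedule.numRounds, hτ₀]; ring
  have hst : P.start τ₀ = τ₀ := by
    rw [Schedule.start_eq, hτ₀, Nat.mul_div_cancel _ (Nat.succ_pos _)]; ring
  have hlev : ∀ k ≤ P.T, P.level (τ₀ + k) = 0 := by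
    intro k hk
    have := P.level_start_add (τ := τ₀) hk
    rw [hst] at this
    rw [this, Schedule.level, hτ₀, Nat.mul_div_cancel _ (Nat.succ_pos _), Nat.sub_self]
  -- At level `0` the threshold is one and every uncovered element is counted, so a set containing
  -- the uncovered `e` cannot drop out. Its coin in the last round has probability one and is forced
  -- to show `true`.
  have hact : ∀ k ≤ P.T, S ∈ active P I x (τ₀ + k) := by
    intro k
    induction k with
    | zero =>
      intro _
      refine mem_filter.2 ⟨?_, ?_⟩
      · have := cand_start P I x τ₀
        rw [hst] at this
        rwa [add_zero, this]
      · have : e ∈ sample P I x (alive P I x (τ₀ + 0)) (τ₀ + 0) S := by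
          refine mem_filter.2 ⟨heS, alive_antitone P I x (by omega) he, ?_⟩
          simp only [Schedule.coin, Schedule.expo, hlev 0 (Nat.zero_le _)]; simp
        rw [Passes, Schedule.thr, hlev 0 (Nat.zero_le _)]
        simpa using card_pos.2 ⟨e, this⟩
    | succ k ih =>
      intro hk
      refine mem_filter.2 ⟨?_, ?_⟩
      · have := cand_start_succ P I x (τ := τ₀) hk
        rw [hst] at this
        rw [this]; exact ih (by omega)
      · have : e ∈ sample P I x (alive P I x (τ₀ + (k + 1))) (τ₀ + (k + 1)) S := by
          refine mem_filter.2 ⟨heS, alive_antitone P I x (by omega) he, ?_⟩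
          simp [Schedule.coin, Schedule.expo, hlev _ hk]
        rw [Passes, Schedule.thr, hlev _ hk]
        simpa using card_pos.2 ⟨e, this⟩
  rw [hN, mem_alive_succ] at he
  refine he.2 S (hact P.T le_rfl) ?_ heS
  have := P.round_start_add (τ := τ₀) (le_refl P.T)
  rw [hst] at this
  simp [Schedule.coin, Schedule.expo, this]

lemma exists_joined_of_notMem_alive {τ e : ℕ} (he : e ∈ I.univ) (h : e ∉ alive P I x τ) :
    ∃ τ' < τ, ∃ S ∈ joined P I x τ', e ∈ I.elts S := by
  induction τ with
  | zero => exact absurd he h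
  | succ τ ih =>
    by_cases h' : e ∈ alive P I x τ
    · rw [alive_succ, mem_sdiff, not_and, not_not] at h
      obtain ⟨S, hS, heS⟩ := mem_biUnion.1 (h h')
      exact ⟨τ, Nat.lt_succ_self _, S, hS, heS⟩
    · obtain ⟨τ', h1, h2⟩ := ih h'
      exact ⟨τ', h1.trans (Nat.lt_succ_self _), h2⟩

end Rounds

/-! ### Failure of the local simulation -/

section Failure

variable (P : Schedule) (I : SetSystem) (x : Key → Bool)

/-- The sets containing `e` which may join in round `τ` and are in the race before round `k` of
the stage of `τ`. -/
def hitList (τ e k : ℕ) : Finset ℕ :=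
  {S ∈ I.setsOf e | P.coin x (true, S, τ) ∧ S ∈ cand P I x (P.start τ + k)}

/-- The elements of `S` counted in round `τ` among those uncovered at the start of the stage. -/
def preSample (τ S : ℕ) : Finset ℕ := sample P I x (alive P I x (P.start τ)) τ S

/-- `Fail false τ e`: the local simulation gives up when asked whether the element `e` is uncovered
before round `τ`. `Fail true τ S`: it gives up when asked whether the set `S` has enough counted
uncovered elements in round `τ`. -/
inductive Fail : Bool → ℕ → ℕ → Prop
  | prev {τ e : ℕ} (h : Fail false τ e) : Fail false (τ + 1) e
  | cap {τ e k : ℕ} (he : e ∈ alive P I x τ) (hk : k ≤ P.round τ)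
      (h : P.cap (P.round τ - k) < #(hitList P I x τ e k)) : Fail false (τ + 1) e
  | hit {τ e k S : ℕ} (he : e ∈ alive P I x τ) (hk : k ≤ P.round τ)
      (hS : S ∈ hitList P I x τ e k) (h : Fail true (P.start τ + k) S) : Fail false (τ + 1) e
  | start {τ S e : ℕ} (he : e ∈ I.elts S) (hc : P.coin x (false, e, τ) = true)
      (h : Fail false (P.start τ) e) : Fail true τ S
  | sample {τ S : ℕ} (h : P.maxSample < #(preSample P I x τ S)) : Fail true τ S
  | elem {τ S e : ℕ} (he : e ∈ preSample P I x τ S) (h : Fail false τ e) : Fail true τ S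

/-- The local simulation gives up when asked about the set `S`. -/
def FailSet (S : ℕ) : Prop :=
  ∃ τ < P.numRounds, P.coin x (true, S, τ) = true ∧
    ∃ k ≤ P.round τ, S ∈ cand P I x (P.start τ + k) ∧ Fail P I x true (P.start τ + k) S

open Classical in
/-- The set cover. -/
noncomputable def cover : Finset ℕ :=
  {S ∈ I.sets | (∃ τ < P.numRounds, S ∈ joined P I x τ) ∨ FailSet P I x S}

/-- The rounds alone cover everything for every outcome of the coins; randomness affects only the
size. The sets added because of failures do no harm. -/
lemma isCover_cover : I.IsCover (cover P I x) := by
  classical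
  refine ⟨filter_subset _ _, fun e he => ?_⟩
  obtain ⟨τ, hτ, S, hS, heS⟩ := exists_joined_of_notMem_alive (P := P) (x := x) he
    (τ := P.numRounds) (by simp [alive_numRounds])
  exact ⟨S, mem_filter.2 ⟨joined_subset P I x τ hS, Or.inl ⟨τ, hτ, hS⟩⟩, heS⟩

end Failure

end LocalSetCover

open Finset

namespace LocalSetCover

/-! ### Expectations over the coins of the parallel algorithm -/

section Mean

variable (P : Schedule) (I : SetSystem)

/-- All coins that the algorithm uses. -/
def keySet : Finset Key := Finset.univ ×ˢ ((I.sets ∪ I.univ) ×ˢ Finset.range P.numRounds)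

/-- The expectation over all coins. -/
noncomputable def mean (f : (Key → Bool) → ℝ) : ℝ :=
  expect P.prob (keySet P I).toList f fun _ => true

open Classical in
/-- The indicator of a proposition. -/
noncomputable def ind (p : Prop) : ℝ := if p then 1 else 0

/-- The probability of an event. -/
noncomputable def pr (A : (Key → Bool) → Prop) : ℝ := mean P I fun x => ind (A x)

lemma ind_nonneg (p : Prop) : 0 ≤ ind p := by unfold ind; split_ifs <;> norm_num

lemma ind_le_one (p : Prop) : ind p ≤ 1 := by unfold ind; split_ifs <;> norm_num

@[simp] lemma ind_true {p : Prop} (h : p) : ind p = 1 := if_pos h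

@[simp] lemma ind_false {p : Prop} (h : ¬p) : ind p = 0 := if_neg h

lemma ind_mono {p q : Prop} (h : p → q) : ind p ≤ ind q := by
  by_cases hp : p
  · rw [ind_true hp, ind_true (h hp)]
  · rw [ind_false hp]; exact ind_nonneg q

lemma ind_and (p q : Prop) : ind (p ∧ q) = ind p * ind q := by
  by_cases hp : p <;> by_cases hq : q <;> simp [ind, hp, hq]

lemma card_filter_eq_sum_ind {α : Type*} (s : Finset α) (p : α → Prop) [DecidablePred p] :
    (#{a ∈ s | p a} : ℝ) = ∑ a ∈ s, ind (p a) := by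
  rw [card_filter]; push_cast
  exact sum_congr rfl fun a _ => by by_cases h : p a <;> simp [h, ind]

variable {P I}

lemma mean_add (f g : (Key → Bool) → ℝ) :
    mean P I (fun x => f x + g x) = mean P I f + mean P I g := expect_add _ _ _ _

lemma mean_sub (f g : (Key → Bool) → ℝ) :
    mean P I (fun x => f x - g x) = mean P I f - mean P I g := expect_sub _ _ _ _

lemma mean_const_mul (c : ℝ) (f : (Key → Bool) → ℝ) :
    mean P I (fun x => c * f x) = c * mean P I f := expect_const_mul _ _ _ _

lemma mean_const (c : ℝ) : mean P I (fun _ => c) = c := expect_const _ _ _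

lemma mean_sum {ι : Type*} (s : Finset ι) (f : ι → (Key → Bool) → ℝ) :
    mean P I (fun x => ∑ i ∈ s, f i x) = ∑ i ∈ s, mean P I (f i) := expect_sum _ _ _ _

lemma mean_mono {f g : (Key → Bool) → ℝ} (h : ∀ x, f x ≤ g x) : mean P I f ≤ mean P I g :=
  expect_mono P.prob_bounds _ fun y _ => h y

lemma mean_le_of_forall {f : (Key → Bool) → ℝ} {c : ℝ} (h : ∀ x, f x ≤ c) : mean P I f ≤ c := by
  rw [← mean_const (P := P) (I := I) c]; exact mean_mono h

lemma mean_nonneg {f : (Key → Bool) → ℝ} (h : ∀ x, 0 ≤ f x) : 0 ≤ mean P I f :=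
  expect_nonneg P.prob_bounds _ h _

lemma mean_expect {l : List Key} (h : ∀ k ∈ l, k ∈ keySet P I) (f : (Key → Bool) → ℝ) :
    mean P I (expect P.prob l f) = mean P I f := by
  unfold mean
  rw [expect_expect fun k hk => mem_toList.2 (h k hk)]

lemma pr_nonneg (A : (Key → Bool) → Prop) : 0 ≤ pr P I A := mean_nonneg fun _ => ind_nonneg _

lemma pr_mono {A B : (Key → Bool) → Prop} (h : ∀ x, A x → B x) : pr P I A ≤ pr P I B :=
  mean_mono fun x => ind_mono (h x)

lemma pr_false {A : (Key → Bool) → Prop} (h : ∀ x, ¬A x) : pr P I A = 0 := by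
  unfold pr; simp only [ind_false (h _), mean_const]

lemma pr_or_le (A B : (Key → Bool) → Prop) :
    pr P I (fun x => A x ∨ B x) ≤ pr P I A + pr P I B := by
  unfold pr
  rw [← mean_add]
  refine mean_mono fun x => ?_
  by_cases hA : A x <;> by_cases hB : B x <;> simp [ind, hA, hB]

lemma pr_exists_le {ι : Type*} (s : Finset ι) (A : ι → (Key → Bool) → Prop) :
    pr P I (fun x => ∃ i ∈ s, A i x) ≤ ∑ i ∈ s, pr P I (A i) := by
  unfold pr
  rw [← mean_sum]
  refine mean_mono fun x => ?_
  by_cases h : ∃ i ∈ s, A i x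
  · obtain ⟨i, hi, hA⟩ := h
    rw [ind_true ⟨i, hi, hA⟩, ← ind_true hA]
    exact single_le_sum (f := fun i => ind (A i x)) (fun _ _ => ind_nonneg _) hi
  · rw [ind_false h]; exact sum_nonneg fun _ _ => ind_nonneg _

/-- Markov's inequality. -/
lemma pr_le_of_mean_le {A : (Key → Bool) → Prop} {f : (Key → Bool) → ℝ} {a b : ℝ} (ha : 0 < a)
    (hf : ∀ x, 0 ≤ f x) (h : ∀ x, A x → a ≤ f x) (hb : mean P I f ≤ b) : pr P I A ≤ b / a := by
  rw [le_div_iff₀ ha, mul_comm]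
  unfold pr
  rw [← mean_const_mul]
  refine (mean_mono fun x => ?_).trans hb
  by_cases hA : A x
  · rw [ind_true hA, mul_one]; exact h x hA
  · rw [ind_false hA, mul_zero]; exact hf x

/-- Forcing a coin of probability one to show `true` alters only an outcome of weight zero. -/
lemma avg_coin (k : Key) (g : Bool → ℝ) (c : ℝ) :
    P.prob k * (c * g (decide (P.expo k = 0) || true)) +
      (1 - P.prob k) * (c * g (decide (P.expo k = 0) || false)) =
    c * (P.prob k * g true + (1 - P.prob k) * g false) := by
  by_cases h : P.expo k = 0
  · simp [h, P.prob_of_expo_eq_zero h]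
  · simp [h]; ring

lemma mean_mul_coin {k : Key} (hk : k ∈ keySet P I) {f : (Key → Bool) → ℝ}
    (hf : ∀ x b, f (Function.update x k b) = f x) :
    mean P I (fun x => f x * ind (P.coin x k = true)) = P.prob k * mean P I f := by
  rw [← mean_expect (l := [k]) (by simpa using hk), ← mean_const_mul]
  congr 1
  funext x
  have := avg_coin (P := P) k (fun b => ind (b = true)) (f x)
  simp only [expect_cons, expect_nil, avg, hf, Schedule.coin, Function.update_self] at this ⊢
  rw [this]; simp [ind]; ring

/-- The expectation of a product over a random set of coins that is determined by other coins. -/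
lemma mean_mul_prod (s : Finset ℕ) (key : ℕ → Key) (hinj : Function.Injective key)
    (hmem : ∀ i ∈ s, key i ∈ keySet P I) (p : ℝ) (hp : ∀ i, P.prob (key i) = p)
    (f : (Key → Bool) → ℝ) (A : (Key → Bool) → Finset ℕ) (hA : ∀ x, A x ⊆ s)
    (hf : ∀ x y : Key → Bool, (∀ k, (∀ i, k ≠ key i) → y k = x k) → f y = f x ∧ A y = A x)
    (g : Bool → ℝ) :
    mean P I (fun x => f x * ∏ i ∈ A x, g (P.coin x (key i))) =
      mean P I (fun x => f x * (p * g true + (1 - p) * g false) ^ #(A x)) := by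
  classical
  rw [← mean_expect (l := s.toList.map key)]
  swap
  · intro k hk
    simp only [List.mem_map, mem_toList] at hk
    obtain ⟨i, hi, rfl⟩ := hk
    exact hmem i hi
  congr 1
  funext x
  rw [expect_congr (g := fun y => f x * ∏ i ∈ s,
    (fun i b => if i ∈ A x then g (decide (P.expo (key i) = 0) || b) else 1) i (y (key i)))]
  · rw [expect_const_mul, expect_prod s key hinj
      (fun i b => if i ∈ A x then g (decide (P.expo (key i) = 0) || b) else 1)]
    congr 1
    have : ∀ i ∈ s, (P.prob (key i) * (if i ∈ A x then g (decide (P.expo (key i) = 0) || true) else 1) +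
        (1 - P.prob (key i)) * (if i ∈ A x then g (decide (P.expo (key i) = 0) || false) else 1)) =
        if i ∈ A x then p * g true + (1 - p) * g false else 1 := by
      intro i _
      by_cases hi : i ∈ A x
      · have := avg_coin (P := P) (key i) g 1
        simp only [if_pos hi]
        simp only [one_mul] at this
        rw [this, hp]
      · simp only [if_neg hi]; ring
    rw [prod_congr rfl this, ← prod_filter, filter_mem_eq_inter, inter_eq_right.2 (hA x), prod_const]
  · intro y hy
    obtain ⟨h1, h2⟩ := hf x y fun k hk => hy k <| by
      simp only [List.mem_map, not_exists, not_and]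
      exact fun i _ h => hk i h.symm
    rw [h1, h2, ← prod_filter, filter_mem_eq_inter, inter_eq_right.2 (hA x)]
    rfl

end Mean

end LocalSetCover

open Finset

namespace LocalSetCover

/-! ### Probability estimates for the parallel algorithm -/

section Estimates

variable (P : Schedule) (I : SetSystem)

/-- The probability that a set may join in round `τ`. -/
noncomputable def Schedule.joinProb (τ : ℕ) : ℝ := (1 / 2) ^ (P.T - P.round τ)

/-- The probability that an element is counted in round `τ`. -/
noncomputable def Schedule.sampleProb (τ : ℕ) : ℝ := (1 / 2) ^ (P.level τ - P.ℓ)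

lemma Schedule.prob_true (S τ : ℕ) : P.prob (true, S, τ) = P.joinProb τ := rfl

lemma Schedule.prob_false (e τ : ℕ) : P.prob (false, e, τ) = P.sampleProb τ := rfl

lemma Schedule.joinProb_nonneg (τ : ℕ) : 0 ≤ P.joinProb τ := P.prob_nonneg (true, 0, τ)

lemma Schedule.joinProb_le_one (τ : ℕ) : P.joinProb τ ≤ 1 := P.prob_le_one (true, 0, τ)

lemma Schedule.sampleProb_nonneg (τ : ℕ) : 0 ≤ P.sampleProb τ := P.prob_nonneg (false, 0, τ)

lemma Schedule.sampleProb_le_one (τ : ℕ) : P.sampleProb τ ≤ 1 := P.prob_le_one (false, 0, τ)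

/-- The calibration of the test: the threshold is the mean number of counted elements among `2 ^
level`. Both cases, with and without genuine sampling, are covered by the truncated subtraction and
the minimum. -/
lemma Schedule.sampleProb_mul (τ : ℕ) : P.sampleProb τ * 2 ^ P.level τ = P.thr τ := by
  have h : P.level τ = (P.level τ - P.ℓ) + min (P.level τ) P.ℓ := by omega
  have h2 : ((2 : ℝ)⁻¹) ^ (P.level τ - P.ℓ) * 2 ^ (P.level τ - P.ℓ) = 1 := by
    rw [← mul_pow]; norm_num
  rw [sampleProb, thr, one_div]
  conv_lhs => rw [h, pow_add]
  push_cast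
  rw [← mul_assoc]
  have h3 : (P.level τ - P.ℓ + min (P.level τ) P.ℓ) - P.ℓ = P.level τ - P.ℓ := by omega
  rw [h3, h2, one_mul]

lemma Schedule.thr_pos (τ : ℕ) : 0 < P.thr τ := by unfold thr; positivity

/-- The uncovered elements of `S` before round `τ`. -/
def liveElts (x : Key → Bool) (τ S : ℕ) : Finset ℕ := {e ∈ I.elts S | e ∈ alive P I x τ}

/-- The sets containing `e` that may join in round `τ`. -/
def actOf (x : Key → Bool) (τ e : ℕ) : Finset ℕ := {S ∈ I.setsOf e | S ∈ active P I x τ}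

/-- The sets containing `e` that are in the race before round `τ`. -/
def candOf (x : Key → Bool) (τ e : ℕ) : Finset ℕ := {S ∈ I.setsOf e | S ∈ cand P I x τ}

variable {P I}

lemma mem_setsOf {e S : ℕ} : S ∈ I.setsOf e ↔ S ∈ I.sets ∧ e ∈ I.elts S := by
  simp [SetSystem.setsOf]

lemma mem_keySet {b : Bool} {i τ : ℕ} (hi : i ∈ I.sets ∨ i ∈ I.univ) (hτ : τ < P.numRounds) :
    (b, i, τ) ∈ keySet P I := by
  simp [keySet, hi, hτ]

lemma sum_sets_elts (F : ℕ → ℕ → ℝ) :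
    ∑ S ∈ I.sets, ∑ e ∈ I.elts S, F S e = ∑ e ∈ I.univ, ∑ S ∈ I.setsOf e, F S e := by
  refine sum_comm' fun S e => ?_
  rw [mem_setsOf]
  exact ⟨fun h => ⟨h, I.elts_subset S h.1 h.2⟩, fun h => h.1⟩

lemma agree_of_lt {τ τ' : ℕ} (h : τ' ≤ τ) {x y : Key → Bool} {b : Bool}
    (hxy : ∀ k, (∀ S, k ≠ (b, S, τ)) → y k = x k) :
    ∀ k : Key, k.2.2 < τ' → y k = x k := by
  refine fun k hk => hxy k fun S hS => ?_
  rw [hS] at hk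
  exact absurd hk (by simpa using h)

/-- Survival as a product over join coins, the shape to which `mean_mul_prod` applies. -/
lemma ind_alive_succ (x : Key → Bool) {τ e : ℕ} :
    ind (e ∈ alive P I x (τ + 1)) = ind (e ∈ alive P I x τ) *
      ∏ S ∈ actOf P I x τ e, (fun b : Bool => if b then (0 : ℝ) else 1) (P.coin x (true, S, τ)) := by
  by_cases h : e ∈ alive P I x τ
  · rw [ind_true h, one_mul]
    by_cases h' : e ∈ alive P I x (τ + 1)
    · rw [ind_true h', prod_eq_one]
      intro S hS
      have hS' := mem_filter.1 hS
      have := (mem_alive_succ P I x).1 h' |>.2 S hS'.2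
      have hc : P.coin x (true, S, τ) = false := by
        by_contra hc
        exact this (by simpa using hc) (mem_setsOf.1 hS'.1).2
      simp [hc]
    · rw [ind_false h', eq_comm, prod_eq_zero_iff]
      rw [mem_alive_succ] at h'
      push Not at h'
      obtain ⟨S, hS, hc, he⟩ := h' h
      exact ⟨S, mem_filter.2 ⟨mem_setsOf.2 ⟨active_subset P I x τ hS, he⟩, hS⟩, by simp [hc]⟩
  · rw [ind_false h, zero_mul, ind_false fun h' => h (alive_antitone P I x (Nat.le_succ τ) h')]

/-- Once the active sets are fixed, each of those containing `e` independently stays out with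
probability `1 - p`. The weight `h` may depend on any coins other than the join coins of round `τ`.
-/
lemma mean_alive_succ_mul {τ e : ℕ} (hτ : τ < P.numRounds) (h : (Key → Bool) → ℝ)
    (hh : ∀ x y : Key → Bool, (∀ k, (∀ S, k ≠ (true, S, τ)) → y k = x k) → h y = h x) :
    mean P I (fun x => ind (e ∈ alive P I x (τ + 1)) * h x) =
      mean P I (fun x => ind (e ∈ alive P I x τ) * h x *
        (1 - P.joinProb τ) ^ #(actOf P I x τ e)) := by
  have := mean_mul_prod (P := P) (I := I) (I.setsOf e) (fun S => (true, S, τ))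
    (fun a b h => by simpa using h)
    (fun S hS => mem_keySet (Or.inl (mem_setsOf.1 hS).1) hτ) (P.joinProb τ) (fun _ => rfl)
    (fun x => ind (e ∈ alive P I x τ) * h x) (fun x => actOf P I x τ e) (fun x => filter_subset _ _)
    (fun x y hxy => by
      have h1 := agree_of_lt le_rfl hxy
      refine ⟨by rw [alive_congr h1, hh x y hxy], ?_⟩
      simp only [actOf]
      rw [active_congr h1 fun e => hxy _ (by simp)])
    (fun b => if b then 0 else 1)
  simp only [if_true, mul_zero, zero_add, Bool.false_eq_true, if_false, mul_one] at this
  rw [← this]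
  congr 1
  funext x
  rw [ind_alive_succ]
  ring

/-- Bernoulli gives `(1 + d p) (1 - p) ^ d ≤ (1 - p ^ 2) ^ d ≤ 1`. -/
lemma mul_pow_le_one_sub {p : ℝ} (h0 : 0 ≤ p) (h1 : p ≤ 1) (d : ℕ) :
    d * p * (1 - p) ^ d ≤ 1 - (1 - p) ^ d := by
  have h2 : 1 + d * p ≤ (1 + p) ^ d := one_add_mul_le_pow (by linarith) d
  have h3 : (1 + p) ^ d * (1 - p) ^ d ≤ 1 := by
    rw [← mul_pow]; exact pow_le_one₀ (by nlinarith) (by nlinarith)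
  have h4 : 0 ≤ (1 - p) ^ d := pow_nonneg (by linarith) d
  nlinarith [mul_le_mul_of_nonneg_right h2 h4]

/-- The expected number of sets joining in a round, charged to the uncovered elements. -/
lemma mean_joined_le {τ : ℕ} (hτ : τ < P.numRounds) :
    mean P I (fun x => (#(joined P I x τ) : ℝ)) ≤ (1 / 2) ^ P.level τ *
      ∑ e ∈ I.univ, P.joinProb τ *
        mean P I (fun x => ind (e ∈ alive P I x τ) * #(candOf P I x τ e)) := by
  have hθ : (0 : ℝ) < P.thr τ := by exact_mod_cast P.thr_pos τ
  -- A joining set spreads its unit cost over its counted uncovered elements. Requiring afterwards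
  -- only that it is in the race, rather than active, makes the counting coin and the join coin
  -- independent of the remaining factors.
  have step : ∀ x, (#(joined P I x τ) : ℝ) ≤ ∑ S ∈ I.sets, ∑ e ∈ I.elts S, (P.thr τ : ℝ)⁻¹ *
      (ind (S ∈ cand P I x τ) * ind (e ∈ alive P I x τ) * ind (P.coin x (false, e, τ) = true) *
        ind (P.coin x (true, S, τ) = true)) := by
    intro x
    have h1 : joined P I x τ = {S ∈ I.sets | S ∈ joined P I x τ} := by
      ext S; simp only [mem_filter]; exact ⟨fun h => ⟨joined_subset P I x τ h, h⟩, fun h => h.2⟩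
    rw [h1, card_filter_eq_sum_ind]
    refine sum_le_sum fun S _ => ?_
    by_cases hS : S ∈ joined P I x τ
    · obtain ⟨ha, hc⟩ := mem_filter.1 hS
      obtain ⟨hcand, hp⟩ := mem_filter.1 ha
      rw [ind_true hS, ind_true hcand, ind_true hc, ← mul_sum]
      rw [Passes, sample] at hp
      have h2 : (P.thr τ : ℝ) ≤ ∑ e ∈ I.elts S,
          ind (e ∈ alive P I x τ ∧ P.coin x (false, e, τ) = true) := by
        rw [← card_filter_eq_sum_ind]; exact_mod_cast hp
      simp only [ind_and] at h2
      simp only [one_mul, mul_one]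
      rw [← inv_mul_cancel₀ hθ.ne']
      exact mul_le_mul_of_nonneg_left h2 (inv_nonneg.2 hθ.le)
    · rw [ind_false hS]
      refine sum_nonneg fun e _ => mul_nonneg (inv_nonneg.2 hθ.le) ?_
      have := fun p => ind_nonneg p
      exact mul_nonneg (mul_nonneg (mul_nonneg (this _) (this _)) (this _)) (this _)
  refine (mean_mono step).trans ?_
  rw [mean_sum, mul_sum]
  simp only [mean_sum, mean_const_mul]
  have hterm : ∀ S ∈ I.sets, ∀ e ∈ I.elts S, (P.thr τ : ℝ)⁻¹ * mean P I (fun x =>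
      ind (S ∈ cand P I x τ) * ind (e ∈ alive P I x τ) * ind (P.coin x (false, e, τ) = true) *
        ind (P.coin x (true, S, τ) = true)) = (1 / 2) ^ P.level τ * P.joinProb τ *
      mean P I (fun x => ind (S ∈ cand P I x τ) * ind (e ∈ alive P I x τ)) := by
    intro S hS e he
    have hupd : ∀ (x : Key → Bool) (b b' : Bool) (i : ℕ), ∀ k : Key, k.2.2 < τ →
        Function.update x (b, i, τ) b' k = x k := by
      intro x b b' i k hk
      refine Function.update_of_ne ?_ _ _
      rintro rfl
      exact lt_irrefl _ hk
    rw [mean_mul_coin (mem_keySet (Or.inl hS) hτ), mean_mul_coin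
      (mem_keySet (Or.inr (I.elts_subset S hS he)) hτ), P.prob_true, P.prob_false]
    · have h2 : (P.thr τ : ℝ)⁻¹ * P.sampleProb τ = (1 / 2) ^ P.level τ := by
        have := P.sampleProb_mul τ
        have h3 : (2 : ℝ) ^ P.level τ ≠ 0 := by positivity
        rw [← this] at hθ ⊢
        have h4 : P.sampleProb τ ≠ 0 := fun h => by simp [h] at hθ
        rw [one_div, inv_pow]
        field_simp
      rw [← h2]; ring
    · intro x b
      rw [cand_congr (hupd x false b e), alive_congr (hupd x false b e)]
    · intro x b
      rw [cand_congr (hupd x true b S), alive_congr (hupd x true b S)]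
      simp [Schedule.coin]
  rw [sum_congr rfl fun S hS => sum_congr rfl (hterm S hS), sum_sets_elts]
  refine le_of_eq (sum_congr rfl fun e _ => ?_)
  rw [← mul_sum, ← mean_sum, mul_assoc]
  congr 3
  funext x
  rw [← sum_mul, ← card_filter_eq_sum_ind, mul_comm]
  rfl

/-- In the first round of a stage the join probability is `2 ^ -T`, and at most `2 ^ T` sets contain
`e`. -/
lemma joinProb_mul_mean_le_start {τ e : ℕ} (ht : #(I.setsOf e) ≤ 2 ^ P.T) (hr : P.round τ = 0) :
    P.joinProb τ * mean P I (fun x => ind (e ∈ alive P I x τ) * #(candOf P I x τ e)) ≤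
      pr P I (fun x => e ∈ alive P I x τ) := by
  rw [← mean_const_mul]
  refine mean_mono fun x => ?_
  have h1 : (#(candOf P I x τ e) : ℝ) ≤ 2 ^ P.T := by
    exact_mod_cast (card_le_card (filter_subset _ _)).trans ht
  have h2 : P.joinProb τ * 2 ^ P.T = 1 := by
    rw [Schedule.joinProb, hr, Nat.sub_zero, ← mul_pow]; norm_num
  calc P.joinProb τ * (ind (e ∈ alive P I x τ) * #(candOf P I x τ e))
      ≤ P.joinProb τ * (ind (e ∈ alive P I x τ) * 2 ^ P.T) := by
        gcongr
        · exact P.joinProb_nonneg τ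
        · exact ind_nonneg _
    _ = ind (e ∈ alive P I x τ) := by
      rw [mul_comm (ind _), ← mul_assoc, h2, one_mul]

/-- The sets in the race now are those active one round earlier. If `d` of them contain `e`, then
`e` survived with probability `(1 - p) ^ d`, so a large `d` is paid for by the chance that `e` was
covered. The `2` is the doubling of the join probability. -/
lemma joinProb_mul_mean_le_succ {τ e : ℕ} (hτ : τ < P.numRounds) (hr : P.round (τ + 1) ≠ 0) :
    P.joinProb (τ + 1) *
        mean P I (fun x => ind (e ∈ alive P I x (τ + 1)) * #(candOf P I x (τ + 1) e)) ≤
      2 * (pr P I (fun x => e ∈ alive P I x τ) - pr P I (fun x => e ∈ alive P I x (τ + 1))) := by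
  have hp : P.joinProb (τ + 1) = 2 * P.joinProb τ := by
    have hround : P.round (τ + 1) = P.round τ + 1 := by
      unfold Schedule.round at hr ⊢
      rw [Nat.add_mod] at hr ⊢
      rcases Nat.eq_zero_or_pos P.T with h | h
      · simp [h, Nat.mod_one] at hr
      · have h1 : 1 % (P.T + 1) = 1 := Nat.mod_eq_of_lt (by omega)
        have h2 : τ % (P.T + 1) < P.T + 1 := Nat.mod_lt τ (Nat.succ_pos P.T)
        rw [h1] at hr ⊢
        refine Nat.mod_eq_of_lt ?_
        rcases Nat.lt_or_ge (τ % (P.T + 1) + 1) (P.T + 1) with h3 | h3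
        · exact h3
        · exact absurd (by rw [show τ % (P.T + 1) + 1 = P.T + 1 by omega, Nat.mod_self]) hr
    have hle := P.round_le (τ + 1)
    rw [Schedule.joinProb, Schedule.joinProb, hround,
      show P.T - P.round τ = (P.T - (P.round τ + 1)) + 1 by omega, pow_succ]
    ring
  have hcand : ∀ x, candOf P I x (τ + 1) e = actOf P I x τ e := by
    intro x
    simp only [candOf, actOf]
    rw [cand_succ, if_neg hr]
  simp only [hcand]
  rw [mean_alive_succ_mul hτ, hp, ← mean_const_mul]
  · have h2 : pr P I (fun x => e ∈ alive P I x (τ + 1)) = mean P I (fun x =>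
        ind (e ∈ alive P I x τ) * (1 - P.joinProb τ) ^ #(actOf P I x τ e)) := by
      have := mean_alive_succ_mul (P := P) (I := I) (e := e) hτ (fun _ => 1) (fun _ _ _ => rfl)
      simpa only [mul_one, pr] using this
    rw [h2, pr, ← mean_sub, ← mean_const_mul]
    refine mean_mono fun x => ?_
    have h3 := mul_pow_le_one_sub (P.joinProb_nonneg τ) (P.joinProb_le_one τ) #(actOf P I x τ e)
    have h4 := mul_le_mul_of_nonneg_left h3 (ind_nonneg (e ∈ alive P I x τ))
    nlinarith
  · intro x y hxy
    simp only [actOf]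
    rw [active_congr (agree_of_lt le_rfl hxy) fun e => hxy _ (by simp)]

/-- The expected number of sets joining in a stage. -/
lemma mean_joined_stage_le {σ : ℕ} (hσ : σ ≤ P.L) (ht : ∀ e ∈ I.univ, #(I.setsOf e) ≤ 2 ^ P.T) :
    ∑ j ∈ range (P.T + 1), mean P I (fun x => (#(joined P I x (σ * (P.T + 1) + j)) : ℝ)) ≤
      3 * (1 / 2) ^ (P.L - σ) * ∑ e ∈ I.univ, pr P I (fun x => e ∈ alive P I x (σ * (P.T + 1))) := by
  set τ₀ := σ * (P.T + 1) with hτ₀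
  have hst : P.start τ₀ = τ₀ := by
    rw [Schedule.start_eq, hτ₀, Nat.mul_div_cancel _ (Nat.succ_pos _)]; ring
  have hround : ∀ j ≤ P.T, P.round (τ₀ + j) = j := by
    intro j hj
    have := P.round_start_add (τ := τ₀) hj
    rwa [hst] at this
  have hlev : ∀ j ≤ P.T, P.level (τ₀ + j) = P.L - σ := by
    intro j hj
    have := P.level_start_add (τ := τ₀) hj
    rw [hst] at this
    rw [this, Schedule.level, hτ₀, Nat.mul_div_cancel _ (Nat.succ_pos _)]
  have hlt : ∀ j ≤ P.T, τ₀ + j < P.numRounds := by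
    intro j hj
    have : σ * (P.T + 1) ≤ P.L * (P.T + 1) := Nat.mul_le_mul_right _ hσ
    rw [Schedule.numRounds, add_mul]
    omega
  set a : ℕ → ℕ → ℝ := fun e j => P.joinProb (τ₀ + j) *
    mean P I (fun x => ind (e ∈ alive P I x (τ₀ + j)) * #(candOf P I x (τ₀ + j) e)) with ha
  -- The bounds for later rounds telescope; the first round contributes one more unit, whence `3`.
  have hbound : ∀ e ∈ I.univ, ∀ n ≤ P.T, ∑ j ∈ range (n + 1), a e j ≤
      3 * pr P I (fun x => e ∈ alive P I x τ₀) - 2 * pr P I (fun x => e ∈ alive P I x (τ₀ + n)) := by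
    intro e he n
    induction n with
    | zero =>
      intro _
      have := joinProb_mul_mean_le_start (ht e he) (hround 0 (Nat.zero_le _))
      simp only [zero_add, sum_range_one, add_zero, ha] at this ⊢
      linarith
    | succ n ih =>
      intro hn
      rw [sum_range_succ]
      have h1 := ih (by omega)
      have h2 : a e (n + 1) ≤ _ := joinProb_mul_mean_le_succ (τ := τ₀ + n) (e := e) (hlt n (by omega))
        (by have := hround (n + 1) hn; rw [← add_assoc] at this; omega)
      rw [← add_assoc]
      linarith
  calc ∑ j ∈ range (P.T + 1), mean P I (fun x => (#(joined P I x (τ₀ + j)) : ℝ))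
      ≤ ∑ j ∈ range (P.T + 1), (1 / 2) ^ (P.L - σ) * ∑ e ∈ I.univ, a e j := by
        refine sum_le_sum fun j hj => ?_
        have hj : j ≤ P.T := Nat.lt_succ_iff.1 (mem_range.1 hj)
        have := mean_joined_le (I := I) (hlt j hj)
        rwa [hlev j hj] at this
    _ = (1 / 2) ^ (P.L - σ) * ∑ e ∈ I.univ, ∑ j ∈ range (P.T + 1), a e j := by
        rw [← mul_sum, sum_comm]
    _ ≤ (1 / 2) ^ (P.L - σ) * ∑ e ∈ I.univ, 3 * pr P I (fun x => e ∈ alive P I x τ₀) := by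
        refine mul_le_mul_of_nonneg_left (sum_le_sum fun e he => ?_) (by positivity)
        have := hbound e he P.T le_rfl
        have h2 := pr_nonneg (P := P) (I := I) (fun x => e ∈ alive P I x (τ₀ + P.T))
        linarith
    _ = _ := by rw [← mul_sum]; ring

end Estimates

end LocalSetCover

open Finset

namespace LocalSetCover

/-! ### Tail bounds from exponential moments -/

section Concentration

variable {P : Schedule} {I : SetSystem}

lemma prod_coin_eq_pow (x : Key → Bool) (A : Finset ℕ) (key : ℕ → Key) (c : ℝ) :
    ∏ i ∈ A, (fun b : Bool => if b then c else 1) (P.coin x (key i)) =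
      c ^ #{i ∈ A | P.coin x (key i) = true} := by
  simp only [prod_ite, prod_const, one_pow, mul_one]

lemma sample_alive_eq (x : Key → Bool) (τ τ' S : ℕ) :
    sample P I x (alive P I x τ') τ S =
      {e ∈ liveElts P I x τ' S | P.coin x (false, e, τ) = true} := by
  simp only [sample, liveElts, filter_filter]

/-- Given the elements uncovered before round `τ' ≤ τ`, the number counted in round `τ` is binomial,
and this is its generating function. It is used with `c = 1 / 2` for the lower tail and `c = 2` for
the upper tail. -/
lemma mean_mul_sample_pow {τ τ' S : ℕ} (hS : S ∈ I.sets) (hτ : τ < P.numRounds) (hτ' : τ' ≤ τ)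
    (f : ℕ → ℝ) (c : ℝ) :
    mean P I (fun x => f #(liveElts P I x τ' S) * c ^ #(sample P I x (alive P I x τ') τ S)) =
      mean P I (fun x => f #(liveElts P I x τ' S) *
        (1 + P.sampleProb τ * (c - 1)) ^ #(liveElts P I x τ' S)) := by
  have := mean_mul_prod (P := P) (I := I) (I.elts S) (fun e => (false, e, τ))
    (fun a b h => by simpa using h)
    (fun e he => mem_keySet (Or.inr (I.elts_subset S hS he)) hτ) (P.sampleProb τ) (fun _ => rfl)
    (fun x => f #(liveElts P I x τ' S)) (fun x => liveElts P I x τ' S)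
    (fun x => filter_subset _ _)
    (fun x y hxy => by
      have h1 := agree_of_lt hτ' hxy
      have : liveElts P I y τ' S = liveElts P I x τ' S := by
        simp only [liveElts]
        rw [alive_congr h1]
      simp only [this, and_self])
    (fun b => if b then c else 1)
  simp only [prod_coin_eq_pow, if_true, Bool.false_eq_true, if_false] at this
  simp only [sample_alive_eq]
  rw [this]
  congr 1
  funext x
  congr 2
  ring

/-- A set with many uncovered elements stays in the race with high probability. -/
lemma pr_not_passes_le {τ S : ℕ} (hS : S ∈ I.sets) (hτ : τ < P.numRounds) :
    pr P I (fun x => 2 ^ (P.level τ + 2) < #(liveElts P I x τ S) ∧ ¬Passes P I x τ S) ≤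
      (1 / 2) ^ 2 ^ P.ℓ := by
  -- Below level `ℓ` every element is counted, so the test is exact.
  rcases Nat.lt_or_ge (P.level τ) P.ℓ with hl | hl
  · rw [pr_false]
    · positivity
    rintro x ⟨h1, h2⟩
    refine h2 ?_
    rw [Passes, sample_alive_eq]
    have : ∀ e, P.coin x (false, e, τ) = true := fun e => by
      simp [Schedule.coin, Schedule.expo, Nat.sub_eq_zero_of_le hl.le]
    simp only [this, filter_true]
    rw [Schedule.thr, min_eq_left hl.le]
    exact (Nat.pow_le_pow_right (by norm_num) (by omega)).trans h1.le
  · have hthr : P.thr τ = 2 ^ P.ℓ := by rw [Schedule.thr, min_eq_right hl]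
    -- Markov for `(1 / 2) ^ count`. More than four times `2 ^ level` uncovered elements bring its
    -- mean below `exp (-2 * thr)`, hence below `(1 / 4) ^ thr`.
    have key := pr_le_of_mean_le (P := P) (I := I) (a := (1 / 2) ^ P.thr τ) (b := (1 / 4) ^ P.thr τ)
      (A := fun x => 2 ^ (P.level τ + 2) < #(liveElts P I x τ S) ∧ ¬Passes P I x τ S)
      (f := fun x => ind (2 ^ (P.level τ + 2) < #(liveElts P I x τ S)) *
        (1 / 2) ^ #(sample P I x (alive P I x τ) τ S)) (by positivity)
      (fun x => mul_nonneg (ind_nonneg _) (by positivity)) ?_ ?_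
    · refine key.trans_eq ?_
      rw [← div_pow, hthr]; norm_num
    · rintro x ⟨h1, h2⟩
      rw [ind_true h1, one_mul]
      rw [Passes, not_le] at h2
      exact pow_le_pow_of_le_one (by norm_num) (by norm_num) h2.le
    · rw [mean_mul_sample_pow hS hτ le_rfl (fun n => ind (2 ^ (P.level τ + 2) < n)) (1 / 2)]
      refine mean_le_of_forall fun x => ?_
      by_cases h : 2 ^ (P.level τ + 2) < #(liveElts P I x τ S)
      swap
      · rw [ind_false h, zero_mul]; positivity
      rw [ind_true h, one_mul]
      set n := #(liveElts P I x τ S)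
      have hq0 := P.sampleProb_nonneg τ
      have hq1 := P.sampleProb_le_one τ
      have h1 : 1 + P.sampleProb τ * (1 / 2 - 1) ≤ Real.exp (-(P.sampleProb τ / 2)) := by
        have := Real.add_one_le_exp (-(P.sampleProb τ / 2))
        linarith
      have hn : (2 : ℝ) ^ (P.level τ + 2) ≤ n := by exact_mod_cast h.le
      have h2 : (2 : ℝ) * P.thr τ ≤ n * (P.sampleProb τ / 2) := by
        rw [← P.sampleProb_mul τ]
        rw [pow_add] at hn
        nlinarith [mul_le_mul_of_nonneg_left hn hq0]
      calc (1 + P.sampleProb τ * (1 / 2 - 1)) ^ n ≤ Real.exp (-(P.sampleProb τ / 2)) ^ n :=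
            pow_le_pow_left₀ (by linarith) h1 n
        _ = Real.exp (-(n * (P.sampleProb τ / 2))) := by rw [← Real.exp_nat_mul]; ring_nf
        _ ≤ Real.exp (-(2 * P.thr τ)) := Real.exp_le_exp.2 (by linarith)
        _ = Real.exp (-2) ^ P.thr τ := by rw [← Real.exp_nat_mul]; ring_nf
        _ ≤ (1 / 4) ^ P.thr τ := by
          refine pow_le_pow_left₀ (Real.exp_pos _).le ?_ _
          have h3 : (2 : ℝ) ≤ Real.exp 1 := by have := Real.add_one_le_exp (1 : ℝ); linarith
          have h4 : Real.exp (-2) = (Real.exp 1 * Real.exp 1)⁻¹ := by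
            rw [← Real.exp_add, ← Real.exp_neg]; norm_num
          rw [h4, one_div]
          exact inv_anti₀ (by norm_num) (by nlinarith)

/-- After a stage, few elements of a given set are uncovered with high probability. -/
lemma pr_liveElts_stage_le {σ S : ℕ} (hS : S ∈ I.sets) (hσ : σ ≤ P.L) :
    pr P I (fun x => 2 ^ (P.L - σ + 2) < #(liveElts P I x ((σ + 1) * (P.T + 1)) S)) ≤
      (P.T + 1) * (1 / 2) ^ 2 ^ P.ℓ := by
  set τ₀ := σ * (P.T + 1) with hτ₀
  have hst : P.start τ₀ = τ₀ := by
    rw [Schedule.start_eq, hτ₀, Nat.mul_div_cancel _ (Nat.succ_pos _)]; ring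
  have hlev : ∀ j ≤ P.T, P.level (τ₀ + j) = P.L - σ := by
    intro j hj
    have := P.level_start_add (τ := τ₀) hj
    rw [hst] at this
    rw [this, Schedule.level, hτ₀, Nat.mul_div_cancel _ (Nat.succ_pos _)]
  have hlt : ∀ j ≤ P.T, τ₀ + j < P.numRounds := by
    intro j hj
    have : σ * (P.T + 1) ≤ P.L * (P.T + 1) := Nat.mul_le_mul_right _ hσ
    rw [Schedule.numRounds, add_mul]
    omega
  have hend : (σ + 1) * (P.T + 1) = τ₀ + P.T + 1 := by rw [hτ₀]; ring
  -- If the set passed every test of the stage, it would join in the last round and keep no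
  -- uncovered element. So some test fails, and it fails while the set still has many uncovered
  -- elements.
  have hincl : ∀ x, 2 ^ (P.L - σ + 2) < #(liveElts P I x ((σ + 1) * (P.T + 1)) S) →
      ∃ j ∈ range (P.T + 1), 2 ^ (P.level (τ₀ + j) + 2) < #(liveElts P I x (τ₀ + j) S) ∧
        ¬Passes P I x (τ₀ + j) S := by
    intro x hx
    by_contra hcon
    push Not at hcon
    have hbig : ∀ j ≤ P.T, 2 ^ (P.level (τ₀ + j) + 2) < #(liveElts P I x (τ₀ + j) S) := by
      intro j hj
      rw [hlev j hj]
      refine hx.trans_le (card_le_card (monotone_filter_right _ fun e _ he => ?_))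
      exact alive_antitone P I x (by rw [hend]; omega) he
    have hpass : ∀ j ≤ P.T, Passes P I x (τ₀ + j) S := fun j hj =>
      hcon j (mem_range.2 (by omega)) (hbig j hj)
    have hact : ∀ j ≤ P.T, S ∈ active P I x (τ₀ + j) := by
      intro j
      induction j with
      | zero =>
        intro h
        refine mem_filter.2 ⟨?_, hpass 0 h⟩
        have := cand_start P I x τ₀
        rw [hst] at this
        rwa [add_zero, this]
      | succ j ih =>
        intro h
        refine mem_filter.2 ⟨?_, hpass _ h⟩
        have := cand_start_succ P I x (τ := τ₀) h
        rw [hst] at this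
        rw [this]; exact ih (by omega)
    have hcoin : P.coin x (true, S, τ₀ + P.T) = true := by
      have := P.round_start_add (τ := τ₀) (le_refl P.T)
      rw [hst] at this
      simp [Schedule.coin, Schedule.expo, this]
    have : liveElts P I x ((σ + 1) * (P.T + 1)) S = ∅ := by
      rw [hend]
      refine filter_eq_empty_iff.2 fun e he he' => ?_
      exact ((mem_alive_succ P I x).1 he').2 S (hact _ le_rfl) hcoin he
    rw [this] at hx
    simp at hx
  calc _ ≤ pr P I (fun x => ∃ j ∈ range (P.T + 1), 2 ^ (P.level (τ₀ + j) + 2) <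
        #(liveElts P I x (τ₀ + j) S) ∧ ¬Passes P I x (τ₀ + j) S) := pr_mono hincl
    _ ≤ ∑ j ∈ range (P.T + 1), pr P I (fun x => 2 ^ (P.level (τ₀ + j) + 2) <
        #(liveElts P I x (τ₀ + j) S) ∧ ¬Passes P I x (τ₀ + j) S) := pr_exists_le _ _
    _ ≤ ∑ j ∈ range (P.T + 1), (1 / 2 : ℝ) ^ 2 ^ P.ℓ :=
        sum_le_sum fun j hj => pr_not_passes_le hS (hlt j (Nat.lt_succ_iff.1 (mem_range.1 hj)))
    _ = _ := by simp

/-- At the start of a stage, few elements of a given set are uncovered with high probability. -/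
lemma pr_liveElts_start_le {σ S : ℕ} (hS : S ∈ I.sets) (hσ : σ ≤ P.L)
    (hs : #(I.elts S) ≤ 2 ^ P.L) :
    pr P I (fun x => 2 ^ (P.L - σ + 3) < #(liveElts P I x (σ * (P.T + 1)) S)) ≤
      (P.T + 1) * (1 / 2) ^ 2 ^ P.ℓ := by
  cases σ with
  | zero =>
    rw [pr_false]
    · positivity
    intro x hx
    have h1 : #(liveElts P I x (0 * (P.T + 1)) S) ≤ 2 ^ P.L :=
      (card_le_card (filter_subset _ _)).trans hs
    have h2 : 2 ^ P.L ≤ 2 ^ (P.L - 0 + 3) := Nat.pow_le_pow_right (by norm_num) (by omega)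
    omega
  | succ σ =>
    have := pr_liveElts_stage_le (P := P) (I := I) hS (σ := σ) (by omega)
    rwa [show P.L - σ + 2 = P.L - (σ + 1) + 3 by omega] at this

/-- The local simulation rarely sees too many counted elements. -/
lemma pr_preSample_le {τ S : ℕ} (hS : S ∈ I.sets) (hτ : τ < P.numRounds)
    (hs : #(I.elts S) ≤ 2 ^ P.L) :
    pr P I (fun x => P.maxSample < #(preSample P I x τ S)) ≤ (P.T + 2) * (1 / 2) ^ 2 ^ P.ℓ := by
  set σ := τ / (P.T + 1) with hσ
  have hσL : σ ≤ P.L := by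
    rw [hσ]
    exact Nat.lt_succ_iff.1 (Nat.div_lt_of_lt_mul (by rw [Schedule.numRounds] at hτ; linarith))
  have hst : P.start τ = σ * (P.T + 1) := by rw [Schedule.start_eq]; ring
  have hlev : P.level τ = P.L - σ := rfl
  have h1 : pr P I (fun x => #(liveElts P I x (P.start τ) S) ≤ 2 ^ (P.level τ + 3) ∧
      P.maxSample < #(preSample P I x τ S)) ≤ (1 / 2) ^ 2 ^ P.ℓ := by
    have key := pr_le_of_mean_le (P := P) (I := I) (a := 2 ^ P.maxSample)
      (b := 2 ^ (16 * 2 ^ P.ℓ))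
      (A := fun x => #(liveElts P I x (P.start τ) S) ≤ 2 ^ (P.level τ + 3) ∧
        P.maxSample < #(preSample P I x τ S))
      (f := fun x => ind (#(liveElts P I x (P.start τ) S) ≤ 2 ^ (P.level τ + 3)) *
        2 ^ #(preSample P I x τ S)) (by positivity)
      (fun x => mul_nonneg (ind_nonneg _) (by positivity)) ?_ ?_
    · refine key.trans_eq ?_
      rw [Schedule.maxSample, show 17 * 2 ^ P.ℓ = 16 * 2 ^ P.ℓ + 2 ^ P.ℓ by ring, pow_add,
        one_div, inv_pow]
      field_simp
    · rintro x ⟨h1, h2⟩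
      rw [ind_true h1, one_mul]
      exact pow_le_pow_right₀ (by norm_num) h2.le
    · simp only [preSample]
      rw [mean_mul_sample_pow hS hτ (P.start_le τ) (fun n => ind (n ≤ 2 ^ (P.level τ + 3))) 2]
      refine mean_le_of_forall fun x => ?_
      by_cases h : #(liveElts P I x (P.start τ) S) ≤ 2 ^ (P.level τ + 3)
      swap
      · rw [ind_false h, zero_mul]; positivity
      rw [ind_true h, one_mul]
      set n := #(liveElts P I x (P.start τ) S)
      have hq0 := P.sampleProb_nonneg τ
      have hn : (n : ℝ) ≤ 2 ^ (P.level τ + 3) := by exact_mod_cast h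
      have hthr : (P.thr τ : ℝ) ≤ 2 ^ P.ℓ := by
        have : P.thr τ ≤ 2 ^ P.ℓ := Nat.pow_le_pow_right (by norm_num) (min_le_right _ _)
        exact_mod_cast this
      have h2 : n * P.sampleProb τ ≤ 8 * 2 ^ P.ℓ := by
        have := P.sampleProb_mul τ
        rw [pow_add] at hn
        nlinarith [mul_le_mul_of_nonneg_right hn hq0]
      have h3 : 1 + P.sampleProb τ * (2 - 1) ≤ Real.exp (P.sampleProb τ) := by
        have := Real.add_one_le_exp (P.sampleProb τ)
        linarith
      have h4 : Real.exp 1 ≤ 2 ^ 2 := by have := Real.exp_one_lt_d9; linarith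
      calc (1 + P.sampleProb τ * (2 - 1)) ^ n ≤ Real.exp (P.sampleProb τ) ^ n :=
            pow_le_pow_left₀ (by linarith) h3 n
        _ = Real.exp (n * P.sampleProb τ) := by rw [← Real.exp_nat_mul]
        _ ≤ Real.exp (8 * 2 ^ P.ℓ) := Real.exp_le_exp.2 h2
        _ = Real.exp 1 ^ (8 * 2 ^ P.ℓ) := by rw [← Real.exp_nat_mul]; push_cast; ring_nf
        _ ≤ (2 ^ 2) ^ (8 * 2 ^ P.ℓ) := pow_le_pow_left₀ (Real.exp_pos _).le h4 _
        _ = 2 ^ (16 * 2 ^ P.ℓ) := by rw [← pow_mul]; ring_nf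
  have h2 := pr_liveElts_start_le (P := P) (I := I) hS hσL hs
  rw [← hst] at h2
  calc _ ≤ pr P I (fun x => 2 ^ (P.L - σ + 3) < #(liveElts P I x (P.start τ) S) ∨
        (#(liveElts P I x (P.start τ) S) ≤ 2 ^ (P.level τ + 3) ∧
          P.maxSample < #(preSample P I x τ S))) := pr_mono fun x hx => by
          rw [hlev]
          rcases Nat.lt_or_ge (2 ^ (P.L - σ + 3)) #(liveElts P I x (P.start τ) S) with h | h
          · exact Or.inl h
          · exact Or.inr ⟨h, hx⟩
    _ ≤ _ := pr_or_le _ _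
    _ ≤ (P.T + 1) * (1 / 2) ^ 2 ^ P.ℓ + (1 / 2) ^ 2 ^ P.ℓ := add_le_add h2 h1
    _ = _ := by ring

lemma two_le_one_add_pow (d : ℕ) : (2 : ℝ) ≤ (1 + (1 / 2) ^ d) ^ 2 ^ d := by
  have h0 : (0 : ℝ) ≤ (1 / 2) ^ d := by positivity
  have := one_add_mul_le_pow (a := ((1 / 2) ^ d : ℝ)) (by linarith) (2 ^ d)
  refine le_trans ?_ this
  push_cast
  rw [← mul_pow]; norm_num

/-- The local simulation rarely sees too many sets around an uncovered element. -/
lemma pr_hitList_le {τ e k : ℕ} (hτ : τ < P.numRounds) (hk : k ≤ P.round τ)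
    (ht : #(I.setsOf e) ≤ 2 ^ P.T) :
    pr P I (fun x => e ∈ alive P I x τ ∧ P.cap (P.round τ - k) < #(hitList P I x τ e k)) ≤
      2 * (1 / 2) ^ 2 ^ P.ℓ := by
  set d := P.round τ - k with hd
  set c : ℝ := (1 / 2) ^ (d + 1) with hc
  have hc0 : 0 ≤ c := by positivity
  have hkT : k ≤ P.T := hk.trans (P.round_le τ)
  have hkτ : P.start τ + k ≤ τ := by have := P.start_add_round τ; omega
  -- The base `1 + c` is chosen so that `(1 + c) ^ cap d` is at least `2 ^ 2 ^ ℓ`. The event is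
  -- relaxed to `e` being uncovered before round `k` of the stage.
  have key := pr_le_of_mean_le (P := P) (I := I) (a := 2 ^ 2 ^ P.ℓ) (b := 2)
    (A := fun x => e ∈ alive P I x τ ∧ P.cap d < #(hitList P I x τ e k))
    (f := fun x => ind (e ∈ alive P I x (P.start τ + k)) * (1 + c) ^ #(hitList P I x τ e k))
    (by positivity) (fun x => mul_nonneg (ind_nonneg _) (by positivity)) ?_ ?_
  · refine key.trans_eq ?_
    rw [one_div, inv_pow, div_eq_mul_inv]
  · rintro x ⟨h1, h2⟩
    rw [ind_true (alive_antitone P I x hkτ h1), one_mul]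
    calc (2 : ℝ) ^ 2 ^ P.ℓ ≤ ((1 + c) ^ 2 ^ (d + 1)) ^ 2 ^ P.ℓ :=
          pow_le_pow_left₀ (by norm_num) (two_le_one_add_pow _) _
      _ = (1 + c) ^ P.cap d := by
          rw [← pow_mul, ← pow_add, Schedule.cap]; congr 2; ring
      _ ≤ _ := pow_le_pow_right₀ (by linarith) h2.le
  · have h1 := mean_mul_prod (P := P) (I := I) (I.setsOf e) (fun S => (true, S, τ))
      (fun a b h => by simpa using h)
      (fun S hS => mem_keySet (Or.inl (mem_setsOf.1 hS).1) hτ) (P.joinProb τ) (fun _ => rfl)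
      (fun x => ind (e ∈ alive P I x (P.start τ + k))) (fun x => candOf P I x (P.start τ + k) e)
      (fun x => filter_subset _ _)
      (fun x y hxy => by
        have h1 := agree_of_lt hkτ hxy
        refine ⟨by rw [alive_congr h1], ?_⟩
        simp only [candOf]
        rw [cand_congr h1])
      (fun b => if b then 1 + c else 1)
    simp only [prod_coin_eq_pow, if_true, Bool.false_eq_true, if_false] at h1
    have h2 : ∀ x, hitList P I x τ e k =
        {S ∈ candOf P I x (P.start τ + k) e | P.coin x (true, S, τ) = true} := by
      intro x
      ext S
      simp only [hitList, candOf, mem_filter]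
      tauto
    simp only [h2]
    rw [h1]
    have hpc : P.joinProb τ * (1 + c) + (1 - P.joinProb τ) * 1 = 1 + P.joinProb τ * c := by ring
    -- Averaging over the join coins of round `τ` turns `c` into `2 ^ -(T + 1 - k)`. For `k > 0`
    -- this is exactly the join probability in round `k - 1` of the stage.
    have hpc' : P.joinProb τ * c = (1 / 2) ^ (P.T + 1 - k) := by
      rw [Schedule.joinProb, hc, ← pow_add]
      congr 1
      have := P.round_le τ
      omega
    rw [hpc, hpc']
    cases k with
    | zero =>
      -- No earlier round of the stage has thinned the race here, but at most `2 ^ T` sets contain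
      -- `e`.
      refine mean_le_of_forall fun x => ?_
      have h3 : #(candOf P I x (P.start τ + 0) e) ≤ 2 ^ P.T :=
        (card_le_card (filter_subset _ _)).trans ht
      calc ind (e ∈ alive P I x (P.start τ + 0)) *
            (1 + (1 / 2) ^ (P.T + 1 - 0)) ^ #(candOf P I x (P.start τ + 0) e)
          ≤ 1 * (1 + (1 / 2) ^ (P.T + 1 - 0)) ^ 2 ^ P.T := by
            gcongr
            · exact ind_le_one _
            · have : (0 : ℝ) ≤ (1 / 2) ^ (P.T + 1 - 0) := by positivity
              linarith
        _ ≤ Real.exp ((1 / 2) ^ (P.T + 1)) ^ 2 ^ P.T := by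
            rw [one_mul, Nat.sub_zero]
            refine pow_le_pow_left₀ (by positivity) ?_ _
            have := Real.add_one_le_exp ((1 / 2 : ℝ) ^ (P.T + 1))
            linarith
        _ = Real.exp (1 / 2) := by
            rw [← Real.exp_nat_mul]
            congr 1
            push_cast
            rw [pow_succ, ← mul_assoc, ← mul_pow]; norm_num
        _ ≤ 2 := by
            have h4 : Real.exp (1 / 2) * Real.exp (1 / 2) = Real.exp 1 := by
              rw [← Real.exp_add]; norm_num
            have h5 := Real.exp_one_lt_d9
            nlinarith [Real.exp_pos (1 / 2)]
    | succ k =>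
      have hk' : k ≤ P.T := by omega
      have h3 : ∀ x, candOf P I x (P.start τ + (k + 1)) e = actOf P I x (P.start τ + k) e := by
        intro x
        simp only [candOf, actOf]
        rw [cand_start_succ P I x hkT]
      simp only [h3]
      simp only [← add_assoc]
      rw [mean_alive_succ_mul (by omega)]
      · refine mean_le_of_forall fun x => ?_
        have h4 : P.joinProb (P.start τ + k) = (1 / 2) ^ (P.T + 1 - (k + 1)) := by
          rw [Schedule.joinProb, P.round_start_add hk']
          congr 1; omega
        rw [h4, mul_assoc, ← mul_pow]
        set q : ℝ := (1 / 2) ^ (P.T + 1 - (k + 1))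
        have hq0 : 0 ≤ q := by positivity
        have hq1 : q ≤ 1 := pow_le_one₀ (by norm_num) (by norm_num)
        -- The growth `(1 + q) ^ d` is cancelled by the probability `(1 - q) ^ d` that `e` survived
        -- the preceding round: an uncovered element is unlikely to be surrounded by many active
        -- sets.
        have h5 : ((1 + q) * (1 - q)) ^ #(actOf P I x (P.start τ + k) e) ≤ 1 :=
          pow_le_one₀ (by nlinarith) (by nlinarith)
        have h6 : 0 ≤ ((1 + q) * (1 - q)) ^ #(actOf P I x (P.start τ + k) e) :=
          pow_nonneg (by nlinarith) _
        nlinarith [ind_le_one (e ∈ alive P I x (P.start τ + k)),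
          ind_nonneg (e ∈ alive P I x (P.start τ + k))]
      · intro x y hxy
        simp only [actOf]
        rw [active_congr (agree_of_lt le_rfl hxy) fun e => hxy _ (by simp)]

end Concentration

end LocalSetCover

open Finset

namespace LocalSetCover

/-! ### Union bound over the recursion -/

section FailureProbability

variable {P : Schedule} {I : SetSystem}

/-- A bound for the probability of each of the elementary reasons to give up. -/
noncomputable def Schedule.slack (P : Schedule) : ℝ := (P.T + 2) * (1 / 2) ^ 2 ^ P.ℓ

/-- The factor by which the failure probability grows from one round to the next. -/
noncomputable def Schedule.growth (P : Schedule) (s t : ℕ) : ℝ := 8 * s * t * (P.T + 1)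

lemma Schedule.slack_nonneg : 0 ≤ P.slack := by unfold slack; positivity

lemma not_fail_false_zero {x : Key → Bool} {e : ℕ} : ¬Fail P I x false 0 e := by
  intro h; cases h

lemma Fail.of_succ {x : Key → Bool} {τ e : ℕ} (h : Fail P I x false (τ + 1) e) :
    Fail P I x false τ e ∨
      (∃ k ∈ range (P.round τ + 1), e ∈ alive P I x τ ∧
        P.cap (P.round τ - k) < #(hitList P I x τ e k)) ∨
      ∃ S ∈ I.setsOf e, ∃ k ∈ range (P.round τ + 1), Fail P I x true (P.start τ + k) S := by
  cases h with
  | prev h => exact Or.inl h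
  | cap he hk h => exact Or.inr (Or.inl ⟨_, mem_range.2 (by omega), he, h⟩)
  | hit he hk hS h =>
    exact Or.inr (Or.inr ⟨_, (mem_filter.1 hS).1, _, mem_range.2 (by omega), h⟩)

lemma Fail.of_test {x : Key → Bool} {τ S : ℕ} (h : Fail P I x true τ S) :
    (∃ e ∈ I.elts S, Fail P I x false (P.start τ) e) ∨
      P.maxSample < #(preSample P I x τ S) ∨ ∃ e ∈ I.elts S, Fail P I x false τ e := by
  cases h with
  | start he _ h => exact Or.inl ⟨_, he, h⟩
  | sample h => exact Or.inr (Or.inl h)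
  | elem he h => exact Or.inr (Or.inr ⟨_, (mem_filter.1 he).1, h⟩)

/-- Needed to charge a failing set to one of its elements; an empty set never fails. -/
lemma FailSet.nonempty {x : Key → Bool} {S : ℕ} (h : FailSet P I x S) : (I.elts S).Nonempty := by
  obtain ⟨τ, _, _, k, _, _, h⟩ := h
  rcases h.of_test with ⟨e, he, _⟩ | h | ⟨e, he, _⟩
  · exact ⟨e, he⟩
  · obtain ⟨e, he⟩ := card_pos.1 ((Nat.zero_le _).trans_lt h)
    exact ⟨e, (mem_filter.1 he).1⟩
  · exact ⟨e, he⟩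

variable {s t : ℕ}

lemma pr_fail_test_le (hI : I.Bounded s t) (hsL : s ≤ 2 ^ P.L) (hs : 1 ≤ s) {τ S : ℕ}
    (hτ : τ < P.numRounds) (hS : S ∈ I.sets) {a : ℝ} (ha : P.slack ≤ a)
    (h1 : ∀ e ∈ I.univ, pr P I (fun x => Fail P I x false (P.start τ) e) ≤ a)
    (h2 : ∀ e ∈ I.univ, pr P I (fun x => Fail P I x false τ e) ≤ a) :
    pr P I (fun x => Fail P I x true τ S) ≤ 3 * s * a := by
  have ha0 : 0 ≤ a := P.slack_nonneg.trans ha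
  have hcard : (#(I.elts S) : ℝ) ≤ s := by exact_mod_cast hI.1 S hS
  have hsum : ∀ τ', (∀ e ∈ I.univ, pr P I (fun x => Fail P I x false τ' e) ≤ a) →
      pr P I (fun x => ∃ e ∈ I.elts S, Fail P I x false τ' e) ≤ s * a := by
    intro τ' h
    calc _ ≤ ∑ e ∈ I.elts S, pr P I (fun x => Fail P I x false τ' e) := pr_exists_le _ _
      _ ≤ ∑ e ∈ I.elts S, a := sum_le_sum fun e he => h e (I.elts_subset S hS he)
      _ = #(I.elts S) * a := by rw [sum_const, nsmul_eq_mul]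
      _ ≤ s * a := mul_le_mul_of_nonneg_right hcard ha0
  have hs' : (1 : ℝ) ≤ s := by exact_mod_cast hs
  have h3 : pr P I (fun x => P.maxSample < #(preSample P I x τ S)) ≤ s * a :=
    (pr_preSample_le hS hτ ((hI.1 S hS).trans hsL)).trans (ha.trans (by nlinarith))
  calc _ ≤ pr P I (fun x => (∃ e ∈ I.elts S, Fail P I x false (P.start τ) e) ∨
        (P.maxSample < #(preSample P I x τ S) ∨ ∃ e ∈ I.elts S, Fail P I x false τ e)) :=
        pr_mono fun x h => h.of_test
    _ ≤ _ := pr_or_le _ _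
    _ ≤ s * a + (s * a + s * a) :=
        add_le_add (hsum _ h1) ((pr_or_le _ _).trans (add_le_add h3 (hsum _ h2)))
    _ = _ := by ring

lemma Schedule.one_le_growth (hs : 1 ≤ s) (ht : 1 ≤ t) : 1 ≤ P.growth s t := by
  have h : 1 ≤ 8 * s * t * (P.T + 1) := by
    have : 0 < 8 * s * t * (P.T + 1) := by positivity
    omega
  unfold growth
  exact_mod_cast h

/-- Each round multiplies the bound by at most `growth`, through a union over sets, rounds of the
stage and elements. Strong induction is needed because a round consults all earlier rounds of its
stage. -/
lemma pr_fail_le (hI : I.Bounded s t) (hsL : s ≤ 2 ^ P.L) (htT : t ≤ 2 ^ P.T) (hs : 1 ≤ s)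
    (ht : 1 ≤ t) {τ : ℕ} (hτ : τ ≤ P.numRounds) :
    ∀ e ∈ I.univ, pr P I (fun x => Fail P I x false τ e) ≤ P.growth s t ^ τ * P.slack := by
  have hG := P.one_le_growth hs ht
  have hδ := P.slack_nonneg
  induction τ using Nat.strong_induction_on with
  | _ τ ih =>
    cases τ with
    | zero =>
      intro e _
      rw [pr_false fun x => not_fail_false_zero]
      positivity
    | succ τ =>
      intro e he
      set a := P.growth s t ^ τ * P.slack with ha
      have hδa : P.slack ≤ a := le_mul_of_one_le_left hδ (one_le_pow₀ hG)
      have ha0 : 0 ≤ a := hδ.trans hδa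
      have hle : ∀ τ' ≤ τ, ∀ e ∈ I.univ, pr P I (fun x => Fail P I x false τ' e) ≤ a := by
        intro τ' h e he
        exact (ih τ' (by omega) (by omega) e he).trans
          (mul_le_mul_of_nonneg_right (pow_le_pow_right₀ hG h) hδ)
      have hround : ((P.round τ + 1 : ℕ) : ℝ) ≤ P.T + 1 := by
        have := P.round_le τ
        exact_mod_cast Nat.succ_le_succ this
      have h1 : pr P I (fun x => ∃ k ∈ range (P.round τ + 1), e ∈ alive P I x τ ∧
          P.cap (P.round τ - k) < #(hitList P I x τ e k)) ≤ (P.T + 1) * a := by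
        calc _ ≤ ∑ k ∈ range (P.round τ + 1), pr P I (fun x => e ∈ alive P I x τ ∧
                P.cap (P.round τ - k) < #(hitList P I x τ e k)) := pr_exists_le _ _
          _ ≤ ∑ k ∈ range (P.round τ + 1), a := by
              refine sum_le_sum fun k hk => ?_
              refine (pr_hitList_le (by omega) (Nat.lt_succ_iff.1 (mem_range.1 hk))
                ((hI.2 e he).trans htT)).trans (le_trans ?_ hδa)
              unfold Schedule.slack
              gcongr
              have : (0 : ℝ) ≤ P.T := Nat.cast_nonneg _
              linarith
          _ = ((P.round τ + 1 : ℕ) : ℝ) * a := by rw [sum_const, nsmul_eq_mul, card_range]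
          _ ≤ _ := mul_le_mul_of_nonneg_right hround ha0
      have h2 : pr P I (fun x => ∃ S ∈ I.setsOf e, ∃ k ∈ range (P.round τ + 1),
          Fail P I x true (P.start τ + k) S) ≤ t * ((P.T + 1) * (3 * s * a)) := by
        calc _ ≤ ∑ S ∈ I.setsOf e, pr P I (fun x => ∃ k ∈ range (P.round τ + 1),
                Fail P I x true (P.start τ + k) S) := pr_exists_le _ _
          _ ≤ ∑ S ∈ I.setsOf e, ∑ k ∈ range (P.round τ + 1),
                pr P I (fun x => Fail P I x true (P.start τ + k) S) :=
              sum_le_sum fun S _ => pr_exists_le _ _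
          _ ≤ ∑ S ∈ I.setsOf e, ∑ k ∈ range (P.round τ + 1), 3 * s * a := by
              refine sum_le_sum fun S hS => sum_le_sum fun k hk => ?_
              have hk' : P.start τ + k ≤ τ := by
                have := P.start_add_round τ
                have := mem_range.1 hk
                omega
              exact pr_fail_test_le hI hsL hs (by omega) (mem_setsOf.1 hS).1 hδa
                (hle _ ((P.start_le _).trans hk')) (hle _ hk')
          _ = #(I.setsOf e) * (((P.round τ + 1 : ℕ) : ℝ) * (3 * s * a)) := by
              rw [sum_const, sum_const, nsmul_eq_mul, nsmul_eq_mul, card_range]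
          _ ≤ t * ((P.T + 1) * (3 * s * a)) := by
              have : (#(I.setsOf e) : ℝ) ≤ t := by exact_mod_cast hI.2 e he
              gcongr
      have hs' : (1 : ℝ) ≤ s := by exact_mod_cast hs
      have ht' : (1 : ℝ) ≤ t := by exact_mod_cast ht
      have hst : (1 : ℝ) ≤ s * t := by nlinarith
      have hT : (0 : ℝ) ≤ P.T := Nat.cast_nonneg _
      have hstT : (P.T : ℝ) + 1 ≤ s * t * (P.T + 1) := by nlinarith
      calc _ ≤ pr P I (fun x => Fail P I x false τ e ∨
            ((∃ k ∈ range (P.round τ + 1), e ∈ alive P I x τ ∧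
              P.cap (P.round τ - k) < #(hitList P I x τ e k)) ∨
            ∃ S ∈ I.setsOf e, ∃ k ∈ range (P.round τ + 1),
              Fail P I x true (P.start τ + k) S)) := pr_mono fun x h => h.of_succ
        _ ≤ a + ((P.T + 1) * a + t * ((P.T + 1) * (3 * s * a))) :=
            (pr_or_le _ _).trans (add_le_add (hle τ le_rfl e he)
              ((pr_or_le _ _).trans (add_le_add h1 h2)))
        _ = (1 + (P.T + 1) + 3 * (s * t * (P.T + 1))) * a := by ring
        _ ≤ P.growth s t * a := by
            refine mul_le_mul_of_nonneg_right ?_ ha0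
            unfold Schedule.growth
            nlinarith
        _ = _ := by rw [ha]; ring

/-- A bound for the probability that the simulation gives up on a given set. -/
noncomputable def Schedule.failBound (P : Schedule) (s t : ℕ) : ℝ :=
  P.numRounds * ((P.T + 1) * (3 * s * (P.growth s t ^ P.numRounds * P.slack)))

lemma pr_failSet_le (hI : I.Bounded s t) (hsL : s ≤ 2 ^ P.L) (htT : t ≤ 2 ^ P.T) (hs : 1 ≤ s)
    (ht : 1 ≤ t) {S : ℕ} (hS : S ∈ I.sets) :
    pr P I (fun x => FailSet P I x S) ≤ P.failBound s t := by
  have hG := P.one_le_growth hs ht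
  have hδ := P.slack_nonneg
  set a := P.growth s t ^ P.numRounds * P.slack with ha
  have hδa : P.slack ≤ a := le_mul_of_one_le_left hδ (one_le_pow₀ hG)
  have ha0 : 0 ≤ a := hδ.trans hδa
  have hle : ∀ τ' ≤ P.numRounds, ∀ e ∈ I.univ, pr P I (fun x => Fail P I x false τ' e) ≤ a :=
    fun τ' h e he => (pr_fail_le hI hsL htT hs ht h e he).trans
      (mul_le_mul_of_nonneg_right (pow_le_pow_right₀ hG h) hδ)
  calc _ ≤ pr P I (fun x => ∃ τ ∈ range P.numRounds, ∃ k ∈ range (P.round τ + 1),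
          Fail P I x true (P.start τ + k) S) := pr_mono fun x h => by
        obtain ⟨τ, hτ, _, k, hk, _, h⟩ := h
        exact ⟨τ, mem_range.2 hτ, k, mem_range.2 (by omega), h⟩
    _ ≤ ∑ τ ∈ range P.numRounds, pr P I (fun x => ∃ k ∈ range (P.round τ + 1),
          Fail P I x true (P.start τ + k) S) := pr_exists_le _ _
    _ ≤ ∑ τ ∈ range P.numRounds, ∑ k ∈ range (P.round τ + 1),
          pr P I (fun x => Fail P I x true (P.start τ + k) S) :=
        sum_le_sum fun τ _ => pr_exists_le _ _
    _ ≤ ∑ τ ∈ range P.numRounds, ∑ k ∈ range (P.round τ + 1), 3 * s * a := by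
        refine sum_le_sum fun τ hτ => sum_le_sum fun k hk => ?_
        have hk' : P.start τ + k ≤ τ := by
          have := P.start_add_round τ
          have := mem_range.1 hk
          omega
        have hτ := mem_range.1 hτ
        exact pr_fail_test_le hI hsL hs (by omega) hS hδa
          (hle _ ((P.start_le _).trans (by omega))) (hle _ (by omega))
    _ ≤ ∑ τ ∈ range P.numRounds, (P.T + 1) * (3 * s * a) := by
        refine sum_le_sum fun τ _ => ?_
        rw [sum_const, nsmul_eq_mul, card_range]
        have : ((P.round τ + 1 : ℕ) : ℝ) ≤ P.T + 1 := by
          exact_mod_cast Nat.succ_le_succ (P.round_le τ)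
        gcongr
    _ = P.failBound s t := by
        rw [sum_const, nsmul_eq_mul, card_range]; rfl

end FailureProbability

/-! ### Expected size through LP duality -/

section Size

variable {P : Schedule} {I : SetSystem}

/-- Weak linear programming duality. -/
lemma sum_le_mul_opt {y : ℕ → ℝ} {M : ℝ} (hy : ∀ e ∈ I.univ, 0 ≤ y e) (hM : 0 < M)
    (h : ∀ S ∈ I.sets, ∑ e ∈ I.elts S, y e ≤ M) : ∑ e ∈ I.univ, y e ≤ M * I.opt := by
  rw [← div_le_iff₀' hM]
  -- The all-ones weighting shows that the infimum is over a nonempty set.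
  refine le_csInf ⟨_, fun _ => 1, ⟨fun _ _ => zero_le_one, fun e he => ?_⟩, rfl⟩ ?_
  · obtain ⟨S, hS, he⟩ := I.exists_mem e he
    have : 0 < #(I.setsOf e) := card_pos.2 ⟨S, mem_setsOf.2 ⟨hS, he⟩⟩
    rw [sum_const, nsmul_eq_mul, mul_one]
    exact_mod_cast this
  · rintro v ⟨x, ⟨hx0, hx1⟩, rfl⟩
    rw [div_le_iff₀' hM]
    calc ∑ e ∈ I.univ, y e ≤ ∑ e ∈ I.univ, ∑ S ∈ I.setsOf e, x S * y e := by
          refine sum_le_sum fun e he => ?_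
          rw [← sum_mul]
          exact le_mul_of_one_le_left (hy e he) (hx1 e he)
      _ = ∑ S ∈ I.sets, ∑ e ∈ I.elts S, x S * y e := (sum_sets_elts fun S e => x S * y e).symm
      _ ≤ ∑ S ∈ I.sets, x S * M := by
          refine sum_le_sum fun S hS => ?_
          rw [← mul_sum]
          exact mul_le_mul_of_nonneg_left (h S hS) (hx0 S hS)
      _ = M * ∑ S ∈ I.sets, x S := by rw [← sum_mul, mul_comm]

variable {s t : ℕ}

/-- Beyond the typical bound, the rare event adds at most `s` elements with probability `slack`,
hence at most one in the mean. -/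
lemma mean_liveElts_le (hI : I.Bounded s t) (hsL : s ≤ 2 ^ P.L) {S σ : ℕ} (hS : S ∈ I.sets)
    (hσ : σ ≤ P.L) (hsmall : s * P.slack ≤ 1) :
    mean P I (fun x => (#(liveElts P I x (σ * (P.T + 1)) S) : ℝ)) ≤ 2 ^ (P.L - σ + 3) + 1 := by
  have hcard := hI.1 S hS
  calc mean P I (fun x => (#(liveElts P I x (σ * (P.T + 1)) S) : ℝ))
      ≤ mean P I (fun x => 2 ^ (P.L - σ + 3) +
          s * ind (2 ^ (P.L - σ + 3) < #(liveElts P I x (σ * (P.T + 1)) S))) := by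
        refine mean_mono fun x => ?_
        by_cases h : 2 ^ (P.L - σ + 3) < #(liveElts P I x (σ * (P.T + 1)) S)
        · rw [ind_true h, mul_one]
          have : (#(liveElts P I x (σ * (P.T + 1)) S) : ℝ) ≤ s := by
            exact_mod_cast (card_le_card (filter_subset _ _)).trans hcard
          have h2 : (0 : ℝ) ≤ 2 ^ (P.L - σ + 3) := by positivity
          linarith
        · rw [ind_false h, mul_zero, add_zero]
          exact_mod_cast not_lt.1 h
    _ = 2 ^ (P.L - σ + 3) +
          s * pr P I (fun x => 2 ^ (P.L - σ + 3) < #(liveElts P I x (σ * (P.T + 1)) S)) := by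
        rw [mean_add, mean_const, mean_const_mul]; rfl
    _ ≤ 2 ^ (P.L - σ + 3) + s * P.slack := by
        gcongr
        refine (pr_liveElts_start_le hS hσ (hcard.trans hsL)).trans ?_
        unfold Schedule.slack
        gcongr
        norm_num
    _ ≤ _ := by gcongr

lemma sum_range_numRounds (f : ℕ → ℝ) :
    ∑ τ ∈ range P.numRounds, f τ =
      ∑ σ ∈ range (P.L + 1), ∑ j ∈ range (P.T + 1), f (σ * (P.T + 1) + j) := by
  rw [Schedule.numRounds]
  induction P.L + 1 with
  | zero => simp
  | succ n ih => rw [Nat.succ_mul, sum_range_add, ih, sum_range_succ _ n]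

/-- The expected size of the cover. -/
lemma mean_cover_le (hI : I.Bounded s t) (hsL : s ≤ 2 ^ P.L) (htT : t ≤ 2 ^ P.T) (hs : 1 ≤ s)
    (ht : 1 ≤ t) (hslack : s * P.slack ≤ 1) (hfail : s * (t * P.failBound s t) ≤ 1) :
    mean P I (fun x => (#(cover P I x) : ℝ)) ≤ 28 * (P.L + 1) * I.opt := by
  classical
  have hη : 0 ≤ P.failBound s t := by
    have h1 := zero_le_one.trans (P.one_le_growth hs ht)
    have h2 := P.slack_nonneg
    unfold Schedule.failBound
    positivity
  -- The dual variable of `e`: its charges over all stages, plus a failure charge for each of the at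
  -- most `t` sets containing it.
  set y : ℕ → ℝ := fun e => ∑ σ ∈ range (P.L + 1), 3 * (1 / 2) ^ (P.L - σ) *
    pr P I (fun x => e ∈ alive P I x (σ * (P.T + 1))) + t * P.failBound s t with hy
  have h1 : mean P I (fun x => (#(cover P I x) : ℝ)) ≤ ∑ e ∈ I.univ, y e := by
    have hcov : ∀ x, (#(cover P I x) : ℝ) ≤ ∑ τ ∈ range P.numRounds, (#(joined P I x τ) : ℝ) +
        ∑ S ∈ I.sets, ind (FailSet P I x S) := by
      intro x
      have hsub : cover P I x ⊆ (range P.numRounds).biUnion (joined P I x) ∪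
          {S ∈ I.sets | FailSet P I x S} := by
        intro S hS
        obtain ⟨hS, ⟨τ, hτ, h⟩ | h⟩ := mem_filter.1 hS
        · exact mem_union_left _ (mem_biUnion.2 ⟨τ, mem_range.2 hτ, h⟩)
        · exact mem_union_right _ (mem_filter.2 ⟨hS, h⟩)
      rw [← card_filter_eq_sum_ind]
      have hle : #(cover P I x) ≤ ∑ τ ∈ range P.numRounds, #(joined P I x τ) +
          #{S ∈ I.sets | FailSet P I x S} := (card_le_card hsub).trans
        ((card_union_le _ _).trans (Nat.add_le_add_right card_biUnion_le _))
      exact_mod_cast hle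
    refine (mean_mono hcov).trans ?_
    rw [mean_add, mean_sum, mean_sum, sum_range_numRounds, hy, sum_add_distrib]
    apply add_le_add
    · conv_rhs => rw [sum_comm]
      refine sum_le_sum fun σ hσ => ?_
      rw [← mul_sum]
      exact mean_joined_stage_le (Nat.lt_succ_iff.1 (mem_range.1 hσ))
        fun e he => (hI.2 e he).trans htT
    · calc ∑ S ∈ I.sets, mean P I (fun x => ind (FailSet P I x S))
          ≤ ∑ S ∈ I.sets, ∑ e ∈ I.elts S, P.failBound s t := by
            refine sum_le_sum fun S hS => ?_
            rcases (I.elts S).eq_empty_or_nonempty with h0 | h0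
            · rw [h0, sum_empty]
              exact (pr_false fun x h => by simpa [h0] using h.nonempty).le
            · rw [sum_const, nsmul_eq_mul]
              refine (pr_failSet_le hI hsL htT hs ht hS).trans (le_mul_of_one_le_left hη ?_)
              exact_mod_cast card_pos.2 h0
        _ = ∑ e ∈ I.univ, ∑ S ∈ I.setsOf e, P.failBound s t :=
            sum_sets_elts fun _ _ => P.failBound s t
        _ ≤ ∑ e ∈ I.univ, t * P.failBound s t := by
            refine sum_le_sum fun e he => ?_
            rw [sum_const, nsmul_eq_mul]
            have : (#(I.setsOf e) : ℝ) ≤ t := by exact_mod_cast hI.2 e he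
            gcongr
  refine h1.trans (sum_le_mul_opt (fun e _ => ?_) (by positivity) fun S hS => ?_)
  · refine add_nonneg (sum_nonneg fun σ _ => mul_nonneg (by positivity) (pr_nonneg _)) (by positivity)
  · rw [hy, sum_add_distrib, sum_comm]
    have h2 : ∑ e ∈ I.elts S, (t : ℝ) * P.failBound s t ≤ 1 := by
      rw [sum_const, nsmul_eq_mul]
      refine le_trans ?_ hfail
      have : (#(I.elts S) : ℝ) ≤ s := by exact_mod_cast hI.1 S hS
      gcongr
    -- With `E` the mean number of uncovered elements, `3 * 2 ^ -level * E ≤ 3 * (8 + 1)`. Over `L +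
    -- 1` stages, plus one unit for failures, this stays below `28 * (L + 1)`.
    have h3 : ∀ σ ∈ range (P.L + 1), ∑ e ∈ I.elts S, 3 * (1 / 2 : ℝ) ^ (P.L - σ) *
        pr P I (fun x => e ∈ alive P I x (σ * (P.T + 1))) ≤ 27 := by
      intro σ hσ
      have hm : ∑ e ∈ I.elts S, pr P I (fun x => e ∈ alive P I x (σ * (P.T + 1))) =
          mean P I (fun x => (#(liveElts P I x (σ * (P.T + 1)) S) : ℝ)) := by
        simp only [liveElts, card_filter_eq_sum_ind]
        rw [mean_sum]; rfl
      rw [← mul_sum, hm]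
      have h4 := mean_liveElts_le hI hsL hS (Nat.lt_succ_iff.1 (mem_range.1 hσ)) hslack
      have h5 : (1 / 2 : ℝ) ^ (P.L - σ) ≤ 1 := pow_le_one₀ (by norm_num) (by norm_num)
      have h6 : (1 / 2 : ℝ) ^ (P.L - σ) * 2 ^ (P.L - σ) = 1 := by rw [← mul_pow]; norm_num
      have h7 : (0 : ℝ) ≤ (1 / 2) ^ (P.L - σ) := by positivity
      rw [pow_add] at h4
      nlinarith [mul_le_mul_of_nonneg_left h4 h7]
    have h8 := sum_le_sum h3
    rw [sum_const, nsmul_eq_mul, card_range] at h8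
    push_cast at h8
    have hL : (0 : ℝ) ≤ P.L := Nat.cast_nonneg _
    linarith

end Size

end LocalSetCover

open Finset

namespace LocalSetCover

/-! ### A recursive query machine -/

/-- The results of subroutines; `none` means that the simulation gives up. -/
abbrev Val := Option (List ℕ)

/-- A subroutine call: the name of the subroutine, a round, an auxiliary number and a list. -/
abbrev Task := ℕ × ℕ × ℕ × List ℕ

/-- A running subroutine, with the list of results that it has obtained so far. -/
abbrev Frame := Task × List Val

/-- What a running subroutine does next: call a subroutine, query the input or the tape, or
return. -/
abbrev Instr := Task ⊕ LCAAction ⊕ Val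

namespace Machine

/-- Hand a result to the topmost subroutine. -/
def push (st : List Frame) (v : Val) : List Frame :=
  st.modifyHead fun f => (f.1, f.2 ++ [v])

/-- One step of the machine, on receiving a response. -/
def step (body : Frame → Instr) (st : List Frame) (o : Option ℕ) : List Frame :=
  match st.head? with
  | none => []
  | some f =>
    match body f with
    | .inl b => (b, []) :: st
    | .inr (.inl _) => push st (o.map fun n => [n])
    | .inr (.inr v) => push st.tail v

/-- The next action of the machine. Calls and returns read an irrelevant tape bit. -/
def action (body : Frame → Instr) (st : List Frame) : LCAAction :=
  match st.head? with
  | none => .answer false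
  | some f =>
    match body f with
    | .inl _ => .readBit 0
    | .inr (.inl a) => a
    | .inr (.inr v) => if st.tail = [] then .answer (decide (v ≠ some [])) else .readBit 0

/-- The state of the machine after the responses `h`. -/
def state (body : Frame → Instr) (root : Task) (h : List (Option ℕ)) : List Frame :=
  h.foldl (step body) [(root, [])]

/-! ### Big-step evaluation and its agreement with the stack machine -/

section Semantics

variable (body : Frame → Instr) {I : SetSystem} (R : I.Representation) (ω : ℕ → Bool)

/-- `Ev body R ω b acc v q`: the subroutine call `b`, having obtained the results `acc`, returns
`v` after `q` further neighbor queries. -/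
inductive Ev : Task → List Val → Val → ℕ → Prop
  | ret {b : Task} {acc : List Val} {v : Val} (h : body (b, acc) = .inr (.inr v)) : Ev b acc v 0
  | call {b b' : Task} {acc : List Val} {v w : Val} {q q' : ℕ} (h : body (b, acc) = .inl b')
      (h₁ : Ev b' [] v q) (h₂ : Ev b (acc ++ [v]) w q') : Ev b acc w (q + q')
  | querySet {b : Task} {acc : List Val} {v : Val} {S i q : ℕ}
      (h : body (b, acc) = .inr (.inl (.querySet S i)))
      (h₁ : Ev b (acc ++ [(R.setList S)[i]?.map fun n => [n]]) v q) : Ev b acc v (q + 1)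
  | queryElem {b : Task} {acc : List Val} {v : Val} {e i q : ℕ}
      (h : body (b, acc) = .inr (.inl (.queryElem e i)))
      (h₁ : Ev b (acc ++ [(R.elemList e)[i]?.map fun n => [n]]) v q) : Ev b acc v (q + 1)
  | readBit {b : Task} {acc : List Val} {v : Val} {j q : ℕ}
      (h : body (b, acc) = .inr (.inl (.readBit j)))
      (h₁ : Ev b (acc ++ [some [(ω j).toNat]]) v q) : Ev b acc v q

variable {body R ω}

/-- The hypothesis on `h'` is a continuation: it says what the algorithm does once the call is about
to return `v` above the untouched frames `r`. It ranges over all histories, because only the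
resulting stack matters. In this form a nested call is handled by passing the rest of its caller as
continuation. -/
lemma Ev.run {A : LocalAlgorithm} {s t S : ℕ} {root : Task}
    (hA : ∀ h, A.next s t S h = action body (state body root h))
    {b : Task} {acc : List Val} {v : Val} {q : ℕ} (hev : Ev body R ω b acc v q) :
    ∀ (r : List Frame) (h : List (Option ℕ)) (q' : ℕ) (res : Bool),
      state body root h = (b, acc) :: r →
      (∀ h' acc', state body root h' = (b, acc') :: r → body (b, acc') = .inr (.inr v) →
        A.Run s t S R ω h' q' res) → A.Run s t S R ω h (q + q') res := by
  have hstate : ∀ h o, state body root (h ++ [o]) = step body (state body root h) o := by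
    intro h o; simp [state, List.foldl_append]
  induction hev with
  | ret h =>
    intro r hh q' res hst K
    rw [zero_add]
    exact K hh _ hst h
  | @call b b' acc v w q₁ q₂ h h₁ h₂ ih₁ ih₂ =>
    intro r hh q' res hst K
    refine .readBit (j := 0) (by simp [hA, hst, action, h]) ?_
    rw [add_assoc]
    refine ih₁ ((b, acc) :: r) _ (q₂ + q') res (by simp [hstate, hst, step, h]) ?_
    intro h' acc' hst' hret
    refine .readBit (j := 0) (by simp [hA, hst', action, hret]) ?_
    exact ih₂ r _ q' res (by simp [hstate, hst', step, hret, push]) K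
  | querySet h _ ih =>
    intro r hh q' res hst K
    rw [add_right_comm]
    exact .querySet (by simp [hA, hst, action, h]; exact ⟨rfl, rfl⟩)
      (ih r _ q' res (by simp [hstate, hst, step, h, push]) K)
  | queryElem h _ ih =>
    intro r hh q' res hst K
    rw [add_right_comm]
    exact .queryElem (by simp [hA, hst, action, h]; exact ⟨rfl, rfl⟩)
      (ih r _ q' res (by simp [hstate, hst, step, h, push]) K)
  | readBit h _ ih =>
    intro r hh q' res hst K
    exact .readBit (by simp [hA, hst, action, h]; rfl)
      (ih r _ q' res (by simp [hstate, hst, step, h, push]) K)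

lemma Ev.answers {A : LocalAlgorithm} {s t S : ℕ} {root : Task}
    (hA : ∀ h, A.next s t S h = action body (state body root h)) {v : Val} {q : ℕ}
    (hev : Ev body R ω root [] v q) : A.Run s t S R ω [] q (decide (v ≠ some [])) := by
  have := hev.run hA [] [] 0 (decide (v ≠ some [])) rfl fun h' acc' hst hret =>
    .answer (by simp [hA, hst, action, hret])
  simpa using this

variable (body R ω) in
/-- The subroutine call `b`, having obtained the results `acc`, returns `v` after at most `q`
further neighbor queries. -/
def EvLe (b : Task) (acc : List Val) (v : Val) (q : ℕ) : Prop :=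
  ∃ q' ≤ q, Ev body R ω b acc v q'

lemma EvLe.mono {b : Task} {acc : List Val} {v : Val} {q q' : ℕ} (h : EvLe body R ω b acc v q)
    (hq : q ≤ q') : EvLe body R ω b acc v q' := by
  obtain ⟨p, hp, h⟩ := h
  exact ⟨p, hp.trans hq, h⟩

lemma EvLe.ret {b : Task} {acc : List Val} {v : Val} (h : body (b, acc) = .inr (.inr v)) (q : ℕ) :
    EvLe body R ω b acc v q := ⟨0, Nat.zero_le _, .ret h⟩

lemma EvLe.call {b b' : Task} {acc : List Val} {v w : Val} {q q' : ℕ}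
    (h : body (b, acc) = .inl b') (h₁ : EvLe body R ω b' [] v q)
    (h₂ : EvLe body R ω b (acc ++ [v]) w q') : EvLe body R ω b acc w (q + q') := by
  obtain ⟨p, hp, h₁⟩ := h₁
  obtain ⟨p', hp', h₂⟩ := h₂
  exact ⟨p + p', Nat.add_le_add hp hp', .call h h₁ h₂⟩

end Semantics

/-! ### Computability of the machine -/

section Primrec

variable {α : Type*} [Primcodable α]

lemma primrec_querySet {f g : α → ℕ} (hf : Primrec f) (hg : Primrec g) :
    Primrec fun a => LCAAction.querySet (f a) (g a) :=
  (Primrec.of_equiv_symm (e := LCAAction.equivSum)).comp (Primrec.sumInl.comp (hf.pair hg))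

lemma primrec_queryElem {f g : α → ℕ} (hf : Primrec f) (hg : Primrec g) :
    Primrec fun a => LCAAction.queryElem (f a) (g a) :=
  (Primrec.of_equiv_symm (e := LCAAction.equivSum)).comp
    (Primrec.sumInr.comp (Primrec.sumInl.comp (hf.pair hg)))

lemma primrec_readBit {f : α → ℕ} (hf : Primrec f) : Primrec fun a => LCAAction.readBit (f a) :=
  (Primrec.of_equiv_symm (e := LCAAction.equivSum)).comp
    (Primrec.sumInr.comp (Primrec.sumInr.comp (Primrec.sumInl.comp hf)))

lemma primrec_answer {f : α → Bool} (hf : Primrec f) : Primrec fun a => LCAAction.answer (f a) :=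
  (Primrec.of_equiv_symm (e := LCAAction.equivSum)).comp
    (Primrec.sumInr.comp (Primrec.sumInr.comp (Primrec.sumInr.comp hf)))

lemma primrec_push {f : α → List Frame} {g : α → Val} (hf : Primrec f) (hg : Primrec g) :
    Primrec fun a => push (f a) (g a) := by
  have : Primrec₂ fun (v : Val) (f : Frame) => ((f.1, f.2 ++ [v]) : Frame) :=
    (Primrec.fst.comp Primrec.snd).pair
      (Primrec.list_concat.comp (Primrec.snd.comp Primrec.snd) Primrec.fst)
  exact (Primrec.list_modifyHead' this).comp hf hg

lemma primrec_step {body : α → Frame → Instr} (hb : Primrec₂ body) {f : α → List Frame}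
    {o : α → Option ℕ} (hf : Primrec f) (ho : Primrec o) :
    Primrec fun a => step (body a) (f a) (o a) := by
  have h1 : Primrec fun a => ((f a).head?.map (body a)) :=
    Primrec.option_map (Primrec.list_head?.comp hf) hb
  have hres : Primrec fun a => (o a).map fun n => [n] :=
    Primrec.option_map ho (Primrec.list_cons.comp₂ Primrec₂.right (Primrec₂.const []))
  have h2 : Primrec fun a => ((f a).head?.map (body a)).casesOn (motive := fun _ => List Frame) []
      (fun i => i.casesOn (motive := fun _ => List Frame) (fun b => (b, []) :: f a)
        (fun j => j.casesOn (motive := fun _ => List Frame)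
          (fun _ => push (f a) ((o a).map fun n => [n])) (fun v => push (f a).tail v))) := by
    refine Primrec.option_casesOn h1 (Primrec.const _) ?_
    refine Primrec.sumCasesOn Primrec.snd ?_ ?_
    · exact Primrec.list_cons.comp (Primrec.snd.pair (Primrec.const []))
        (hf.comp (Primrec.fst.comp Primrec.fst))
    · refine Primrec.sumCasesOn Primrec.snd ?_ ?_
      · have h3 : Primrec fun p : (((α × Instr) × (LCAAction ⊕ Val)) × LCAAction) => p.1.1.1 :=
          Primrec.fst.comp (Primrec.fst.comp Primrec.fst)
        exact primrec_push (hf.comp h3) (hres.comp h3)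
      · have h3 : Primrec fun p : (((α × Instr) × (LCAAction ⊕ Val)) × Val) => p.1.1.1 :=
          Primrec.fst.comp (Primrec.fst.comp Primrec.fst)
        exact primrec_push (Primrec.list_tail.comp (hf.comp h3)) Primrec.snd
  refine h2.of_eq fun a => ?_
  unfold step
  cases (f a).head? with
  | none => rfl
  | some x =>
    simp only [Option.map_some]
    rcases body a x with b | _ | v <;> rfl

lemma primrec_action {body : α → Frame → Instr} (hb : Primrec₂ body) {f : α → List Frame}
    (hf : Primrec f) : Primrec fun a => action (body a) (f a) := by
  have h1 : Primrec fun a => ((f a).head?.map (body a)) :=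
    Primrec.option_map (Primrec.list_head?.comp hf) hb
  have h2 : Primrec fun a => ((f a).head?.map (body a)).casesOn (motive := fun _ => LCAAction)
      (.answer false)
      (fun i => i.casesOn (motive := fun _ => LCAAction) (fun _ => .readBit 0)
        (fun j => j.casesOn (motive := fun _ => LCAAction)
          (fun b => b) (fun v => if (f a).tail = [] then .answer (decide (v ≠ some []))
            else .readBit 0))) := by
    refine Primrec.option_casesOn h1 (Primrec.const _) ?_
    refine Primrec.sumCasesOn Primrec.snd (Primrec.const _) ?_
    refine Primrec.sumCasesOn Primrec.snd Primrec.snd ?_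
    have h3 : Primrec fun p : (((α × Instr) × (LCAAction ⊕ Val)) × Val) => p.1.1.1 :=
      Primrec.fst.comp (Primrec.fst.comp Primrec.fst)
    have h4 : PrimrecPred fun p : (((α × Instr) × (LCAAction ⊕ Val)) × Val) =>
        (f p.1.1.1).tail = [] :=
      Primrec.eq.comp (Primrec.list_tail.comp (hf.comp h3)) (Primrec.const [])
    refine Primrec.ite h4 (primrec_answer ?_) (Primrec.const _)
    exact (PrimrecPred.not (Primrec.eq.comp Primrec.snd (Primrec.const (some [])))).decide
  refine h2.of_eq fun a => ?_
  unfold action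
  cases (f a).head? with
  | none => rfl
  | some x =>
    simp only [Option.map_some]
    rcases body a x with b | _ | v <;> rfl

/-- The stack is not stored but recomputed by a fold over the responses, so the next action is
primitive recursive as soon as the program is. -/
lemma primrec_action_state {body : α → Frame → Instr} (hb : Primrec₂ body) {root : α → Task}
    (hi : Primrec root) {h : α → List (Option ℕ)} (hh : Primrec h) :
    Primrec fun a => action (body a) (state (body a) (root a) (h a)) := by
  refine primrec_action hb ?_
  have hroot : Primrec fun a => ([(root a, [])] : List Frame) :=
    Primrec.list_cons.comp (hi.pair (Primrec.const [])) (Primrec.const [])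
  have hb' : Primrec₂ fun (p : α × List Frame × Option ℕ) (f : Frame) => body p.1 f :=
    hb.comp₂ (Primrec.fst.comp₂ Primrec₂.left) Primrec₂.right
  have hstep : Primrec₂ fun (a : α) (p : List Frame × Option ℕ) => step (body a) p.1 p.2 :=
    primrec_step hb' (Primrec.fst.comp Primrec.snd) (Primrec.snd.comp Primrec.snd)
  exact Primrec.list_foldl hh hroot hstep

end Primrec

end Machine

end LocalSetCover

open Finset

namespace LocalSetCover

/-! ### The local algorithm -/

/-- The position on the tape of the `r`-th bit of a coin. -/
def tapePos (k : Key) (r : ℕ) : ℕ :=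
  Nat.pair (Nat.pair (if k.1 then 1 else 0) (Nat.pair k.2.1 k.2.2)) r

lemma tapePos_injective (k : Key) (r : ℕ) (k' : Key) (r' : ℕ) (h : tapePos k r = tapePos k' r') :
    k = k' ∧ r = r' := by
  obtain ⟨b, i, τ⟩ := k
  obtain ⟨b', i', τ'⟩ := k'
  simp only [tapePos, Nat.pair_eq_pair] at h
  obtain ⟨⟨h1, h2, h3⟩, h4⟩ := h
  refine ⟨?_, h4⟩
  cases b <;> cases b' <;> simp_all

/-- The result of the last call. -/
def lastVal (acc : List Val) : List ℕ := (acc.reverse.headI).getD []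

/-- The last call has given up, or the last neighbor query has found no neighbor. -/
def lastFailed (acc : List Val) : Prop := acc.reverse.head? = some none

instance (acc : List Val) : Decidable (lastFailed acc) := inferInstanceAs (Decidable (_ = _))

/-- Concatenate all results. -/
def collect (acc : List Val) : List ℕ := acc.flatMap fun v => v.getD []

def Instr.call (op τ u : ℕ) (l : List ℕ) : Instr := .inl (op, τ, u, l)

def Instr.act (a : LCAAction) : Instr := .inr (.inl a)

def Instr.ret (v : Val) : Instr := .inr (.inr v)

section Program

variable (P : Schedule) (τ u : ℕ) (l : List ℕ) (acc : List Val)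

/-- List the elements of a set. -/
def progElems : Instr :=
  if lastFailed acc then .ret (some (collect acc)) else .act (.querySet l.headI acc.length)

/-- List the sets containing an element. -/
def progSets : Instr :=
  if lastFailed acc then .ret (some (collect acc)) else .act (.queryElem l.headI acc.length)

/-- Read a coin. -/
def progCoin (b : Bool) : Instr :=
  if acc.length < P.expo (b, l.headI, τ) then .act (.readBit (tapePos (b, l.headI, τ) acc.length))
  else .ret (some (if ∀ v ∈ acc, v = some [1] then [l.headI] else []))

/-- Filter the list `l` with the subroutine `u`. -/
def progFilter : Instr :=
  if acc.length < l.length then .call u τ 0 [l.getI acc.length] else .ret (some (collect acc))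

/-- Does the set have enough counted uncovered elements? -/
def progTest : Instr :=
  if acc.length = 0 then .call 0 0 0 l
  else if acc.length = 1 then .call 4 τ 3 (lastVal acc)
  -- Asking about the stage start first is the expensive-looking but safe order: this pass costs a
  -- factor `s` only on the cost at the stage start, and the pass for round `τ` then sees at most
  -- `maxSample` elements.
  else if acc.length = 2 then .call 4 (P.start τ) 6 (lastVal acc)
  else if acc.length = 3 then
    if P.maxSample < (lastVal acc).length then .ret none else .call 4 τ 6 (lastVal acc)
  else .ret (some (if P.thr τ ≤ (lastVal acc).length then l else []))

/-- Is the element uncovered? -/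
def progAlive : Instr :=
  if τ = 0 then .ret (some l)
  else if acc.length = 0 then .call 6 (τ - 1) 0 l
  else if acc.length = 1 then
    if lastVal acc = [] then .ret (some []) else .call 7 (τ - 1) 0 l
  else .ret (some (if lastVal acc = [] then l else []))

/-- Which sets containing the element join in round `τ`? -/
def progHit : Instr :=
  if acc.length = 0 then .call 1 0 0 l
  else if acc.length = 1 then .call 4 τ 2 (lastVal acc)
  else if acc.length = 2 then .call 8 τ 0 (lastVal acc)
  else .ret (some (lastVal acc))

/-- Which sets in the list stay in the race through round `τ`, from round `u` of its stage on? -/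
def progChain : Instr :=
  if P.round τ < u then .ret (some l)
  else if P.cap (P.round τ - u) < l.length then .ret none
  else if acc.length = 0 then .call 4 (P.start τ + u) 5 l
  else if acc.length = 1 then .call 8 τ (u + 1) (lastVal acc)
  else .ret (some (lastVal acc))

/-- Has the set joined the cover before round `τ`? -/
def progTop : Instr :=
  if τ = 0 then .ret (some [])
  else if acc.length = 0 then .call 9 (τ - 1) 0 l
  else if acc.length = 1 then
    if lastVal acc = [] then .call 4 (τ - 1) 2 l else .ret (some (lastVal acc))
  else if acc.length = 2 then .call 8 (τ - 1) 0 (lastVal acc)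
  else .ret (some (lastVal acc))

/-- The program of the local algorithm. -/
def prog (f : Frame) : Instr :=
  if f.1.1 = 0 then progElems f.1.2.2.2 f.2
  else if f.1.1 = 1 then progSets f.1.2.2.2 f.2
  -- Giving up propagates to every caller. The two listing subroutines are dispatched before this
  -- line, since for them `none` just marks the end of a neighbor list.
  else if lastFailed f.2 then .ret none
  else if f.1.1 = 2 then progCoin P f.1.2.1 f.1.2.2.2 f.2 true
  else if f.1.1 = 3 then progCoin P f.1.2.1 f.1.2.2.2 f.2 false
  else if f.1.1 = 4 then progFilter f.1.2.1 f.1.2.2.1 f.1.2.2.2 f.2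
  else if f.1.1 = 5 then progTest P f.1.2.1 f.1.2.2.2 f.2
  else if f.1.1 = 6 then progAlive f.1.2.1 f.1.2.2.2 f.2
  else if f.1.1 = 7 then progHit f.1.2.1 f.1.2.2.2 f.2
  else if f.1.1 = 8 then progChain P f.1.2.1 f.1.2.2.1 f.1.2.2.2 f.2
  else progTop f.1.2.1 f.1.2.2.2 f.2

end Program

/-! ### The program is primitive recursive -/

section Primrec

variable {α : Type*} [Primcodable α]

lemma primrec_two_pow {f : α → ℕ} (hf : Primrec f) : Primrec fun a => 2 ^ f a :=
  (Primrec₂.unpaired'.1 Nat.Primrec.pow).comp (Primrec.const 2) hf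

variable {L T ℓ τ u n : α → ℕ} {l : α → List ℕ} {acc : α → List Val}

lemma primrec_round (hT : Primrec T) (hτ : Primrec τ) :
    Primrec fun a => Schedule.round ⟨L a, T a, ℓ a⟩ (τ a) :=
  Primrec.nat_mod.comp hτ (Primrec.succ.comp hT)

lemma primrec_start (hT : Primrec T) (hτ : Primrec τ) :
    Primrec fun a => Schedule.start ⟨L a, T a, ℓ a⟩ (τ a) :=
  Primrec.nat_sub.comp hτ (Primrec.nat_mod.comp hτ (Primrec.succ.comp hT))

lemma primrec_level (hL : Primrec L) (hT : Primrec T) (hτ : Primrec τ) :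
    Primrec fun a => Schedule.level ⟨L a, T a, ℓ a⟩ (τ a) :=
  Primrec.nat_sub.comp hL (Primrec.nat_div.comp hτ (Primrec.succ.comp hT))

lemma primrec_expo (hL : Primrec L) (hT : Primrec T) (hℓ : Primrec ℓ)
    (hτ : Primrec τ) (b : Bool) :
    Primrec fun a => Schedule.expo ⟨L a, T a, ℓ a⟩ (b, n a, τ a) := by
  cases b
  · exact Primrec.nat_sub.comp (primrec_level (ℓ := ℓ) hL hT hτ) hℓ
  · exact Primrec.nat_sub.comp hT (primrec_round (L := L) (ℓ := ℓ) hT hτ)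

lemma primrec_thr (hL : Primrec L) (hT : Primrec T) (hℓ : Primrec ℓ) (hτ : Primrec τ) :
    Primrec fun a => Schedule.thr ⟨L a, T a, ℓ a⟩ (τ a) :=
  primrec_two_pow (Primrec.nat_min.comp (primrec_level (ℓ := ℓ) hL hT hτ) hℓ)

lemma primrec_cap (hℓ : Primrec ℓ) (hn : Primrec n) :
    Primrec fun a => Schedule.cap ⟨L a, T a, ℓ a⟩ (n a) :=
  primrec_two_pow (Primrec.nat_add.comp (Primrec.nat_add.comp hℓ (Primrec.const 1)) hn)

lemma primrec_maxSample (hℓ : Primrec ℓ) :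
    Primrec fun a => Schedule.maxSample ⟨L a, T a, ℓ a⟩ :=
  Primrec.nat_mul.comp (Primrec.const 17) (primrec_two_pow hℓ)

lemma primrec_tapePos (b : Bool) (hn : Primrec n) (hτ : Primrec τ) {r : α → ℕ} (hr : Primrec r) :
    Primrec fun a => tapePos (b, n a, τ a) (r a) :=
  Primrec₂.natPair.comp (Primrec₂.natPair.comp (Primrec.const (if b then 1 else 0))
    (Primrec₂.natPair.comp hn hτ)) hr

lemma primrec_call (op : ℕ) (hτ : Primrec τ) (hu : Primrec u) (hl : Primrec l) :
    Primrec fun a => Instr.call op (τ a) (u a) (l a) :=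
  Primrec.sumInl.comp ((Primrec.const op).pair (hτ.pair (hu.pair hl)))

lemma primrec_call' {op : α → ℕ} (hop : Primrec op) (hτ : Primrec τ) (hu : Primrec u)
    (hl : Primrec l) : Primrec fun a => Instr.call (op a) (τ a) (u a) (l a) :=
  Primrec.sumInl.comp (hop.pair (hτ.pair (hu.pair hl)))

lemma primrec_act {f : α → LCAAction} (hf : Primrec f) : Primrec fun a => Instr.act (f a) :=
  Primrec.sumInr.comp (Primrec.sumInl.comp hf)

lemma primrec_ret {f : α → Val} (hf : Primrec f) : Primrec fun a => Instr.ret (f a) :=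
  Primrec.sumInr.comp (Primrec.sumInr.comp hf)

lemma primrec_ret_some {f : α → List ℕ} (hf : Primrec f) :
    Primrec fun a => Instr.ret (some (f a)) := primrec_ret (Primrec.option_some.comp hf)

lemma primrec_option_getD_nil {f : α → Val} (hf : Primrec f) : Primrec fun a => (f a).getD [] :=
  Primrec.option_getD.comp hf (Primrec.const [])

lemma primrec_lastVal (h : Primrec acc) : Primrec fun a => lastVal (acc a) :=
  primrec_option_getD_nil (Primrec.list_headI.comp (Primrec.list_reverse.comp h))

lemma primrec_lastFailed (h : Primrec acc) : PrimrecPred fun a => lastFailed (acc a) :=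
  Primrec.eq.comp (Primrec.list_head?.comp (Primrec.list_reverse.comp h)) (Primrec.const _)

lemma primrec_collect (h : Primrec acc) : Primrec fun a => collect (acc a) :=
  Primrec.list_flatMap h (primrec_option_getD_nil Primrec.snd)

lemma primrecPred_eq_const {f : α → ℕ} (hf : Primrec f) (c : ℕ) : PrimrecPred fun a => f a = c :=
  Primrec.eq.comp hf (Primrec.const c)

lemma primrecPred_eq_nil {f : α → List ℕ} (hf : Primrec f) : PrimrecPred fun a => f a = [] :=
  Primrec.eq.comp hf (Primrec.const [])

lemma primrec_progElems (hl : Primrec l) (h : Primrec acc) :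
    Primrec fun a => progElems (l a) (acc a) :=
  Primrec.ite (primrec_lastFailed h) (primrec_ret_some (primrec_collect h))
    (primrec_act (Machine.primrec_querySet (Primrec.list_headI.comp hl) (Primrec.list_length.comp h)))

lemma primrec_progSets (hl : Primrec l) (h : Primrec acc) :
    Primrec fun a => progSets (l a) (acc a) :=
  Primrec.ite (primrec_lastFailed h) (primrec_ret_some (primrec_collect h))
    (primrec_act (Machine.primrec_queryElem (Primrec.list_headI.comp hl) (Primrec.list_length.comp h)))

lemma primrec_progCoin (hL : Primrec L) (hT : Primrec T) (hℓ : Primrec ℓ) (hτ : Primrec τ)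
    (hl : Primrec l) (h : Primrec acc) (b : Bool) :
    Primrec fun a => progCoin ⟨L a, T a, ℓ a⟩ (τ a) (l a) (acc a) b := by
  have hh := Primrec.list_headI.comp hl
  have hn := Primrec.list_length.comp h
  have hall : PrimrecPred fun a => ∀ v ∈ acc a, v = some [1] :=
    (PrimrecPred.forall_mem_list (p := fun v : Val => v = some [1])
      (Primrec.eq.comp Primrec.id (Primrec.const _))).comp h
  exact Primrec.ite (Primrec.nat_lt.comp hn (primrec_expo hL hT hℓ hτ b))
    (primrec_act (Machine.primrec_readBit (primrec_tapePos b hh hτ hn)))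
    (primrec_ret_some (Primrec.ite hall (Primrec.list_cons.comp hh (Primrec.const []))
      (Primrec.const [])))

lemma primrec_progFilter (hτ : Primrec τ) (hu : Primrec u) (hl : Primrec l) (h : Primrec acc) :
    Primrec fun a => progFilter (τ a) (u a) (l a) (acc a) :=
  Primrec.ite (Primrec.nat_lt.comp (Primrec.list_length.comp h) (Primrec.list_length.comp hl))
    (primrec_call' hu hτ (Primrec.const 0) (Primrec.list_cons.comp
      (Primrec.list_getI.comp hl (Primrec.list_length.comp h)) (Primrec.const [])))
    (primrec_ret_some (primrec_collect h))

lemma primrec_progTest (hL : Primrec L) (hT : Primrec T) (hℓ : Primrec ℓ) (hτ : Primrec τ)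
    (hl : Primrec l) (h : Primrec acc) :
    Primrec fun a => progTest ⟨L a, T a, ℓ a⟩ (τ a) (l a) (acc a) := by
  have hn := primrecPred_eq_const (Primrec.list_length.comp h)
  have hv := primrec_lastVal h
  have hvn := Primrec.list_length.comp hv
  exact Primrec.ite (hn 0) (primrec_call 0 (Primrec.const 0) (Primrec.const 0) hl) <|
    Primrec.ite (hn 1) (primrec_call 4 hτ (Primrec.const 3) hv) <|
    Primrec.ite (hn 2) (primrec_call 4 (primrec_start hT hτ) (Primrec.const 6) hv) <|
    Primrec.ite (hn 3) (Primrec.ite (Primrec.nat_lt.comp (primrec_maxSample hℓ) hvn)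
      (Primrec.const _) (primrec_call 4 hτ (Primrec.const 6) hv)) <|
    primrec_ret_some (Primrec.ite (Primrec.nat_le.comp (primrec_thr hL hT hℓ hτ) hvn) hl
      (Primrec.const []))

lemma primrec_progAlive (hτ : Primrec τ) (hl : Primrec l) (h : Primrec acc) :
    Primrec fun a => progAlive (τ a) (l a) (acc a) := by
  have hn := primrecPred_eq_const (Primrec.list_length.comp h)
  have hv := primrecPred_eq_nil (primrec_lastVal h)
  have hp := Primrec.nat_sub.comp hτ (Primrec.const 1)
  exact Primrec.ite (primrecPred_eq_const hτ 0) (primrec_ret_some hl) <|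
    Primrec.ite (hn 0) (primrec_call 6 hp (Primrec.const 0) hl) <|
    Primrec.ite (hn 1) (Primrec.ite hv (Primrec.const _)
      (primrec_call 7 hp (Primrec.const 0) hl)) <|
    primrec_ret_some (Primrec.ite hv hl (Primrec.const []))

lemma primrec_progHit (hτ : Primrec τ) (hl : Primrec l) (h : Primrec acc) :
    Primrec fun a => progHit (τ a) (l a) (acc a) := by
  have hn := primrecPred_eq_const (Primrec.list_length.comp h)
  have hv := primrec_lastVal h
  exact Primrec.ite (hn 0) (primrec_call 1 (Primrec.const 0) (Primrec.const 0) hl) <|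
    Primrec.ite (hn 1) (primrec_call 4 hτ (Primrec.const 2) hv) <|
    Primrec.ite (hn 2) (primrec_call 8 hτ (Primrec.const 0) hv) <| primrec_ret_some hv

lemma primrec_progChain (hT : Primrec T) (hℓ : Primrec ℓ) (hτ : Primrec τ)
    (hu : Primrec u) (hl : Primrec l) (h : Primrec acc) :
    Primrec fun a => progChain ⟨L a, T a, ℓ a⟩ (τ a) (u a) (l a) (acc a) := by
  have hn := primrecPred_eq_const (Primrec.list_length.comp h)
  have hv := primrec_lastVal h
  have hr := primrec_round (L := L) (ℓ := ℓ) hT hτ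
  exact Primrec.ite (Primrec.nat_lt.comp hr hu) (primrec_ret_some hl) <|
    Primrec.ite (Primrec.nat_lt.comp (primrec_cap hℓ (Primrec.nat_sub.comp hr hu))
      (Primrec.list_length.comp hl)) (Primrec.const _) <|
    Primrec.ite (hn 0) (primrec_call 4 (Primrec.nat_add.comp (primrec_start hT hτ) hu)
      (Primrec.const 5) hl) <|
    Primrec.ite (hn 1) (primrec_call 8 hτ (Primrec.succ.comp hu) hv) <| primrec_ret_some hv

lemma primrec_progTop (hτ : Primrec τ) (hl : Primrec l) (h : Primrec acc) :
    Primrec fun a => progTop (τ a) (l a) (acc a) := by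
  have hn := primrecPred_eq_const (Primrec.list_length.comp h)
  have hv := primrec_lastVal h
  have hp := Primrec.nat_sub.comp hτ (Primrec.const 1)
  exact Primrec.ite (primrecPred_eq_const hτ 0) (Primrec.const _) <|
    Primrec.ite (hn 0) (primrec_call 9 hp (Primrec.const 0) hl) <|
    Primrec.ite (hn 1) (Primrec.ite (primrecPred_eq_nil hv)
      (primrec_call 4 hp (Primrec.const 2) hl) (primrec_ret_some hv)) <|
    Primrec.ite (hn 2) (primrec_call 8 hp (Primrec.const 0) hv) <| primrec_ret_some hv

lemma primrec_prog (hL : Primrec L) (hT : Primrec T) (hℓ : Primrec ℓ) {f : α → Frame}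
    (hf : Primrec f) : Primrec fun a => prog ⟨L a, T a, ℓ a⟩ (f a) := by
  have hb := Primrec.fst.comp hf
  have hop := primrecPred_eq_const (Primrec.fst.comp hb)
  have hτ := Primrec.fst.comp (Primrec.snd.comp hb)
  have hu := Primrec.fst.comp (Primrec.snd.comp (Primrec.snd.comp hb))
  have hl := Primrec.snd.comp (Primrec.snd.comp (Primrec.snd.comp hb))
  have h := Primrec.snd.comp hf
  exact Primrec.ite (hop 0) (primrec_progElems hl h) <|
    Primrec.ite (hop 1) (primrec_progSets hl h) <|
    Primrec.ite (primrec_lastFailed h) (Primrec.const _) <|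
    Primrec.ite (hop 2) (primrec_progCoin hL hT hℓ hτ hl h true) <|
    Primrec.ite (hop 3) (primrec_progCoin hL hT hℓ hτ hl h false) <|
    Primrec.ite (hop 4) (primrec_progFilter hτ hu hl h) <|
    Primrec.ite (hop 5) (primrec_progTest hL hT hℓ hτ hl h) <|
    Primrec.ite (hop 6) (primrec_progAlive hτ hl h) <|
    Primrec.ite (hop 7) (primrec_progHit hτ hl h) <|
    Primrec.ite (hop 8) (primrec_progChain hT hℓ hτ hu hl h) (primrec_progTop hτ hl h)

end Primrec

/-- The binary logarithm, rounded down. -/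
def lg (n : ℕ) : ℕ := Nat.findGreatest (fun k => 2 ^ k ≤ n) n

lemma primrec_lg : Primrec lg :=
  Primrec.nat_findGreatest Primrec.id
    (Primrec.nat_le.comp (primrec_two_pow Primrec.snd) Primrec.fst)

lemma two_pow_lg_le {n : ℕ} (h : 1 ≤ n) : 2 ^ lg n ≤ n :=
  Nat.findGreatest_spec (P := fun k => 2 ^ k ≤ n) (m := 0) (Nat.zero_le _) (by simpa using h)

lemma lt_two_pow_lg (n : ℕ) : n < 2 ^ (lg n + 1) := by
  by_contra h
  push Not at h
  have h1 : lg n + 1 ≤ n := (Nat.lt_two_pow_self).le.trans h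
  have := Nat.le_findGreatest (P := fun k => 2 ^ k ≤ n) h1 h
  unfold lg at this
  omega

/-- The schedule for sets of size at most `s` and elements in at most `t` sets. -/
def schedule (s t : ℕ) : Schedule :=
  -- The third entry makes `2 ^ ℓ` at least the fourth power of `lg s + lg t + 18 = L + T + 16`,
  -- enough to beat the union bound, while `ℓ` remains doubly logarithmic.
  ⟨lg s + 1, lg t + 1, 4 * (lg (lg s + lg t + 18) + 1)⟩

/-- The local computation algorithm. -/
def algorithm : LocalAlgorithm where
  next s t S h := Machine.action (prog (schedule s t))
    (Machine.state (prog (schedule s t)) (9, (schedule s t).numRounds, 0, [S]) h)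
  computable := by
    have hs : Primrec fun p : ℕ × ℕ × ℕ × List (Option ℕ) => lg p.1 := primrec_lg.comp Primrec.fst
    have ht : Primrec fun p : ℕ × ℕ × ℕ × List (Option ℕ) => lg p.2.1 :=
      primrec_lg.comp (Primrec.fst.comp Primrec.snd)
    have hL : Primrec fun p : ℕ × ℕ × ℕ × List (Option ℕ) => lg p.1 + 1 := Primrec.succ.comp hs
    have hT : Primrec fun p : ℕ × ℕ × ℕ × List (Option ℕ) => lg p.2.1 + 1 := Primrec.succ.comp ht
    have hℓ : Primrec fun p : ℕ × ℕ × ℕ × List (Option ℕ) =>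
        4 * (lg (lg p.1 + lg p.2.1 + 18) + 1) :=
      Primrec.nat_mul.comp (Primrec.const 4) (Primrec.succ.comp (primrec_lg.comp
        (Primrec.nat_add.comp (Primrec.nat_add.comp hs ht) (Primrec.const 18))))
    have hbody : Primrec₂ fun (p : ℕ × ℕ × ℕ × List (Option ℕ)) (f : Frame) =>
        prog (schedule p.1 p.2.1) f :=
      primrec_prog (hL.comp Primrec.fst) (hT.comp Primrec.fst) (hℓ.comp Primrec.fst) Primrec.snd
    have hN : Primrec fun p : ℕ × ℕ × ℕ × List (Option ℕ) => (schedule p.1 p.2.1).numRounds :=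
      Primrec.nat_mul.comp (Primrec.succ.comp hL) (Primrec.succ.comp hT)
    have hroot : Primrec fun p : ℕ × ℕ × ℕ × List (Option ℕ) =>
        ((9, (schedule p.1 p.2.1).numRounds, 0, [p.2.2.1]) : Task) :=
      (Primrec.const 9).pair (hN.pair ((Primrec.const 0).pair (Primrec.list_cons.comp
        (Primrec.fst.comp (Primrec.snd.comp Primrec.snd)) (Primrec.const []))))
    exact (Machine.primrec_action_state hbody hroot
      (Primrec.snd.comp (Primrec.snd.comp Primrec.snd))).to_comp

end LocalSetCover

open Finset

namespace LocalSetCover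

/-! ### Correctness of the local algorithm -/

lemma not_lastFailed_nil : ¬lastFailed [] := by simp [lastFailed]

@[simp] lemma lastFailed_concat (acc : List Val) (v : Val) :
    lastFailed (acc ++ [v]) ↔ v = none := by
  simp [lastFailed]

lemma lastFailed.mem {acc : List Val} (h : lastFailed acc) : none ∈ acc := by
  have := List.mem_of_mem_head? h
  simpa using this

lemma collect_map_some {f : ℕ → List ℕ} (l : List ℕ) :
    collect (l.map fun a => some (f a)) = l.flatMap f := by
  induction l with
  | nil => rfl
  | cons a l ih => simpa [collect] using ih

open Classical in
/-- The value of a test that gives up if `F` holds and otherwise decides `p`. -/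
noncomputable def testVal (F p : Prop) (a : ℕ) : Val := if F then none else some (if p then [a] else [])

section Correctness

open Machine

variable {P : Schedule} {I : SetSystem} {R : I.Representation} {ω : ℕ → Bool} {x : Key → Bool}

/-- The extra query is the one that finds the end of the list. -/
lemma evLe_elems (S τ u : ℕ) :
    EvLe (prog P) R ω (0, τ, u, [S]) [] (some (R.setList S)) ((R.setList S).length + 1) := by
  suffices H : ∀ l₂ l₁, R.setList S = l₁ ++ l₂ → Ev (prog P) R ω (0, τ, u, [S])
      (l₁.map fun a => some [a]) (some (R.setList S)) (l₂.length + 1) from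
    ⟨_, le_rfl, H (R.setList S) [] rfl⟩
  intro l₂
  induction l₂ with
  | nil =>
    intro l₁ h
    have hnf : ¬lastFailed (l₁.map fun a => some [a]) := fun hf => by simpa using hf.mem
    refine .querySet (S := S) (i := l₁.length) (by simp [prog, progElems, hnf, Instr.act]) ?_
    refine .ret ?_
    have hnone : (R.setList S)[l₁.length]? = none := by simp [h]
    have hc := collect_map_some (f := fun a => [a]) l₁
    simp only [List.flatMap_singleton', List.append_nil] at hc h
    simp [prog, progElems, Instr.ret, h, collect]
    simpa [collect] using hc
  | cons a l₂ ih =>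
    intro l₁ h
    have hnf : ¬lastFailed (l₁.map fun a => some [a]) := fun hf => by simpa using hf.mem
    refine .querySet (S := S) (i := l₁.length) (by simp [prog, progElems, hnf, Instr.act]) ?_
    have hsome : (R.setList S)[l₁.length]? = some a := by simp [h]
    have := ih (l₁ ++ [a]) (by simp [h])
    simpa [hsome] using this

lemma evLe_sets (e τ u : ℕ) :
    EvLe (prog P) R ω (1, τ, u, [e]) [] (some (R.elemList e)) ((R.elemList e).length + 1) := by
  suffices H : ∀ l₂ l₁, R.elemList e = l₁ ++ l₂ → Ev (prog P) R ω (1, τ, u, [e])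
      (l₁.map fun a => some [a]) (some (R.elemList e)) (l₂.length + 1) from
    ⟨_, le_rfl, H (R.elemList e) [] rfl⟩
  intro l₂
  induction l₂ with
  | nil =>
    intro l₁ h
    have hnf : ¬lastFailed (l₁.map fun a => some [a]) := fun hf => by simpa using hf.mem
    refine .queryElem (e := e) (i := l₁.length) (by simp [prog, progSets, hnf, Instr.act]) ?_
    refine .ret ?_
    have hnone : (R.elemList e)[l₁.length]? = none := by simp [h]
    have hc := collect_map_some (f := fun a => [a]) l₁
    simp only [List.flatMap_singleton', List.append_nil] at hc h
    simp [prog, progSets, Instr.ret, h, collect]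
    simpa [collect] using hc
  | cons a l₂ ih =>
    intro l₁ h
    have hnf : ¬lastFailed (l₁.map fun a => some [a]) := fun hf => by simpa using hf.mem
    refine .queryElem (e := e) (i := l₁.length) (by simp [prog, progSets, hnf, Instr.act]) ?_
    have hsome : (R.elemList e)[l₁.length]? = some a := by simp [h]
    have := ih (l₁ ++ [a]) (by simp [h])
    simpa [hsome] using this

/-- Coins cost no neighbor queries, so the bound holds for every `q`. -/
lemma evLe_coin (b : Bool) (τ u i : ℕ) (q : ℕ) :
    EvLe (prog P) R ω (if b then 2 else 3, τ, u, [i]) []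
      (some (if coins P.expo tapePos ω (b, i, τ) then [i] else [])) q := by
  set k : Key := (b, i, τ) with hk
  suffices H : ∀ n m, m + n = P.expo k → Ev (prog P) R ω (if b then 2 else 3, τ, u, [i])
      ((List.range m).map fun r => some [(ω (tapePos k r)).toNat])
      (some (if coins P.expo tapePos ω k then [i] else [])) 0 from
    ⟨0, Nat.zero_le _, H (P.expo k) 0 (zero_add _)⟩
  intro n
  induction n with
  | zero =>
    intro m hm
    rw [add_zero] at hm
    subst hm
    have hnf : ¬lastFailed ((List.range (P.expo k)).map fun r => some [(ω (tapePos k r)).toNat]) :=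
      fun hf => by simpa using hf.mem
    refine .ret ?_
    have hb : ∀ c : Bool, (c.toNat = 1 ↔ c = true) := by decide
    have : (∀ v ∈ (List.range (P.expo k)).map fun r => some [(ω (tapePos k r)).toNat], v = some [1]) ↔
        coins P.expo tapePos ω k = true := by
      simp [coins, hb]
    cases b <;> simp [prog, progCoin, hnf, ← hk, Instr.ret] <;> simp [← this]
  | succ n ih =>
    intro m hm
    have hnf : ¬lastFailed ((List.range m).map fun r => some [(ω (tapePos k r)).toNat]) :=
      fun hf => by simpa using hf.mem
    have hlt : m < P.expo k := by omega
    refine .readBit (j := tapePos k m) ?_ ?_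
    · cases b <;> simp [prog, progCoin, hnf, ← hk, hlt, Instr.act]
    · have := ih (m + 1) (by omega)
      simpa [List.range_succ] using this

-- The run stops at the first element that fails, but the outcome depends only on whether one
-- exists. This keeps the answer independent of the order of the neighbor lists.
open Classical in
lemma evLe_filter {τ u : ℕ} {l : List ℕ} {F p : ℕ → Prop} {c : ℕ}
    (h : ∀ a ∈ l, EvLe (prog P) R ω (u, τ, 0, [a]) [] (testVal (F a) (p a) a) c) :
    EvLe (prog P) R ω (4, τ, u, l) []
      (if ∃ a ∈ l, F a then none else some (l.filter (p ·))) (l.length * c) := by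
  suffices H : ∀ l₂ l₁, l = l₁ ++ l₂ → (∀ a ∈ l₁, ¬F a) → EvLe (prog P) R ω (4, τ, u, l)
      (l₁.map fun a => some (if p a then [a] else []))
      (if ∃ a ∈ l, F a then none else some (l.filter (p ·))) (l₂.length * c) from
    H l [] rfl (by simp)
  intro l₂
  induction l₂ with
  | nil =>
    intro l₁ hl hF
    rw [List.append_nil] at hl
    subst hl
    have hnf : ¬lastFailed (l.map fun a => some (if p a then [a] else [])) :=
      fun hf => by simpa using hf.mem
    refine .ret ?_ _
    rw [if_neg (by push Not; exact hF)]
    have : l.filter (p ·) = l.flatMap fun a => if p a then [a] else [] := by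
      clear hF hnf h
      induction l with
      | nil => rfl
      | cons a l ih =>
        by_cases ha : p a <;> simp [ha, ih]
    simp [prog, progFilter, hnf, Instr.ret, collect_map_some, this]
  | cons a l₂ ih =>
    intro l₁ hl hF
    have hnf : ¬lastFailed (l₁.map fun a => some (if p a then [a] else [])) :=
      fun hf => by simpa using hf.mem
    have hget : l.getI l₁.length = a := by
      rw [hl, List.getI_append_right _ _ _ le_rfl]; simp [List.getI]
    have hstep : prog P ((4, τ, u, l), l₁.map fun a => some (if p a then [a] else [])) =
        .inl (u, τ, 0, [a]) := by
      have hlt : l₁.length < l.length := by simp [hl]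
      simp [prog, progFilter, hnf, Instr.call, hlt, hget]
    rw [List.length_cons, add_mul, one_mul, add_comm]
    refine .call hstep (h a (by simp [hl])) ?_
    by_cases hFa : F a
    · refine .ret ?_ _
      rw [if_pos ⟨a, by simp [hl], hFa⟩]
      simp [prog, testVal, hFa, Instr.ret]
    · have := ih (l₁ ++ [a]) (by simp [hl]) (by
        intro b hb
        rcases List.mem_append.1 hb with hb | hb
        · exact hF b hb
        · rw [List.mem_singleton.1 hb]; exact hFa)
      simpa [testVal, hFa] using this

/-- The coins in `x` are those on the tape `ω`. -/
def ReadsCoins (P : Schedule) (I : SetSystem) (ω : ℕ → Bool) (x : Key → Bool) : Prop :=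
  ∀ k ∈ keySet P I, coins P.expo tapePos ω k = P.coin x k

lemma evLe_filter_coin (hx : ReadsCoins P I ω x) {b : Bool} {τ : ℕ} (hτ : τ < P.numRounds)
    {l : List ℕ} (hl : ∀ a ∈ l, a ∈ I.sets ∨ a ∈ I.univ) :
    EvLe (prog P) R ω (4, τ, if b then 2 else 3, l) []
      (some (l.filter (fun a => P.coin x (b, a, τ)))) 0 := by
  classical
  have := evLe_filter (P := P) (R := R) (ω := ω) (τ := τ) (u := if b then 2 else 3) (l := l)
    (F := fun _ => False) (p := fun a => P.coin x (b, a, τ) = true) (c := 0) fun a ha => by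
      have h := evLe_coin (P := P) (R := R) (ω := ω) b τ 0 a 0
      rw [hx _ (mem_keySet (hl a ha) hτ)] at h
      simp only [testVal, if_false]
      convert h
  simpa using this

lemma length_eq_card {l : List ℕ} {A : Finset ℕ} (hl : l.Nodup) (h : ∀ a, a ∈ l ↔ a ∈ A) :
    l.length = #A := by
  rw [← List.toFinset_card_of_nodup hl]
  congr 1
  ext a
  rw [List.mem_toFinset, h]

variable {s t : ℕ} {cU cA : ℕ → ℕ}

/-- The number of queries needed to follow a list of sets through the rounds of a stage. -/
def chainCost (P : Schedule) (cA : ℕ → ℕ) (τ k : ℕ) : ℕ :=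
  ∑ i ∈ Ico k (P.round τ + 1), P.cap (P.round τ - i) * cA (P.start τ + i)

/-- The four summands of the cost are the listing of the set, its final empty reply, the pass for
the stage start over at most `s` elements, and the pass for round `τ` over at most `maxSample`
elements. The constructors of `Fail` for tests mirror the three ways of giving up. -/
lemma evLe_test (hI : I.Bounded s t) (hx : ReadsCoins P I ω x) {τ S : ℕ} (hτ : τ < P.numRounds)
    (hS : S ∈ I.sets)
    (hcA : s + 1 + s * cU (P.start τ) + P.maxSample * cU τ ≤ cA τ)
    (h₁ : ∀ e ∈ I.univ, EvLe (prog P) R ω (6, P.start τ, 0, [e]) []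
      (testVal (Fail P I x false (P.start τ) e) (e ∈ alive P I x (P.start τ)) e) (cU (P.start τ)))
    (h₂ : ∀ e ∈ I.univ, EvLe (prog P) R ω (6, τ, 0, [e]) []
      (testVal (Fail P I x false τ e) (e ∈ alive P I x τ) e) (cU τ)) :
    EvLe (prog P) R ω (5, τ, 0, [S]) []
      (testVal (Fail P I x true τ S) (Passes P I x τ S) S) (cA τ) := by
  classical
  set l₀ := R.setList S with hl₀
  have hm₀ : ∀ e, e ∈ l₀ ↔ e ∈ I.elts S := fun e => by
    rw [hl₀, R.mem_setList]; exact ⟨fun h => h.2, fun h => ⟨hS, h⟩⟩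
  have hu₀ : ∀ e ∈ l₀, e ∈ I.univ := fun e he => I.elts_subset S hS ((hm₀ e).1 he)
  have hlen₀ : l₀.length ≤ s := by
    rw [length_eq_card (R.setList_nodup S) hm₀]; exact hI.1 S hS
  set l₁ := l₀.filter (fun a => P.coin x (false, a, τ)) with hl₁
  have hlen₁ : l₁.length ≤ s := (List.length_filter_le _ _).trans hlen₀
  have hu₁ : ∀ e ∈ l₁, e ∈ I.univ := fun e he => hu₀ e (List.mem_filter.1 he).1
  set l₂ := l₁.filter (fun e => @decide (e ∈ alive P I x (P.start τ)) (Classical.propDecidable _)) with hl₂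
  have hm₂ : ∀ e, e ∈ l₂ ↔ e ∈ preSample P I x τ S := fun e => by
    simp only [hl₂, hl₁, List.mem_filter, hm₀, preSample, sample, mem_filter, decide_eq_true_eq]
    tauto
  have hlen₂ : l₂.length = #(preSample P I x τ S) :=
    length_eq_card (((R.setList_nodup S).filter _).filter _) hm₂
  set l₃ := l₂.filter (fun e => @decide (e ∈ alive P I x τ) (Classical.propDecidable _)) with hl₃
  have hlen₃ : l₃.length = #(sample P I x (alive P I x τ) τ S) := by
    refine length_eq_card ((((R.setList_nodup S).filter _).filter _).filter _) fun e => ?_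
    simp only [hl₃, hl₂, hl₁, List.mem_filter, hm₀, sample, mem_filter, decide_eq_true_eq]
    have := @alive_antitone P I x _ _ (P.start_le τ) e
    tauto
  refine EvLe.mono (q := (l₀.length + 1) + (0 + (l₁.length * cU (P.start τ) +
    P.maxSample * cU τ))) ?_ (by
      have := Nat.mul_le_mul_right (cU (P.start τ)) hlen₁
      omega)
  refine .call (b' := (0, 0, 0, [S])) (by simp [prog, progTest, not_lastFailed_nil, Instr.call])
    (evLe_elems S 0 0) ?_
  refine .call (b' := (4, τ, 3, l₀)) (by simp [prog, progTest, lastFailed, lastVal, Instr.call, hl₀])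
    (evLe_filter_coin (b := false) hx hτ fun e he => Or.inr (hu₀ e he)) ?_
  refine .call (b' := (4, P.start τ, 6, l₁))
    (by simp [prog, progTest, lastFailed, lastVal, Instr.call, hl₁])
    (evLe_filter fun e he => h₁ e (hu₁ e he)) ?_
  by_cases hf₁ : ∃ e ∈ l₁, Fail P I x false (P.start τ) e
  · have hF : Fail P I x true τ S := by
      obtain ⟨e, he, hf⟩ := hf₁
      obtain ⟨he, hc⟩ := List.mem_filter.1 he
      exact .start ((hm₀ e).1 he) hc hf
    refine .ret ?_ _
    rw [if_pos hf₁]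
    simp [prog, lastFailed, Instr.ret, testVal, hF]
  rw [if_neg hf₁]
  by_cases hf₂ : P.maxSample < l₂.length
  · have hF : Fail P I x true τ S := .sample (by rwa [← hlen₂])
    refine .ret ?_ _
    simp [prog, progTest, lastFailed, lastVal, Instr.ret, testVal, hF, ← hl₂, hf₂]
  refine EvLe.mono (q := l₂.length * cU τ + 0) ?_
    (Nat.mul_le_mul_right _ (not_lt.1 hf₂))
  refine .call (b' := (4, τ, 6, l₂))
    (by simp [prog, progTest, lastFailed, lastVal, Instr.call, ← hl₂, hf₂])
    (evLe_filter fun e he => h₂ e (hu₁ e (List.mem_filter.1 he).1)) ?_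
  by_cases hf₃ : ∃ e ∈ l₂, Fail P I x false τ e
  · have hF : Fail P I x true τ S := by
      obtain ⟨e, he, hf⟩ := hf₃
      exact .elem ((hm₂ e).1 he) hf
    refine .ret ?_ _
    rw [if_pos hf₃]
    simp [prog, lastFailed, Instr.ret, testVal, hF]
  rw [if_neg hf₃]
  have hF : ¬Fail P I x true τ S := by
    intro hF
    cases hF with
    | @start _ _ e he hc h =>
      exact hf₁ ⟨e, List.mem_filter.2 ⟨(hm₀ e).2 he, hc⟩, h⟩
    | sample h => exact hf₂ (by rwa [hlen₂])
    | @elem _ _ e he h => exact hf₃ ⟨e, (hm₂ e).2 he, h⟩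
  refine .ret ?_ _
  have hp : Passes P I x τ S ↔ P.thr τ ≤ l₃.length := by rw [hlen₃]; rfl
  simp [prog, progTest, lastFailed, lastVal, Instr.ret, testVal, hF, ← hl₃, hp]

/-- The sets that have survived the first `k` rounds of the stage of `τ`. -/
def racing (P : Schedule) (I : SetSystem) (x : Key → Bool) (τ k : ℕ) : Finset ℕ :=
  if k = 0 then I.sets else active P I x (P.start τ + (k - 1))

/-- The two notions part after the last round: at `k = T + 1` a new stage resets `cand`, while
`racing` keeps the survivors that are about to join. -/
lemma racing_eq_cand {τ k : ℕ} (hk : k ≤ P.T) :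
    racing P I x τ k = cand P I x (P.start τ + k) := by
  cases k with
  | zero => rw [racing, if_pos rfl, add_zero, cand_start]
  | succ k => rw [racing, if_neg (Nat.succ_ne_zero k), cand_start_succ P I x hk, Nat.add_sub_cancel]

lemma racing_succ (τ k : ℕ) : racing P I x τ (k + 1) = active P I x (P.start τ + k) := by
  rw [racing, if_neg (Nat.succ_ne_zero k), Nat.add_sub_cancel]

lemma racing_antitone {τ k k' : ℕ} (h : k ≤ k') (hk : k' ≤ P.T + 1) :
    racing P I x τ k' ⊆ racing P I x τ k := by
  induction k', h using Nat.le_induction with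
  | base => exact subset_rfl
  | succ k' _ ih =>
    refine subset_trans ?_ (ih (by omega))
    rw [racing_succ, racing_eq_cand (by omega)]
    exact active_subset_cand P I x _

/-- Following the list `l` from round `k` of the stage of `τ` on fails. -/
def ChainFails (P : Schedule) (I : SetSystem) (x : Key → Bool) (τ k : ℕ) (l : List ℕ) : Prop :=
  ∃ i, k ≤ i ∧ i ≤ P.round τ ∧
    (P.cap (P.round τ - i) < (l.filter (· ∈ racing P I x τ i)).length ∨
      ∃ S ∈ l, S ∈ racing P I x τ i ∧ Fail P I x true (P.start τ + i) S)

-- Induction on the number of rounds left. The cap is checked before any test in a round, so that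
-- round makes at most `cap` tests. Since the race only shrinks, replacing `l` by the sets that pass
-- does not change the later lists or failures.
open Classical in
lemma evLe_chain {τ : ℕ}
    (h : ∀ S ∈ I.sets, ∀ k ≤ P.round τ, EvLe (prog P) R ω (5, P.start τ + k, 0, [S]) []
      (testVal (Fail P I x true (P.start τ + k) S) (Passes P I x (P.start τ + k) S) S)
      (cA (P.start τ + k))) :
    ∀ n k l, k + n = P.round τ + 1 → (∀ S ∈ l, S ∈ racing P I x τ k) →
      EvLe (prog P) R ω (8, τ, k, l) []
        (if ChainFails P I x τ k l then none
          else some (l.filter (· ∈ racing P I x τ (P.round τ + 1)))) (chainCost P cA τ k) := by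
  intro n
  induction n with
  | zero =>
    intro k l hk hl
    rw [add_zero] at hk
    subst hk
    have hF : ¬ChainFails P I x τ (P.round τ + 1) l := by
      rintro ⟨i, h1, h2, _⟩; omega
    rw [if_neg hF, List.filter_eq_self.2 (by simpa using hl)]
    exact .ret (by simp [prog, progChain, not_lastFailed_nil, Instr.ret]) _
  | succ n ih =>
    intro k l hk hl
    have hkr : k ≤ P.round τ := by omega
    have hkT : k ≤ P.T := hkr.trans (P.round_le τ)
    have hnlt : ¬P.round τ < k := by omega
    have hself : l.filter (· ∈ racing P I x τ k) = l := List.filter_eq_self.2 (by simpa using hl)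
    have hsets : ∀ S ∈ l, S ∈ I.sets := fun S hS => by
      have := hl S hS
      rw [racing_eq_cand hkT] at this
      exact cand_subset P I x _ this
    by_cases hcap : P.cap (P.round τ - k) < l.length
    · have hF : ChainFails P I x τ k l := ⟨k, le_rfl, hkr, Or.inl (by rwa [hself])⟩
      rw [if_pos hF]
      exact .ret (by simp [prog, progChain, not_lastFailed_nil, Instr.ret, hnlt, hcap]) _
    have hcost : chainCost P cA τ k =
        P.cap (P.round τ - k) * cA (P.start τ + k) + chainCost P cA τ (k + 1) := by
      rw [chainCost, sum_eq_sum_Ico_succ_bot (by omega)]; rfl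
    refine EvLe.mono (q := l.length * cA (P.start τ + k) + chainCost P cA τ (k + 1)) ?_ (by
      rw [hcost]
      exact Nat.add_le_add_right (Nat.mul_le_mul_right _ (not_lt.1 hcap)) _)
    refine .call (b' := (4, P.start τ + k, 5, l))
      (by simp [prog, progChain, not_lastFailed_nil, Instr.call, hnlt, hcap])
      (evLe_filter fun S hS => h S (hsets S hS) k hkr) ?_
    by_cases hf : ∃ S ∈ l, Fail P I x true (P.start τ + k) S
    · have hF : ChainFails P I x τ k l := by
        obtain ⟨S, hS, hfS⟩ := hf
        exact ⟨k, le_rfl, hkr, Or.inr ⟨S, hS, hl S hS, hfS⟩⟩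
      rw [if_pos hF, if_pos hf]
      exact .ret (by simp [prog, lastFailed, Instr.ret]) _
    rw [if_neg hf]
    set l' := l.filter (fun S => @decide (Passes P I x (P.start τ + k) S)
      (Classical.propDecidable _)) with hl'
    have hmem : ∀ S, S ∈ l → (Passes P I x (P.start τ + k) S ↔ S ∈ racing P I x τ (k + 1)) := by
      intro S hS
      have h1 := hl S hS
      rw [racing_eq_cand hkT] at h1
      rw [racing_succ, active, mem_filter]
      exact ⟨fun h => ⟨h1, h⟩, fun h => h.2⟩
    have hl'r : ∀ S ∈ l', S ∈ racing P I x τ (k + 1) := by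
      intro S hS
      obtain ⟨h1, h2⟩ := List.mem_filter.1 hS
      exact (hmem S h1).1 (by simpa using h2)
    have hfil : ∀ i, k + 1 ≤ i → i ≤ P.T + 1 →
        l'.filter (· ∈ racing P I x τ i) = l.filter (· ∈ racing P I x τ i) := by
      intro i h1 h2
      rw [hl', List.filter_filter]
      refine List.filter_congr fun S hS => ?_
      have := fun h => (hmem S hS).2 (racing_antitone h1 h2 h)
      by_cases h3 : S ∈ racing P I x τ i
      · simp [h3, this h3]
      · simp [h3]
    have hFF : ChainFails P I x τ k l ↔ ChainFails P I x τ (k + 1) l' := by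
      constructor
      · rintro ⟨i, h1, h2, h3⟩
        have h4 := P.round_le τ
        rcases Nat.eq_or_lt_of_le h1 with rfl | h1
        · rcases h3 with h3 | ⟨S, hS, _, h3⟩
          · rw [hself] at h3; exact absurd h3 hcap
          · exact absurd ⟨S, hS, h3⟩ hf
        · refine ⟨i, h1, h2, ?_⟩
          rw [hfil i h1 (by omega)]
          refine h3.imp id ?_
          rintro ⟨S, hS, hr, hfS⟩
          refine ⟨S, List.mem_filter.2 ⟨hS, ?_⟩, hr, hfS⟩
          simpa using (hmem S hS).2 (racing_antitone h1 (by omega) hr)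
      · rintro ⟨i, h1, h2, h3⟩
        have h4 := P.round_le τ
        refine ⟨i, by omega, h2, ?_⟩
        rw [hfil i h1 (by omega)] at h3
        refine h3.imp id ?_
        rintro ⟨S, hS, hr, hfS⟩
        exact ⟨S, (List.mem_filter.1 hS).1, hr, hfS⟩
    have hrec := ih (k + 1) l' (by omega) hl'r
    rw [hfil _ (by omega) (Nat.succ_le_succ (P.round_le τ)), ← hFF] at hrec
    refine EvLe.call (q' := 0) (b' := (8, τ, k + 1, l'))
      (by simp [prog, progChain, lastFailed, lastVal, Instr.call, hnlt, hcap]) hrec ?_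
    by_cases hF : ChainFails P I x τ k l
    · simp only [if_pos hF]
      exact .ret (by simp [prog, lastFailed, Instr.ret]) _
    · simp only [if_neg hF]
      exact .ret (by simp [prog, progChain, lastFailed, lastVal, Instr.ret, hnlt, hcap]) _

-- The resulting list depends on the order of the neighbor list, hence the existential; only its
-- emptiness is used.
open Classical in
lemma evLe_hit (hI : I.Bounded s t) (hx : ReadsCoins P I ω x) {τ e : ℕ} (hτ : τ < P.numRounds)
    (he : e ∈ I.univ) (hal : e ∈ alive P I x τ)
    (h : ∀ S ∈ I.sets, ∀ k ≤ P.round τ, EvLe (prog P) R ω (5, P.start τ + k, 0, [S]) []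
      (testVal (Fail P I x true (P.start τ + k) S) (Passes P I x (P.start τ + k) S) S)
      (cA (P.start τ + k))) :
    ∃ l : List ℕ, (l = [] ↔ e ∈ alive P I x (τ + 1)) ∧ EvLe (prog P) R ω (7, τ, 0, [e]) []
      (if ∃ k ≤ P.round τ, P.cap (P.round τ - k) < #(hitList P I x τ e k) ∨
          ∃ S ∈ hitList P I x τ e k, Fail P I x true (P.start τ + k) S
        then none else some l) (t + 1 + chainCost P cA τ 0) := by
  set l₀ := R.elemList e with hl₀
  have hm₀ : ∀ S, S ∈ l₀ ↔ S ∈ I.setsOf e := fun S => by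
    rw [hl₀, R.mem_elemList, mem_setsOf]
  have hlen₀ : l₀.length ≤ t := by
    rw [length_eq_card (R.elemList_nodup e) hm₀]; exact hI.2 e he
  set l₁ := l₀.filter (fun a => P.coin x (true, a, τ)) with hl₁
  have hs₁ : ∀ S ∈ l₁, S ∈ I.sets := fun S hS =>
    (mem_setsOf.1 ((hm₀ S).1 (List.mem_filter.1 hS).1)).1
  have hfil : ∀ k ≤ P.round τ, ∀ S, S ∈ l₁.filter (· ∈ racing P I x τ k) ↔
      S ∈ hitList P I x τ e k := by
    intro k hk S
    rw [racing_eq_cand (hk.trans (P.round_le τ))]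
    simp only [hl₁, List.mem_filter, hm₀, hitList, mem_filter, decide_eq_true_eq]
    tauto
  have hF : ChainFails P I x τ 0 l₁ ↔ ∃ k ≤ P.round τ,
      P.cap (P.round τ - k) < #(hitList P I x τ e k) ∨
        ∃ S ∈ hitList P I x τ e k, Fail P I x true (P.start τ + k) S := by
    refine exists_congr fun k => ?_
    simp only [Nat.zero_le, true_and]
    refine and_congr_right fun hk => ?_
    rw [length_eq_card (((R.elemList_nodup e).filter _).filter _) (hfil k hk)]
    refine or_congr_right (exists_congr fun S => ?_)
    rw [← hfil k hk]
    simp only [List.mem_filter, decide_eq_true_eq, and_assoc]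
  refine ⟨l₁.filter (· ∈ racing P I x τ (P.round τ + 1)), ?_, ?_⟩
  · rw [List.filter_eq_nil_iff, mem_alive_succ, racing_succ, P.start_add_round]
    simp only [hl₁, List.mem_filter, hm₀, mem_setsOf, decide_eq_true_eq]
    constructor
    · intro H
      exact ⟨hal, fun S hS hc heS => H S ⟨⟨active_subset P I x τ hS, heS⟩, hc⟩ hS⟩
    · rintro ⟨_, H⟩ S ⟨⟨_, heS⟩, hc⟩ hS
      exact H S hS hc heS
  · have hchain := evLe_chain h (P.round τ + 1) 0 l₁ (zero_add _)
      fun S hS => by rw [racing, if_pos rfl]; exact hs₁ S hS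
    simp only [hF] at hchain
    refine EvLe.mono (q := (l₀.length + 1) + (0 + (chainCost P cA τ 0 + 0))) ?_ (by omega)
    refine .call (b' := (1, 0, 0, [e])) (by simp [prog, progHit, not_lastFailed_nil, Instr.call])
      (evLe_sets e 0 0) ?_
    refine .call (b' := (4, τ, 2, l₀))
      (by simp [prog, progHit, lastFailed, lastVal, Instr.call, hl₀])
      (evLe_filter_coin (b := true) hx hτ fun S hS => Or.inl (mem_setsOf.1 ((hm₀ S).1 hS)).1) ?_
    refine .call (b' := (8, τ, 0, l₁))
      (by simp [prog, progHit, lastFailed, lastVal, Instr.call, hl₁]) hchain ?_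
    split_ifs with hC
    · exact .ret (by simp [prog, lastFailed, Instr.ret]) _
    · exact .ret (by simp [prog, progHit, lastFailed, lastVal, Instr.ret]) _

lemma evLe_alive_succ (hI : I.Bounded s t) (hx : ReadsCoins P I ω x) {τ e : ℕ}
    (hτ : τ < P.numRounds) (he : e ∈ I.univ)
    (hcU : cU τ + (t + 1 + chainCost P cA τ 0) ≤ cU (τ + 1))
    (h₁ : EvLe (prog P) R ω (6, τ, 0, [e]) []
      (testVal (Fail P I x false τ e) (e ∈ alive P I x τ) e) (cU τ))
    (h₂ : ∀ S ∈ I.sets, ∀ k ≤ P.round τ, EvLe (prog P) R ω (5, P.start τ + k, 0, [S]) []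
      (testVal (Fail P I x true (P.start τ + k) S) (Passes P I x (P.start τ + k) S) S)
      (cA (P.start τ + k))) :
    EvLe (prog P) R ω (6, τ + 1, 0, [e]) []
      (testVal (Fail P I x false (τ + 1) e) (e ∈ alive P I x (τ + 1)) e) (cU (τ + 1)) := by
  classical
  refine EvLe.mono ?_ hcU
  refine .call (b' := (6, τ, 0, [e])) (by simp [prog, progAlive, not_lastFailed_nil, Instr.call])
    h₁ ?_
  by_cases hF₀ : Fail P I x false τ e
  · have hF : Fail P I x false (τ + 1) e := .prev hF₀
    exact .ret (by simp [prog, lastFailed, Instr.ret, testVal, hF, hF₀]) _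
  by_cases hal : e ∈ alive P I x τ
  swap
  · have hF : ¬Fail P I x false (τ + 1) e := by
      intro hF
      cases hF with
      | prev h => exact hF₀ h
      | cap h => exact hal h
      | hit h => exact hal h
    have hal' : e ∉ alive P I x (τ + 1) := fun h => hal (alive_antitone P I x (Nat.le_succ τ) h)
    exact .ret (by simp [prog, progAlive, lastFailed, lastVal, Instr.ret, testVal, hF, hF₀, hal,
      hal']) _
  obtain ⟨l, hl, hhit⟩ := evLe_hit hI hx hτ he hal h₂
  refine EvLe.call (q' := 0) (b' := (7, τ, 0, [e]))
    (by simp [prog, progAlive, lastFailed, lastVal, Instr.call, testVal, hF₀, hal]) hhit ?_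
  have hFF : Fail P I x false (τ + 1) e ↔ ∃ k ≤ P.round τ,
      P.cap (P.round τ - k) < #(hitList P I x τ e k) ∨
        ∃ S ∈ hitList P I x τ e k, Fail P I x true (P.start τ + k) S := by
    constructor
    · intro hF
      cases hF with
      | prev h => exact absurd h hF₀
      | cap _ hk h => exact ⟨_, hk, Or.inl h⟩
      | hit _ hk hS h => exact ⟨_, hk, Or.inr ⟨_, hS, h⟩⟩
    · rintro ⟨k, hk, h | ⟨S, hS, h⟩⟩
      · exact .cap hal hk h
      · exact .hit hal hk hS h
  by_cases hF : Fail P I x false (τ + 1) e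
  · rw [if_pos (hFF.1 hF)]
    exact .ret (by simp [prog, lastFailed, Instr.ret, testVal, hF]) _
  · rw [if_neg fun h => hF (hFF.2 h)]
    refine .ret ?_ _
    simp [prog, progAlive, lastFailed, lastVal, Instr.ret, testVal, hF, hF₀, hal, hl]

/-- `cU` and `cA` bound the numbers of queries for deciding whether an element is uncovered and
whether a set has enough counted uncovered elements. -/
structure CostBound (P : Schedule) (s t : ℕ) (cU cA : ℕ → ℕ) : Prop where
  test : ∀ τ < P.numRounds, s + 1 + s * cU (P.start τ) + P.maxSample * cU τ ≤ cA τ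
  alive : ∀ τ < P.numRounds, cU τ + (t + 1 + chainCost P cA τ 0) ≤ cU (τ + 1)

lemma evLe_alive (hI : I.Bounded s t) (hx : ReadsCoins P I ω x) (hc : CostBound P s t cU cA)
    {τ : ℕ} (hτ : τ ≤ P.numRounds) {e : ℕ} (he : e ∈ I.univ) :
    EvLe (prog P) R ω (6, τ, 0, [e]) []
      (testVal (Fail P I x false τ e) (e ∈ alive P I x τ) e) (cU τ) := by
  induction τ using Nat.strong_induction_on generalizing e with
  | _ τ ih =>
    cases τ with
    | zero =>
      refine .ret ?_ _
      simp [prog, progAlive, not_lastFailed_nil, Instr.ret, testVal, not_fail_false_zero,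
        alive_zero, he]
    | succ τ =>
      refine evLe_alive_succ hI hx (by omega) he (hc.alive τ (by omega))
        (ih τ (by omega) (by omega) he) fun S hS k hk => ?_
      have hkτ : P.start τ + k ≤ τ := by have := P.start_add_round τ; omega
      have hst := P.start_le (P.start τ + k)
      exact evLe_test hI hx (by omega) hS (hc.test _ (by omega))
        (fun e he => ih _ (by omega) (by omega) he) fun e he => ih _ (by omega) (by omega) he

/-- The rounds are searched in order until a nonempty list or a failure appears. Both mean yes, so
the answer is read off as `v ≠ some []`. Each round costs a chain, which fits into the growth of
`cU`. -/
lemma evLe_top (hI : I.Bounded s t) (hx : ReadsCoins P I ω x) (hc : CostBound P s t cU cA) {S : ℕ}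
    (hS : S ∈ I.sets) {τ : ℕ} (hτ : τ ≤ P.numRounds) :
    ∃ v : Val, EvLe (prog P) R ω (9, τ, 0, [S]) [] v (cU τ) ∧
      (v ≠ some [] ↔ ∃ τ' < τ, S ∈ joined P I x τ' ∨ (P.coin x (true, S, τ') = true ∧
        ∃ k ≤ P.round τ', S ∈ cand P I x (P.start τ' + k) ∧
          Fail P I x true (P.start τ' + k) S)) := by
  classical
  induction τ with
  | zero =>
    exact ⟨some [], .ret (by simp [prog, progTop, not_lastFailed_nil, Instr.ret]) _, by simp⟩
  | succ τ ih =>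
    obtain ⟨v, hv, hiff⟩ := ih (by omega)
    have hcost := hc.alive τ (by omega)
    have hfirst : prog P ((9, τ + 1, 0, [S]), []) = .inl (9, τ, 0, [S]) := by
      simp [prog, progTop, not_lastFailed_nil, Instr.call]
    by_cases hv0 : v = some []
    swap
    · refine ⟨v, EvLe.mono (.call hfirst hv (q' := 0) ?_) (by omega), ?_⟩
      · cases v with
        | none => exact .ret (by simp [prog, lastFailed, Instr.ret]) _
        | some w =>
          have : w ≠ [] := fun h => hv0 (by rw [h])
          exact .ret (by simp [prog, progTop, lastFailed, lastVal, Instr.ret, this]) _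
      · obtain ⟨τ', h1, h2⟩ := hiff.1 hv0
        exact ⟨fun _ => ⟨τ', by omega, h2⟩, fun _ => hv0⟩
    subst hv0
    have hno : ¬∃ τ' < τ, S ∈ joined P I x τ' ∨ (P.coin x (true, S, τ') = true ∧
        ∃ k ≤ P.round τ', S ∈ cand P I x (P.start τ' + k) ∧
          Fail P I x true (P.start τ' + k) S) := fun h => hiff.2 h rfl
    set l := [S].filter (fun a => P.coin x (true, a, τ)) with hl
    have hlS : ∀ S' ∈ l, S' = S := fun S' h => by simpa using (List.mem_filter.1 h).1
    have hchain := evLe_chain (P := P) (R := R) (ω := ω) (x := x) (cA := cA) (τ := τ)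
      (fun S hS k hk => by
        have hkτ : P.start τ + k ≤ τ := by have := P.start_add_round τ; omega
        have hst := P.start_le (P.start τ + k)
        exact evLe_test hI hx (by omega) hS (hc.test _ (by omega))
          (fun e he => evLe_alive hI hx hc (by omega) he)
          fun e he => evLe_alive hI hx hc (by omega) he)
      (P.round τ + 1) 0 l (zero_add _)
      fun S' hS' => by rw [racing, if_pos rfl, hlS S' hS']; exact hS
    refine ⟨_, EvLe.mono (.call hfirst hv (.call (b' := (4, τ, 2, [S])) ?_
      (evLe_filter_coin (b := true) hx (by omega) ?_) (.call (b' := (8, τ, 0, l)) ?_ hchain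
        (q' := 0) (w := if ChainFails P I x τ 0 l then none
          else some (l.filter (· ∈ racing P I x τ (P.round τ + 1)))) ?_))) (by omega), ?_⟩
    · simp [prog, progTop, lastFailed, lastVal, Instr.call]
    · intro a ha
      rw [List.mem_singleton.1 ha]; exact Or.inl hS
    · simp [prog, progTop, lastFailed, lastVal, Instr.call, hl]
    · by_cases hF : ChainFails P I x τ 0 l
      · simp only [if_pos hF]
        exact .ret (by simp [prog, lastFailed, Instr.ret]) _
      · simp only [if_neg hF]
        exact .ret (by simp [prog, progTop, lastFailed, lastVal, Instr.ret]) _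
    · have hmem : S ∈ l ↔ P.coin x (true, S, τ) = true := by simp [hl]
      have hF : ChainFails P I x τ 0 l ↔ P.coin x (true, S, τ) = true ∧
          ∃ k ≤ P.round τ, S ∈ cand P I x (P.start τ + k) ∧
            Fail P I x true (P.start τ + k) S := by
        constructor
        · rintro ⟨i, -, h2, h3 | ⟨S', hS', h4, h5⟩⟩
          -- A list with at most one member never exceeds a cap, so at the top level only failing
          -- tests matter.
          · have h4 : (l.filter (· ∈ racing P I x τ i)).length ≤ 1 :=
              (List.length_filter_le _ _).trans (List.length_filter_le _ [S])
            have h5 : 1 ≤ P.cap (P.round τ - i) := Nat.one_le_two_pow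
            omega
          · obtain rfl := hlS S' hS'
            rw [racing_eq_cand (h2.trans (P.round_le τ))] at h4
            exact ⟨hmem.1 hS', i, h2, h4, h5⟩
        · rintro ⟨h1, k, hk, h2, h3⟩
          refine ⟨k, Nat.zero_le _, hk, Or.inr ⟨S, hmem.2 h1, ?_, h3⟩⟩
          rwa [racing_eq_cand (hk.trans (P.round_le τ))]
      have hJ : l.filter (· ∈ racing P I x τ (P.round τ + 1)) = [] ↔ S ∉ joined P I x τ := by
        rw [List.filter_eq_nil_iff, racing_succ, P.start_add_round, joined, mem_filter]
        simp only [decide_eq_true_eq]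
        constructor
        · rintro h ⟨h1, h2⟩
          exact h S (hmem.2 h2) h1
        · intro h S' hS' h1
          obtain rfl := hlS S' hS'
          exact h ⟨h1, hmem.1 hS'⟩
      have hlast : (∃ τ' < τ + 1, S ∈ joined P I x τ' ∨ (P.coin x (true, S, τ') = true ∧
          ∃ k ≤ P.round τ', S ∈ cand P I x (P.start τ' + k) ∧
            Fail P I x true (P.start τ' + k) S)) ↔
          S ∈ joined P I x τ ∨ ChainFails P I x τ 0 l := by
        rw [hF]
        constructor
        · rintro ⟨τ', h1, h2⟩
          rcases Nat.lt_succ_iff_lt_or_eq.1 h1 with h1 | rfl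
          · exact absurd ⟨τ', h1, h2⟩ hno
          · exact h2
        · exact fun h => ⟨τ, Nat.lt_succ_self _, h⟩
      rw [hlast]
      by_cases hC : ChainFails P I x τ 0 l
      · simp [hC]
      · rw [if_neg hC, ne_eq, Option.some.injEq, hJ, not_not, or_iff_left hC]

end Correctness

end LocalSetCover

open Finset

namespace LocalSetCover

/-! ### The number of queries -/

section Cost

variable (P : Schedule) (s t : ℕ)

/-- A bound for the growth of the cost from one round to the next. -/
def Schedule.roundFactor : ℕ := 2 ^ (2 * P.ℓ + 7)

/-- A bound for the growth of the cost from one stage to the next. -/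
def Schedule.stageFactor : ℕ := (s + t + 2) * P.roundFactor ^ (P.T + 1)

/-- A bound for the cost of deciding whether an element is uncovered. -/
def aliveCost (τ : ℕ) : ℕ :=
  P.stageFactor s t ^ (τ / (P.T + 1)) *
    -- The factor `s + t + 2` is paid once per stage: it absorbs the listing costs and the factor
    -- `s` of the pass for the stage start.
    if P.round τ = 0 then 1 else (s + t + 2) * P.roundFactor ^ P.round τ

/-- A bound for the cost of deciding whether a set has enough counted uncovered elements. -/
def testCost (τ : ℕ) : ℕ :=
  s + 1 + s * aliveCost P s t (P.start τ) + P.maxSample * aliveCost P s t τ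

variable {P s t}

lemma aliveCost_le (τ : ℕ) : aliveCost P s t τ ≤
    P.stageFactor s t ^ (τ / (P.T + 1)) * ((s + t + 2) * P.roundFactor ^ P.round τ) := by
  unfold aliveCost
  gcongr
  split_ifs
  · exact Nat.mul_pos (by omega) (pow_pos (Nat.two_pow_pos _) _)
  · exact le_rfl

/-- After the last round of a stage the accumulated factor is exactly one more `stageFactor`, so
both cases of the definition agree with one formula. -/
lemma aliveCost_succ (τ : ℕ) : aliveCost P s t (τ + 1) =
    P.stageFactor s t ^ (τ / (P.T + 1)) * ((s + t + 2) * P.roundFactor ^ (P.round τ + 1)) := by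
  unfold aliveCost Schedule.round
  by_cases h : τ % (P.T + 1) = P.T
  · have hdvd : P.T + 1 ∣ τ + 1 :=
      (Nat.dvd_iff_mod_eq_zero ..).2 (by rw [Nat.add_mod, h]; simp)
    rw [if_pos (Nat.dvd_iff_mod_eq_zero .. |>.1 hdvd), Nat.succ_div, if_pos hdvd, h, mul_one,
      pow_succ]
    rfl
  · have hlt : τ % (P.T + 1) + 1 < P.T + 1 := by
      have := Nat.mod_lt τ (show 0 < P.T + 1 by omega)
      omega
    have hmod : (τ + 1) % (P.T + 1) = τ % (P.T + 1) + 1 := by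
      rw [Nat.add_mod, Nat.mod_eq_of_lt (a := 1) (by omega), Nat.mod_eq_of_lt hlt]
    have hdvd : ¬P.T + 1 ∣ τ + 1 := by rw [Nat.dvd_iff_mod_eq_zero, hmod]; omega
    rw [hmod, if_neg (Nat.succ_ne_zero _), Nat.succ_div, if_neg hdvd, add_zero]

lemma testCost_le {τ i : ℕ} (hi : i ≤ P.T) : testCost P s t (P.start τ + i) ≤
    (P.maxSample + 2) * (P.stageFactor s t ^ (τ / (P.T + 1)) * (s + t + 2)) *
      P.roundFactor ^ i := by
  have hdiv := P.div_start_add (τ := τ) hi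
  have hstart : P.start (P.start τ + i) = P.start τ := P.start_start_add hi
  have hround : P.round (P.start τ + i) = i := by
    have := P.start_add_round (P.start τ + i)
    omega
  have h0 : aliveCost P s t (P.start τ) = P.stageFactor s t ^ (τ / (P.T + 1)) := by
    have hd := P.div_start_add (τ := τ) (Nat.zero_le P.T)
    have hr : P.round (P.start τ) = 0 := by
      have h1 := P.start_add_round (P.start τ)
      have h2 := P.start_start_add (τ := τ) (Nat.zero_le P.T)
      rw [add_zero] at h2
      omega
    rw [add_zero] at hd
    rw [aliveCost, hd, if_pos hr, mul_one]
  have h1 := aliveCost_le (P := P) (s := s) (t := t) (P.start τ + i)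
  rw [hdiv, hround] at h1
  have hW : 1 ≤ P.stageFactor s t ^ (τ / (P.T + 1)) :=
    Nat.one_le_pow _ _ (Nat.mul_pos (by omega) (pow_pos (Nat.two_pow_pos _) _))
  have hK : 1 ≤ P.roundFactor ^ i := pow_pos (Nat.two_pow_pos _) _
  rw [testCost, hstart, h0]
  set W := P.stageFactor s t ^ (τ / (P.T + 1))
  set K := P.roundFactor ^ i
  have h2 : s + 1 + s * W ≤ 2 * (W * (s + t + 2)) := by nlinarith
  have h3 : 2 * (W * (s + t + 2)) ≤ 2 * (W * (s + t + 2)) * K := Nat.le_mul_of_pos_right _ hK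
  have h4 := Nat.mul_le_mul_left P.maxSample h1
  calc _ ≤ 2 * (W * (s + t + 2)) * K + P.maxSample * (W * ((s + t + 2) * K)) := by omega
    _ = _ := by ring

/-- A geometric sum dominated by its last term. Caps double with the distance to an earlier round
while tests there are cheaper by a factor `K` per round, so looking back through a stage costs only
a constant factor. -/
lemma sum_two_pow_mul_pow_le {K : ℕ} (hK : 4 ≤ K) (j : ℕ) :
    ∑ i ∈ range (j + 1), 2 ^ (j - i) * K ^ i ≤ 2 * K ^ j := by
  induction j with
  | zero => simp
  | succ j ih =>
    rw [sum_range_succ]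
    have : ∑ i ∈ range (j + 1), 2 ^ (j + 1 - i) * K ^ i =
        2 * ∑ i ∈ range (j + 1), 2 ^ (j - i) * K ^ i := by
      rw [mul_sum]
      refine sum_congr rfl fun i hi => ?_
      rw [Nat.succ_sub (Nat.lt_succ_iff.1 (mem_range.1 hi)), pow_succ]; ring
    rw [this, Nat.sub_self, pow_zero, one_mul, pow_succ]
    nlinarith [Nat.mul_le_mul_left (K ^ j) hK]

lemma costBound : CostBound P s t (aliveCost P s t) (testCost P s t) where
  test _ _ := le_rfl
  alive τ _ := by
    rw [aliveCost_succ]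
    have h1 := aliveCost_le (P := P) (s := s) (t := t) τ
    set W := P.stageFactor s t ^ (τ / (P.T + 1)) with hWdef
    set K := P.roundFactor with hKdef
    set j := P.round τ
    have hW : 1 ≤ W := Nat.one_le_pow _ _ (Nat.mul_pos (by omega) (pow_pos (Nat.two_pow_pos _) _))
    have hKj : 1 ≤ K ^ j := pow_pos (Nat.two_pow_pos _) _
    have hpl : 1 ≤ 2 ^ P.ℓ := Nat.one_le_two_pow
    have hK : K = 128 * (2 ^ P.ℓ * 2 ^ P.ℓ) := by
      rw [hKdef, Schedule.roundFactor, pow_add, two_mul, pow_add]; ring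
    have hchain : chainCost P (testCost P s t) τ 0 ≤
        2 ^ (P.ℓ + 1) * ((P.maxSample + 2) * (W * (s + t + 2))) * (2 * K ^ j) := by
      have h4 : 4 ≤ K := by nlinarith
      refine le_trans ?_ (Nat.mul_le_mul_left _ (sum_two_pow_mul_pow_le h4 j))
      rw [chainCost, mul_sum, ← Finset.range_eq_Ico]
      refine sum_le_sum fun i hi => ?_
      have hi' : i ≤ P.T := (Nat.lt_succ_iff.1 (mem_range.1 hi)).trans (P.round_le τ)
      calc P.cap (j - i) * testCost P s t (P.start τ + i)
          ≤ P.cap (j - i) * ((P.maxSample + 2) * (W * (s + t + 2)) * K ^ i) :=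
            Nat.mul_le_mul_left _ (testCost_le hi')
        _ = _ := by rw [Schedule.cap, pow_add 2 (P.ℓ + 1)]; ring
    have h5 : t + 1 ≤ W * ((s + t + 2) * K ^ j) := by
      calc t + 1 ≤ 1 * ((s + t + 2) * 1) := by omega
        _ ≤ _ := by gcongr
    -- With `p = 2 ^ ℓ` the left side is `68 p ^ 2 + 8 p + 2` and `K = 128 p ^ 2`; this is the
    -- origin of the `7` in `roundFactor`.
    have h6 : 2 + 2 ^ (P.ℓ + 1) * (P.maxSample + 2) * 2 ≤ K := by
      rw [hK, Schedule.maxSample, pow_succ]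
      nlinarith [Nat.mul_le_mul hpl hpl, Nat.mul_le_mul_left (2 ^ P.ℓ) hpl]
    calc _ ≤ W * ((s + t + 2) * K ^ j) + (W * ((s + t + 2) * K ^ j) +
          2 ^ (P.ℓ + 1) * ((P.maxSample + 2) * (W * (s + t + 2))) * (2 * K ^ j)) := by omega
      _ = W * ((s + t + 2) * K ^ j) * (2 + 2 ^ (P.ℓ + 1) * (P.maxSample + 2) * 2) := by ring
      _ ≤ W * ((s + t + 2) * K ^ j) * K := Nat.mul_le_mul_left _ h6
      _ = _ := by ring

lemma aliveCost_numRounds :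
    aliveCost P s t P.numRounds = P.stageFactor s t ^ (P.L + 1) := by
  unfold aliveCost Schedule.round Schedule.numRounds
  rw [Nat.mul_mod_left, if_pos rfl, mul_one, Nat.mul_div_cancel _ (Nat.succ_pos _)]

end Cost

end LocalSetCover

open Finset

namespace LocalSetCover

/-! ### Choice of the parameters -/

lemma lg_le_logb {n : ℕ} (h : 1 ≤ n) : (lg n : ℝ) ≤ Real.logb 2 n := by
  rw [Real.le_logb_iff_rpow_le (by norm_num) (by exact_mod_cast h), Real.rpow_natCast]
  exact_mod_cast two_pow_lg_le h

lemma le_two_pow_schedule_L (s t : ℕ) : s ≤ 2 ^ (schedule s t).L := (lt_two_pow_lg s).le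

lemma le_two_pow_schedule_T (s t : ℕ) : t ≤ 2 ^ (schedule s t).T := (lt_two_pow_lg t).le

lemma pow_four_le_two_pow_schedule_ℓ (s t : ℕ) :
    ((schedule s t).L + (schedule s t).T + 16) ^ 4 ≤ 2 ^ (schedule s t).ℓ := by
  have h := (lt_two_pow_lg (lg s + lg t + 18)).le
  have h2 : (schedule s t).L + (schedule s t).T + 16 = lg s + lg t + 18 := by
    simp only [schedule]; ring
  rw [h2]
  calc _ ≤ (2 ^ (lg (lg s + lg t + 18) + 1)) ^ 4 := Nat.pow_le_pow_left h 4
    _ = _ := by rw [← pow_mul, mul_comm]; rfl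

/-- The left side is at most `2` to a cubic in `m = L + T + 16`, because `numRounds ≤ m ^ 2` and
each round contributes a factor `2 ^ O(m)`. The fourth power in `hℓ` leaves room. -/
lemma Schedule.failBound_numerator_le {P : Schedule} {s t : ℕ} (hsL : s ≤ 2 ^ P.L)
    (htT : t ≤ 2 ^ P.T) (hℓ : (P.L + P.T + 16) ^ 4 ≤ 2 ^ P.ℓ) :
    s * (t * (P.numRounds * ((P.T + 1) * (3 * s * ((8 * s * t * (P.T + 1)) ^ P.numRounds *
      (P.T + 2)))))) ≤ 2 ^ 2 ^ P.ℓ := by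
  have hT : P.T + 1 ≤ 2 ^ P.T := Nat.lt_two_pow_self
  have hT2 : P.T + 2 ≤ 2 ^ (P.T + 1) := Nat.lt_two_pow_self
  have hL : P.L + 1 ≤ 2 ^ P.L := Nat.lt_two_pow_self
  calc _ ≤ 2 ^ P.L * (2 ^ P.T * (2 ^ P.L * 2 ^ P.T * (2 ^ P.T * (2 ^ 2 * 2 ^ P.L *
        ((2 ^ 3 * 2 ^ P.L * 2 ^ P.T * 2 ^ P.T) ^ P.numRounds * 2 ^ (P.T + 1)))))) := by
        gcongr
        · exact Nat.mul_le_mul hL hT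
        · norm_num
        · norm_num
    _ = 2 ^ (3 * P.L + 4 * P.T + 3 + (3 + P.L + 2 * P.T) * P.numRounds) := by
        rw [pow_add _ (3 * P.L + 4 * P.T + 3), pow_mul 2 (3 + P.L + 2 * P.T)]
        ring
    _ ≤ 2 ^ 2 ^ P.ℓ := by
        refine Nat.pow_le_pow_right (by norm_num) (le_trans ?_ hℓ)
        set m := P.L + P.T + 16 with hm
        have hN : P.numRounds ≤ m * m := Nat.mul_le_mul (by omega) (by omega)
        calc _ ≤ 4 * m + 2 * m * (m * m) := by
              gcongr <;> omega
          _ ≤ m ^ 4 := by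
              have hm16 : 16 ≤ m := by omega
              have h1 : 16 * m ^ 3 ≤ m ^ 4 := by
                rw [pow_succ m 3, mul_comm]; exact Nat.mul_le_mul_left _ hm16
              nlinarith [Nat.mul_le_mul hm16 hm16]

lemma Schedule.failBound_le {P : Schedule} {s t : ℕ} (hsL : s ≤ 2 ^ P.L)
    (htT : t ≤ 2 ^ P.T) (hℓ : (P.L + P.T + 16) ^ 4 ≤ 2 ^ P.ℓ) :
    (s : ℝ) * (t * P.failBound s t) ≤ 1 := by
  have h := Schedule.failBound_numerator_le hsL htT hℓ
  have h' : (s : ℝ) * (t * (P.numRounds * ((P.T + 1) * (3 * s * ((8 * s * t * (P.T + 1)) ^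
      P.numRounds * (P.T + 2)))))) ≤ 2 ^ 2 ^ P.ℓ := by exact_mod_cast h
  calc _ = (s : ℝ) * (t * (P.numRounds * ((P.T + 1) * (3 * s * ((8 * s * t * (P.T + 1)) ^
      P.numRounds * (P.T + 2)))))) * (1 / 2) ^ 2 ^ P.ℓ := by
        unfold failBound growth slack; ring
    _ ≤ 2 ^ 2 ^ P.ℓ * (1 / 2) ^ 2 ^ P.ℓ := by gcongr
    _ = 1 := by rw [← mul_pow]; norm_num

/-- `slack` is a factor of `failBound` and the other factors are at least one, so one smallness
condition suffices. -/
lemma Schedule.mul_slack_le {P : Schedule} {s t : ℕ} (hs : 1 ≤ s) (ht : 1 ≤ t) :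
    (s : ℝ) * P.slack ≤ s * (t * P.failBound s t) := by
  have hG := one_le_pow₀ (P.one_le_growth hs ht) (n := P.numRounds)
  have hδ := P.slack_nonneg
  have hs' : (1 : ℝ) ≤ s := by exact_mod_cast hs
  have ht' : (1 : ℝ) ≤ t := by exact_mod_cast ht
  have hN : (1 : ℝ) ≤ P.numRounds := by
    exact_mod_cast Nat.mul_pos (Nat.succ_pos P.L) (Nat.succ_pos P.T)
  have hT : (1 : ℝ) ≤ P.T + 1 := by norm_cast; omega
  have h1 : (1 : ℝ) ≤ 3 * s := by linarith
  gcongr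
  unfold failBound
  have h2 : P.slack ≤ P.growth s t ^ P.numRounds * P.slack := le_mul_of_one_le_left hδ hG
  have h3 := h2.trans (le_mul_of_one_le_left (hδ.trans h2) h1)
  have h4 := h3.trans (le_mul_of_one_le_left (hδ.trans h3) hT)
  have h5 := h4.trans (le_mul_of_one_le_left (hδ.trans h4) hN)
  exact h5.trans (le_mul_of_one_le_left (hδ.trans h5) ht')

/-! ### Comparison with the query bound -/

section Logs

variable {s t : ℕ}

lemma one_le_logb {n : ℕ} (h : 2 ≤ n) : 1 ≤ Real.logb 2 n := by
  rw [Real.le_logb_iff_rpow_le (by norm_num) (by positivity), Real.rpow_one]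
  exact_mod_cast h

lemma schedule_L_le (hs : 1 ≤ s) : ((schedule s t).L : ℝ) ≤ Real.logb 2 s + 1 := by
  have := lg_le_logb hs
  simp only [schedule]
  push_cast
  linarith

lemma schedule_T_le (ht : 1 ≤ t) : ((schedule s t).T : ℝ) ≤ Real.logb 2 t + 1 := by
  have := lg_le_logb ht
  simp only [schedule]
  push_cast
  linarith

lemma schedule_ℓ_le (hs : 2 ≤ s) (ht : 2 ≤ t) : ((schedule s t).ℓ : ℝ) ≤
    4 * (Real.logb 2 (Real.logb 2 s) + Real.logb 2 (Real.logb 2 t) + 6) := by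
  have ha := one_le_logb hs
  have hb := one_le_logb ht
  have h1 := lg_le_logb (n := s) (by omega)
  have h2 := lg_le_logb (n := t) (by omega)
  have h3 := lg_le_logb (n := lg s + lg t + 18) (by omega)
  set a := Real.logb 2 s
  set b := Real.logb 2 t
  have h4 : Real.logb 2 ((lg s + lg t + 18 : ℕ) : ℝ) ≤ Real.logb 2 (2 ^ (5 : ℕ) * (a * b)) := by
    -- For `a, b ≥ 1`, `a + b + 18 ≤ 32 * a * b`.
    refine Real.logb_le_logb_of_le (by norm_num) (by positivity) ?_
    push_cast
    nlinarith
  rw [Real.logb_mul (by norm_num) (by positivity), Real.logb_pow,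
    Real.logb_self_eq_one (by norm_num), Real.logb_mul (by positivity) (by positivity)] at h4
  simp only [schedule]
  push_cast at h3 h4 ⊢
  linarith

/-- The cost exponent contains a bare `log s * log t`, while the double logarithms in the bound may
vanish. If `b ≤ 2 a` the square `a * a` absorbs the product; otherwise `b ≥ 2` and `log b ≥ 1`. -/
lemma mul_le_of_logb {a b : ℝ} (ha : 1 ≤ a) (hb : 1 ≤ b) :
    a * b ≤ 2 * (a * a) + a * b * (Real.logb 2 a + Real.logb 2 b) := by
  have hla : 0 ≤ Real.logb 2 a := Real.logb_nonneg (by norm_num) ha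
  have hlb : 0 ≤ Real.logb 2 b := Real.logb_nonneg (by norm_num) hb
  have hab : 0 ≤ a * b := by positivity
  rcases le_total b (2 * a) with h | h
  · have h1 := mul_nonneg hab (add_nonneg hla hlb)
    have h2 := mul_le_mul_of_nonneg_left h (zero_le_one.trans ha)
    linarith
  · have h2 : 1 ≤ Real.logb 2 b := by
      rw [Real.le_logb_iff_rpow_le (by norm_num) (by linarith), Real.rpow_one]
      linarith
    have h4 := le_mul_of_one_le_right hab (h2.trans (le_add_of_nonneg_left hla))
    have h5 : 0 ≤ a * a := by positivity
    linarith

lemma queryBound_eq (C : ℝ) (hs : 1 ≤ s) (ht : 1 ≤ t) :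
    queryBound C s t = (2 : ℝ) ^ (C * (Real.logb 2 s * Real.logb 2 s +
      Real.logb 2 s * Real.logb 2 t *
        (Real.logb 2 (Real.logb 2 s) + Real.logb 2 (Real.logb 2 t)))) := by
  have hsr : (2 : ℝ) ^ Real.logb 2 s = s :=
    Real.rpow_logb (by norm_num) (by norm_num) (by positivity)
  have htr : (2 : ℝ) ^ Real.logb 2 t = t :=
    Real.rpow_logb (by norm_num) (by norm_num) (by positivity)
  unfold queryBound
  conv_lhs => enter [1, 1]; rw [← hsr]
  conv_lhs => enter [2, 1]; rw [← htr]
  rw [← Real.rpow_mul (by norm_num), ← Real.rpow_mul (by norm_num),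
    ← Real.rpow_add (by norm_num)]
  congr 1
  ring

lemma schedule_exponent_le (hs : 2 ≤ s) (ht : 2 ≤ t) {L T ℓ : ℝ} (hT0 : 0 ≤ T) (hL0 : 0 ≤ L)
    (hL : L ≤ Real.logb 2 s + 1) (hT : T ≤ Real.logb 2 t + 1)
    (hℓ : ℓ ≤ 4 * (Real.logb 2 (Real.logb 2 s) + Real.logb 2 (Real.logb 2 t) + 6)) :
    (L + T + 1 + (2 * ℓ + 7) * (T + 1)) * (L + 1) ≤
      1200 * (Real.logb 2 s * Real.logb 2 s + Real.logb 2 s * Real.logb 2 t *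
        (Real.logb 2 (Real.logb 2 s) + Real.logb 2 (Real.logb 2 t))) := by
  have ha := one_le_logb hs
  have hb := one_le_logb ht
  have hr0 := add_nonneg (Real.logb_nonneg one_lt_two ha) (Real.logb_nonneg one_lt_two hb)
  have hab := mul_le_of_logb ha hb
  generalize Real.logb 2 s = a at *
  generalize Real.logb 2 t = b at *
  generalize Real.logb 2 a + Real.logb 2 b = r at *
  have hL1 : L + 1 ≤ 3 * a := by linarith
  have hT1 : T + 1 ≤ 3 * b := by linarith
  have hl1 : 2 * ℓ + 7 ≤ 8 * r + 55 := by linarith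
  have h1 : (2 * ℓ + 7) * (T + 1) ≤ (8 * r + 55) * (3 * b) :=
    mul_le_mul hl1 hT1 (by linarith) (by linarith)
  calc _ ≤ (3 * a + 3 * b + (8 * r + 55) * (3 * b)) * (3 * a) := by
        refine mul_le_mul (by linarith) hL1 (by linarith) ?_
        positivity
    _ = 9 * (a * a) + 72 * (a * b * r) + 504 * (a * b) := by ring
    _ ≤ _ := by
        have : 0 ≤ a * b * r := by positivity
        have : 0 ≤ a * a := by positivity
        linarith

lemma stageFactor_pow_le (hs : 2 ≤ s) (ht : 2 ≤ t) :
    (((schedule s t).stageFactor s t ^ ((schedule s t).L + 1) : ℕ) : ℝ) ≤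
      queryBound 1200 s t := by
  have hL := schedule_L_le (s := s) (t := t) (by omega)
  have hT := schedule_T_le (s := s) (t := t) (by omega)
  have hℓ := schedule_ℓ_le hs ht
  have hsL := le_two_pow_schedule_L s t
  have htT := le_two_pow_schedule_T s t
  generalize schedule s t = P at *
  have hX : P.stageFactor s t ≤ 2 ^ (P.L + P.T + 1 + (2 * P.ℓ + 7) * (P.T + 1)) := by
    have h1 : s + t + 2 ≤ 2 ^ P.L * 2 ^ P.T * 2 := by
      calc s + t + 2 ≤ s * t * 2 := by nlinarith
        _ ≤ _ := by gcongr
    calc P.stageFactor s t ≤ 2 ^ P.L * 2 ^ P.T * 2 * (2 ^ (2 * P.ℓ + 7)) ^ (P.T + 1) :=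
          Nat.mul_le_mul_right _ h1
      _ = _ := by rw [← pow_mul, ← pow_add, ← pow_succ, ← pow_add]
  have hX' := Nat.pow_le_pow_left hX (P.L + 1)
  rw [← pow_mul] at hX'
  calc _ ≤ (((2 ^ ((P.L + P.T + 1 + (2 * P.ℓ + 7) * (P.T + 1)) * (P.L + 1)) : ℕ)) : ℝ) :=
        Nat.cast_le.2 hX'
    _ = (2 : ℝ) ^ (((P.L + P.T + 1 + (2 * P.ℓ + 7) * (P.T + 1)) * (P.L + 1) : ℝ)) := by
        rw [Nat.cast_pow, ← Real.rpow_natCast]; push_cast; rfl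
    _ ≤ queryBound 1200 s t := by
        rw [queryBound_eq _ (by omega) (by omega)]
        exact Real.rpow_le_rpow_of_exponent_le (by norm_num)
          (schedule_exponent_le hs ht (Nat.cast_nonneg _) (Nat.cast_nonneg _) hL hT hℓ)

end Logs

/-! ### The law of the cover -/

section Law

variable (P : Schedule) (I : SetSystem)

/-- Set all coins that play no role to `true`. -/
def mask (x : Key → Bool) (k : Key) : Bool := if k ∈ keySet P I then x k else true

/-- The cover computed from a random tape. -/
noncomputable def tapeCover (ω : ℕ → Bool) : Finset ℕ :=
  cover P I (mask P I (coins P.expo tapePos ω))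

variable {P I}

/-- A coin without bits is an empty conjunction, hence `true`, matching the forced value in `coin`.
-/
lemma readsCoins (ω : ℕ → Bool) : ReadsCoins P I ω (mask P I (coins P.expo tapePos ω)) := by
  intro k hk
  rw [Schedule.coin, mask, if_pos hk]
  by_cases h : P.expo k = 0
  · simp [coins, h]
  · simp [h]

/-- Masking makes the cover a function of finitely many coins, and it agrees with `mean`, whose base
point is constantly `true`. -/
lemma integral_tapeCover :
    MeasureTheory.Integrable (fun ω => (#(tapeCover P I ω) : ℝ)) tapeMeasure ∧
      ∫ ω, (#(tapeCover P I ω) : ℝ) ∂tapeMeasure = mean P I fun x => (#(cover P I x) : ℝ) := by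
  have h := integral_coins (expo := P.expo) (pos := tapePos) tapePos_injective (keySet P I).toList
    (fun x => (#(cover P I (mask P I x)) : ℝ)) (fun x y hxy => by
      have : mask P I x = mask P I y := by
        funext k
        unfold mask
        split_ifs with hk
        · exact hxy k (mem_toList.2 hk)
        · rfl
      simp only [this]) fun _ => true
  refine ⟨h.1, h.2.trans (expect_congr _ fun y hy => ?_)⟩
  have : mask P I y = y := by
    funext k
    unfold mask
    split_ifs with hk
    · rfl
    · exact (hy k (mt mem_toList.1 hk)).symm
  simp only [this]

lemma opt_nonneg : 0 ≤ I.opt := by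
  refine Real.sInf_nonneg ?_
  rintro v ⟨x, hx, rfl⟩
  exact sum_nonneg hx.1

lemma answers_algorithm {s t : ℕ} (hs : 2 ≤ s) (ht : 2 ≤ t) (hI : I.Bounded s t)
    (R : I.Representation) (ω : ℕ → Bool) {S : ℕ} (hS : S ∈ I.sets) :
    algorithm.Answers s t S R ω (queryBound 1200 s t)
      (decide (S ∈ tapeCover (schedule s t) I ω)) := by
  classical
  obtain ⟨v, ⟨q, hq, hev⟩, hv⟩ := evLe_top (R := R) hI (readsCoins ω) costBound hS le_rfl
    (P := schedule s t)
  refine ⟨q, ?_, le_trans ?_ (stageFactor_pow_le hs ht)⟩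
  · have hrun := hev.answers (A := algorithm) (s := s) (t := t) (S := S) fun _ => rfl
    convert hrun using 2
    rw [hv, tapeCover, cover, mem_filter, FailSet]
    constructor
    · rintro ⟨-, ⟨τ, h1, h2⟩ | ⟨τ, h1, h2⟩⟩
      · exact ⟨τ, h1, Or.inl h2⟩
      · exact ⟨τ, h1, Or.inr h2⟩
    · rintro ⟨τ, h1, h2 | h2⟩
      · exact ⟨hS, Or.inl ⟨τ, h1, h2⟩⟩
      · exact ⟨hS, Or.inr ⟨τ, h1, h2⟩⟩
  · rw [← aliveCost_numRounds]
    exact_mod_cast hq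

lemma integral_card_tapeCover_le {s t : ℕ} (hs : 2 ≤ s) (ht : 2 ≤ t) (hI : I.Bounded s t) :
    ∫ ω, (#(tapeCover (schedule s t) I ω) : ℝ) ∂tapeMeasure ≤
      1200 * Real.logb 2 s * I.opt := by
  have hsL := le_two_pow_schedule_L s t
  have htT := le_two_pow_schedule_T s t
  have hfail := Schedule.failBound_le hsL htT (pow_four_le_two_pow_schedule_ℓ s t)
  have hs1 : 1 ≤ s := by omega
  have ht1 : 1 ≤ t := by omega
  have hslack := (Schedule.mul_slack_le (P := schedule s t) hs1 ht1).trans hfail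
  rw [integral_tapeCover.2]
  refine (mean_cover_le hI hsL htT hs1 ht1 hslack hfail).trans ?_
  refine mul_le_mul_of_nonneg_right ?_ opt_nonneg
  have := schedule_L_le (s := s) (t := t) hs1
  have := one_le_logb hs
  linarith

end Law

end LocalSetCover

theorem theorem1 :
    ∃ (C : ℝ) (A : LocalAlgorithm), 0 < C ∧
      ∀ s t : ℕ, 2 ≤ s → 2 ≤ t → ∀ I : SetSystem, I.Bounded s t →
        ∃ D : (ℕ → Bool) → Finset ℕ,
          (∀ ω, I.IsCover (D ω)) ∧
          (∀ (R : I.Representation) (ω : ℕ → Bool), ∀ S ∈ I.sets,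
            A.Answers s t S R ω (queryBound C s t) (decide (S ∈ D ω))) ∧
          MeasureTheory.Integrable (fun ω => ((D ω).card : ℝ)) tapeMeasure ∧
          ∫ ω, ((D ω).card : ℝ) ∂tapeMeasure ≤ C * Real.logb 2 s * I.opt := by
  classical
  -- The constant is chosen for the query exponent; for the expected size `28 * (L + 1) ≤ 84 * log
  -- s` would do.
  refine ⟨1200, LocalSetCover.algorithm, by norm_num, fun s t hs ht I hI =>
    ⟨LocalSetCover.tapeCover (LocalSetCover.schedule s t) I,
      fun ω => LocalSetCover.isCover_cover _ _ _, fun R ω S hS => ?_,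
      LocalSetCover.integral_tapeCover.1, LocalSetCover.integral_card_tapeCover_le hs ht hI⟩⟩
  convert LocalSetCover.answers_algorithm hs ht hI R ω hS
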